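/- \textbf{Setting.} For each $N\ge1$ let $(X^{(\lambda)})_{\lambda\in\Lambda}$ be a family of independent $N\times N$ Wigner matrices $X^{(\lambda)}=\frac1{\sqrt N}(x^{(\lambda)}_{ij})$: Hermitian, with independent centered complex entries $x^{(\lambda)}_{ij}$, $i\le j$, having finite moments of all orders, the law of $x_{ij}^{(\lambda)}$ not depending on $N$, and identically distributed diagonal entries. Assume that $\mathrm E|x^{(\lambda)}_{ij}|^2=1$ for $i\ne j$ and that each $X^{(\lambda)}$ is invariant in law under conjugation by permutation matrices. Let $(A^{(b)})_{b\in J}$ be deterministic $N\times N$ matrices with $\sup_N\|A^{(b)}\|<\infty$ (operator norm) for each $b$. Fix $n$ and integers $p_1,\dots,p_n\ge 1$, let $K=\{(j,k): 1\le j\le n,\ 1\le k\le p_j\}$, choose for each $\kappa\in K$ a Wigner matrix $X_\kappa$ and a deterministic matrix $A_\kappa$ of these families (repetitions allowed), put $M_j=X_{(j,1)}A_{(j,1)}\cdots X_{(j,p_j)}A_{(j,p_j)}$ and $$\tau^{(1)}=\mathrm E\Big[\prod_{j=1}^n\tfrac1N\mathrm{Tr}\,M_j\Big],\qquad \tau^{(2)}=\mathrm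 E\Big[\prod_{j=1}^n\big(\mathrm{Tr}\,M_j-\mathrm E\,\mathrm{Tr}\,M_j\big)\Big].$$ \textbf{Graphs.} Let $T=T_1\sqcup\dots\sqcup T_n$ be the directed graph with vertex set $V=\{\kappa,\kappa':\kappa\in K\}$ and, for each $\kappa=(j,k)$, an edge $e_{\kappa,x}=(\kappa',\kappa)$ and an edge $e_{\kappa,a}=(\kappa^+,\kappa')$, where an edge is written (source, target) and $\kappa^+=(j,k+1)$ with $k+1$ taken cyclically modulo $p_j$; $T_j$ is the cycle formed by the edges with first index $j$. For a partition $\pi$ of $V$, let $T^\pi$ be the quotient graph obtained by identifying the vertices in a same block (all edges are kept), $V^\pi$ its vertex set, and $T^\pi_X$, $T_A^\pi$ its subgraphs, on all of $V^\pi$, formed by the edges $e_{\kappa,x}$ and $e_{\kappa,a}$ respectively. Let $\mathfrak f(T_A^\pi)$ be the number of leaves of the forest whose vertices are the two-edge connected components of $T^\pi_A$ and whose edges are the cutting edges of $T_A^\pi$, a tree of this forest that consists of a single vertex being counted as two leaves. The graph $\mathcal{GDC}(T^\pi)$ has as vertices the elements of $V^\pi$ together with the connected components of $T_A^\pi$,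 and as edges those of $T_X^\pi$ together with one edge from each $v\in V^\pi$ to the component of $T_A^\pi$ containing $v$. Its connected components $\mathcal{GDC}_i$ correspond to the connected components of $T^\pi$. For each $i$, let $q_{1,i}$ be the number of edges of $T_X^\pi$ in $\mathcal{GDC}_i$ counted without multiplicity (edges with the same unordered pair of end points are counted once) minus half their number counted with multiplicity, and let $q_{2,i}$ be the number of vertices of $\mathcal{GDC}_i$ minus the number of its edges counted without multiplicity (a loop being an edge). The $i$-th component of $T^\pi$ is of \emph{double tree type} if $(q_{1,i},q_{2,i})=(0,1)$, of \emph{double unicyclic type} if $(q_{1,i},q_{2,i})=(0,0)$, and of \emph{2-4 tree type} if $(q_{1,i},q_{2,i})=(-1,1)$. Let $\mathcal{DT}_n$ be the set of partitions $\pi$ of $V$ such that $T^\pi$ has exactly $n$ connected components, all of double tree type, and let $\mathcal{DUFT}$ be the set of partitions $\pi$ of $V$ such that each component of $T^\pi$ is of double unicyclic type or of 2-4 tree type. \textbf{Weights.} For $N\ge|V^\pi|$ and any injective map $\psi_0:V^\pi\to[N]$ (the values do not depend on its choice), put $Y_j=\prod_{k=1}^{p_j}x_{(j,k)}\big(\psi_0(\mathrm{trg}),\psi_0(\mathrm{src})\big)$,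 where $x_\kappa=\sqrt N X_\kappa$ and $\mathrm{trg},\mathrm{src}$ are the target and source in $T^\pi$ of the edge $e_{(j,k),x}$, and $$\omega_X^{(1)}(\pi)=\mathrm E\Big[\prod_{j=1}^nY_j\Big],\qquad \omega_X^{(2)}(\pi)=\sum_{S\subset[n]}(-1)^{n-|S|}\,\mathrm E\Big[\prod_{j\in S}Y_j\Big]\prod_{j\notin S}\mathrm E[Y_j],$$ $$\omega_A(\pi)=N^{-\mathfrak f(T_A^\pi)/2}\sum_{\psi:V^\pi\to[N]\text{ injective}}\ \prod_{\kappa\in K}A_\kappa\big(\psi(\mathrm{trg}\,e_{\kappa,a}),\psi(\mathrm{src}\,e_{\kappa,a})\big).$$ \textbf{Proposition.} As $N\to\infty$, $$\tau^{(1)}=\sum_{\pi\in\mathcal{DT}_n}\omega^{(1)}_X(\pi)\,\omega_A(\pi)+o(1),\qquad \tau^{(2)}=\sum_{\pi\in\mathcal{DUFT}}\omega^{(2)}_X(\pi)\,\omega_A(\pi)+o(1).$$ Moreover the first-order asymptotics are universal: if $(\widetilde X^{(\lambda)})_{\lambda\in\Lambda}$ is any other family of Wigner matrices that satisfies the same assumptions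 (for instance a Gaussian one), and $\widetilde\tau^{(1)}$ is the corresponding statistic with the same words and the same deterministic matrices, then $\tau^{(1)}-\widetilde\tau^{(1)}\to0$. -/

import Mathlib

open MeasureTheory ProbabilityTheory Filter Topology

noncomputable section

namespace WignerTraffic

/-! ## Directed multigraphs -/

/-- A directed multigraph with vertex set `W` and edges indexed by `F`; loops and multiple edges
are allowed. -/
structure EdgeGraph (W F : Type*) where
  src : F → W
  trg : F → W

namespace EdgeGraph

variable {W F : Type*}

/-- The unordered pair of end points of an edge. Two edges are twin when these pairs agree. -/
def ends (G : EdgeGraph W F) (e : F) : Sym2 W := s(G.src e, G.trg e)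

/-- The underlying undirected simple graph, used only to speak about connectivity. -/
def toSimple (G : EdgeGraph W F) : SimpleGraph W :=
  SimpleGraph.fromRel fun u v => ∃ e, G.src e = u ∧ G.trg e = v

/-- The connected components. -/
abbrev Comp (G : EdgeGraph W F) : Type _ := G.toSimple.ConnectedComponent

/-- The connected component of a vertex. -/
def compMk (G : EdgeGraph W F) (v : W) : G.Comp := G.toSimple.connectedComponentMk v

/-- The subgraph with all the vertices, and with the edges in `s` only. -/
def restrict (G : EdgeGraph W F) (s : Set F) : EdgeGraph W s where
  src e := G.src e
  trg e := G.trg e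

/-- The quotient graph: vertices in a same block of `π` are identified, all edges are kept. -/
def quot (G : EdgeGraph W F) (π : Setoid W) : EdgeGraph (Quotient π) F where
  src e := Quotient.mk π (G.src e)
  trg e := Quotient.mk π (G.trg e)

/-- The graph on the same vertices that has the edges of both graphs. -/
def union {F' : Type*} (G : EdgeGraph W F) (H : EdgeGraph W F') : EdgeGraph W (F ⊕ F') where
  src := Sum.elim G.src H.src
  trg := Sum.elim G.trg H.trg

/-- A cutting edge: its removal increases the number of connected components. -/
def IsCutting (G : EdgeGraph W F) (e : F) : Prop :=
  Nat.card G.Comp < Nat.card (G.restrict {f | f ≠ e}).Comp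

/-- The graph without its cutting edges. Its connected components are the two-edge connected
components of `G`. -/
def core (G : EdgeGraph W F) : EdgeGraph W {e | ¬ G.IsCutting e} :=
  G.restrict {e | ¬ G.IsCutting e}

/-- The forest of two-edge connected components: the vertices are the two-edge connected
components of `G`, the edges are the cutting edges of `G`. -/
def tec (G : EdgeGraph W F) : EdgeGraph G.core.Comp {e | G.IsCutting e} where
  src e := G.core.compMk (G.src e)
  trg e := G.core.compMk (G.trg e)

/-- The degree of a vertex (a loop counts twice). -/
def degree (G : EdgeGraph W F) (v : W) : ℕ :=
  Set.ncard {e | G.src e = v} + Set.ncard {e | G.trg e = v}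

/-- The number `𝔣(G)` of leaves of the forest of two-edge connected components, a component of the
forest that consists of a single vertex being counted as two leaves. -/
def numLeaves (G : EdgeGraph W F) : ℕ :=
  Set.ncard {t | G.tec.degree t = 1} + 2 * Set.ncard {t | G.tec.degree t = 0}

end EdgeGraph

/-! ## The union of cycles `T = T₁ ⊔ ⋯ ⊔ Tₙ` and its quotients -/

section Cycles

variable {n : ℕ}

/-- The positions `(j, k)`, `k ∈ [p j]`, of the letters of the `n` words. -/
abbrev Pos (p : Fin n → ℕ) : Type := Σ j : Fin n, Fin (p j)

/-- The vertices of `T`: `Sum.inl k` is the vertex `k`, and `Sum.inr k` is the vertex `k'`. -/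
abbrev Vtx (p : Fin n → ℕ) : Type := Pos p ⊕ Pos p

/-- The cyclic successor of a position inside its word. -/
def next (p : Fin n → ℕ) (k : Pos p) : Pos p := ⟨k.1, finRotate (p k.1) k.2⟩

/-- The subgraph `T_X`: for each position an edge from `k'` to `k`. -/
def cycX (p : Fin n → ℕ) : EdgeGraph (Vtx p) (Pos p) where
  src := Sum.inr
  trg := Sum.inl

/-- The subgraph `T_A`: for each position an edge from `k + 1` to `k'`. -/
def cycA (p : Fin n → ℕ) : EdgeGraph (Vtx p) (Pos p) where
  src k := Sum.inl (next p k)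
  trg := Sum.inr

/-- The graph `T`. -/
def cyc (p : Fin n → ℕ) : EdgeGraph (Vtx p) (Pos p ⊕ Pos p) := (cycX p).union (cycA p)

variable {p : Fin n → ℕ}

/-- The graph of deterministic components of `T^π`. Its vertices are those of `T^π` and the
connected components of `T^π_A`; its edges are those of `T^π_X` and, for each vertex of `T^π`, an
edge that joins it to its component in `T^π_A`. -/
def gdc (π : Setoid (Vtx p)) :
    EdgeGraph (Quotient π ⊕ ((cycA p).quot π).Comp) (Pos p ⊕ Quotient π) where
  src := Sum.elim (fun k => Sum.inl (((cycX p).quot π).src k)) Sum.inl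
  trg := Sum.elim (fun k => Sum.inl (((cycX p).quot π).trg k))
    (fun v => Sum.inr (((cycA p).quot π).compMk v))

/-- For the component `i` of the graph of deterministic components, the number of edges that come
from `T^π_X` counted without multiplicity, minus half the number of these edges counted with
multiplicity. -/
def q₁ (π : Setoid (Vtx p)) (i : (gdc π).Comp) : ℚ :=
  (Set.ncard {s : Sym2 (Quotient π ⊕ ((cycA p).quot π).Comp) |
      ∃ k : Pos p, (gdc π).compMk ((gdc π).src (Sum.inl k)) = i ∧ (gdc π).ends (Sum.inl k) = s} : ℚ)
    - (Set.ncard {k : Pos p | (gdc π).compMk ((gdc π).src (Sum.inl k)) = i} : ℚ) / 2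

/-- For the component `i` of the graph of deterministic components, the number of vertices minus
the number of edges counted without multiplicity. A loop is an edge. -/
def q₂ (π : Setoid (Vtx p)) (i : (gdc π).Comp) : ℚ :=
  (Set.ncard {w | (gdc π).compMk w = i} : ℚ)
    - (Set.ncard {s : Sym2 (Quotient π ⊕ ((cycA p).quot π).Comp) |
        ∃ e, (gdc π).compMk ((gdc π).src e) = i ∧ (gdc π).ends e = s} : ℚ)

/-- Double tree type. -/
def IsDoubleTree (π : Setoid (Vtx p)) (i : (gdc π).Comp) : Prop := q₁ π i = 0 ∧ q₂ π i = 1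

/-- Double unicyclic type. -/
def IsDoubleUnicyclic (π : Setoid (Vtx p)) (i : (gdc π).Comp) : Prop := q₁ π i = 0 ∧ q₂ π i = 0

/-- 2-4 tree type. -/
def IsTwoFourTree (π : Setoid (Vtx p)) (i : (gdc π).Comp) : Prop := q₁ π i = -1 ∧ q₂ π i = 1

/-- The partitions `π` such that `T^π` has `c` connected components, all of double tree type. -/
def DT (p : Fin n → ℕ) (c : ℕ) : Set (Setoid (Vtx p)) :=
  {π | Nat.card ((cyc p).quot π).Comp = c ∧ ∀ i, IsDoubleTree π i}

/-- The partitions `π` such that all the components of `T^π` are of double unicyclic type or of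
2-4 tree type. -/
def DUFT (p : Fin n → ℕ) : Set (Setoid (Vtx p)) :=
  {π | ∀ i, IsDoubleUnicyclic π i ∨ IsTwoFourTree π i}

/-- A finite set has finitely many partitions. -/
instance finite_setoid {V : Type*} [Finite V] : Finite (Setoid V) :=
  Finite.of_injective (fun π : Setoid V => fun a b => π a b)
    fun _ _ h => Setoid.ext fun a b => iff_of_eq (congrFun (congrFun h a) b)

/-- The finite set of partitions that belong to `S`. -/
def partitions (S : Set (Setoid (Vtx p))) : Finset (Setoid (Vtx p)) := S.toFinite.toFinset

end Cycles

/-! ## Wigner matrices -/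

/-- `x N l` is the unnormalized version of the `N × N` Wigner matrix labelled `l`. The matrices with
the different labels are independent. -/
structure IsWignerFamily {Λ : Type*} {Ω : ℕ → Type*} [∀ N, MeasurableSpace (Ω N)]
    (μ : ∀ N, Measure (Ω N)) (x : ∀ N, Λ → Ω N → Matrix (Fin N) (Fin N) ℂ) : Prop where
  hermitian : ∀ N l, ∀ᵐ ω ∂μ N, (x N l ω).IsHermitian
  memLp : ∀ N l i j (k : ℕ), MemLp (fun ω => x N l ω i j) k (μ N)
  centered : ∀ N l i j, ∫ ω, x N l ω i j ∂μ N = 0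
  /-- The matrices are independent, each with independent sub-diagonal entries. -/
  indep : ∀ N, iIndepFun
    (fun (e : Λ × {ij : Fin N × Fin N // ij.1 ≤ ij.2}) ω => x N e.1 ω e.2.1.1 e.2.1.2) (μ N)
  diag_identDistrib : ∀ N l i i',
    IdentDistrib (fun ω => x N l ω i i) (fun ω => x N l ω i' i') (μ N) (μ N)
  /-- The law of the entry `(i, j)` does not depend on the size of the matrix. -/
  law_eq : ∀ N N' l (i j : Fin N) (i' j' : Fin N'), (i : ℕ) = i' → (j : ℕ) = j' →
    IdentDistrib (fun ω => x N l ω i j) (fun ω => x N' l ω i' j') (μ N) (μ N')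

/-- The assumptions on the Wigner matrices: normalized variance of the off-diagonal entries, and
invariance in law by conjugation by permutation matrices. -/
structure WignerHypothesis {Λ : Type*} {Ω : ℕ → Type*} [∀ N, MeasurableSpace (Ω N)]
    (μ : ∀ N, Measure (Ω N)) (x : ∀ N, Λ → Ω N → Matrix (Fin N) (Fin N) ℂ) : Prop
    extends IsWignerFamily μ x where
  variance : ∀ N l i j, i ≠ j → ∫ ω, ‖x N l ω i j‖ ^ 2 ∂μ N = 1
  perm_invariant : ∀ N l (σ : Equiv.Perm (Fin N)),
    IdentDistrib (fun ω (i j : Fin N) => x N l ω (σ i) (σ j)) (fun ω (i j : Fin N) => x N l ω i j)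
      (μ N) (μ N)

/-- The operator norm of a complex matrix, with respect to the Euclidean norm. -/
def opNorm {N : ℕ} (B : Matrix (Fin N) (Fin N) ℂ) : ℝ := ‖Matrix.toEuclideanCLM (𝕜 := ℂ) B‖

/-! ## The statistics and the weights -/

section Stat

variable {n : ℕ} {Λ J : Type*} {Ω : ℕ → Type*} [∀ N, MeasurableSpace (Ω N)]

/-- The normalized Wigner matrix `X = x / √N`. -/
def normalized (x : ∀ N, Λ → Ω N → Matrix (Fin N) (Fin N) ℂ) (N : ℕ) (l : Λ) (ω : Ω N) :
    Matrix (Fin N) (Fin N) ℂ :=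
  ((Real.sqrt N : ℝ) : ℂ)⁻¹ • x N l ω

variable (p : Fin n → ℕ) (l : Pos p → Λ) (a : Pos p → J) (μ : ∀ N, Measure (Ω N))
  (x : ∀ N, Λ → Ω N → Matrix (Fin N) (Fin N) ℂ) (A : ∀ N, J → Matrix (Fin N) (Fin N) ℂ)

/-- The `j`-th word `X A X A ⋯ X A`, with `p j` factors `X A`; the labels of the matrices at each
position are given by `l` and `a`. -/
def word (N : ℕ) (j : Fin n) (ω : Ω N) : Matrix (Fin N) (Fin N) ℂ :=
  (List.ofFn fun k : Fin (p j) => normalized x N (l ⟨j, k⟩) ω * A N (a ⟨j, k⟩)).prod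

/-- `τ⁽¹⁾`: the expected product of the normalized traces. -/
def tau₁ (N : ℕ) : ℂ :=
  ∫ ω, ∏ j : Fin n, (1 / (N : ℂ)) * (word p l a x A N j ω).trace ∂μ N

/-- `τ⁽²⁾`: the expected product of the centered traces. -/
def tau₂ (N : ℕ) : ℂ :=
  ∫ ω, ∏ j : Fin n, ((word p l a x A N j ω).trace
    - ∫ ω', (word p l a x A N j ω').trace ∂μ N) ∂μ N

variable {p}

/-- The product of the unnormalized entries of the Wigner matrices over the edges of `T_j^π`. -/
def entryProd {N : ℕ} (π : Setoid (Vtx p)) (ψ : Quotient π → Fin N) (j : Fin n) (ω : Ω N) : ℂ :=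
  ∏ k : Fin (p j), x N (l ⟨j, k⟩) ω (ψ (((cycX p).quot π).trg ⟨j, k⟩))
    (ψ (((cycX p).quot π).src ⟨j, k⟩))

open Classical in
/-- `ω_X⁽¹⁾(π)`, for an arbitrary choice of an injective map from the vertices of `T^π` to `[N]`;
when there is none, that is when `N` is too small, the value is `0`. -/
def omegaX₁ (N : ℕ) (π : Setoid (Vtx p)) : ℂ :=
  if h : Nonempty (Quotient π ↪ Fin N) then
    ∫ ω, ∏ j : Fin n, entryProd l x π h.some j ω ∂μ N
  else 0

open Classical in
/-- `ω_X⁽²⁾(π)`, with the same convention. -/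
def omegaX₂ (N : ℕ) (π : Setoid (Vtx p)) : ℂ :=
  if h : Nonempty (Quotient π ↪ Fin N) then
    ∑ S : Finset (Fin n), (∫ ω, ∏ j ∈ S, entryProd l x π h.some j ω ∂μ N)
      * (-1) ^ (n - S.card) * ∏ j ∈ Sᶜ, ∫ ω, entryProd l x π h.some j ω ∂μ N
  else 0

open Classical in
/-- The injective trace `Tr⁰[T_A^π]`. -/
def injTraceA (N : ℕ) (π : Setoid (Vtx p)) : ℂ :=
  ∑ ψ : Quotient π ↪ Fin N, ∏ k : Pos p,
    A N (a k) (ψ (((cycA p).quot π).trg k)) (ψ (((cycA p).quot π).src k))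

/-- `ω_A(π) = N ^ (- 𝔣(T_A^π) / 2) Tr⁰[T_A^π]`. -/
def omegaA (N : ℕ) (π : Setoid (Vtx p)) : ℂ :=
  (((N : ℝ) ^ (-(((cycA p).quot π).numLeaves : ℝ) / 2) : ℝ) : ℂ) * injTraceA a A N π

end Stat

end WignerTraffic

end

noncomputable section

namespace WignerTraffic

/-! ## Traces of products of matrices -/

section TraceExpansion

variable {N : ℕ}

/-- The cyclic successor of a position in a family of cyclic words. -/
def cycNext {ι : Type*} (q : ι → ℕ) (a : Σ c, Fin (q c)) : Σ c, Fin (q c) :=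
  ⟨a.1, finRotate (q a.1) a.2⟩

theorem prod_ofFn_apply {m : ℕ} (C : Fin m → Matrix (Fin N) (Fin N) ℂ) (u v : Fin N) :
    (List.ofFn C).prod u v = ∑ y : Fin (m + 1) → Fin N,
      if y 0 = u ∧ y (Fin.last m) = v then ∏ k : Fin m, C k (y k.castSucc) (y k.succ) else 0 := by
  induction m generalizing u with
  | zero =>
    simp only [List.ofFn_zero, List.prod_nil, Matrix.one_apply]
    rw [← (Equiv.funUnique (Fin 1) (Fin N)).symm.sum_comp]
    simp [ite_and]
  | succ m ih =>
    rw [List.ofFn_succ, List.prod_cons, Matrix.mul_apply]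
    rw [← (Fin.consEquiv (fun _ : Fin (m + 2) => Fin N)).sum_comp, Fintype.sum_prod_type]
    simp only [ih, Fin.consEquiv, Equiv.coe_fn_mk, Fin.cons_zero, Finset.mul_sum]
    rw [Finset.sum_comm]
    rw [Finset.sum_comm (s := Finset.univ (α := Fin N))]
    refine Finset.sum_congr rfl fun y _ => ?_
    have h1 : ∀ x : Fin N, (Fin.cons x y : Fin (m + 2) → Fin N) (Fin.last (m + 1)) = y (Fin.last m) :=
      fun x => by rw [← Fin.succ_last, Fin.cons_succ]
    simp only [h1, Fin.prod_univ_succ, Fin.castSucc_zero, Fin.cons_zero, Fin.cons_succ,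
      ← Fin.succ_castSucc, ite_and, mul_ite, mul_zero]
    rw [Finset.sum_ite_eq, Finset.sum_ite_eq']
    simp

/-- The path closes up when its last vertex equals its first one. Positivity of `m` matters: the
empty product has trace `N`, while the right side would be `1`. -/
theorem trace_prod_ofFn {m : ℕ} (hm : 0 < m) (C : Fin m → Matrix (Fin N) (Fin N) ℂ) :
    (List.ofFn C).prod.trace = ∑ y : Fin m → Fin N, ∏ k, C k (y k) (y (finRotate m k)) := by
  obtain ⟨m, rfl⟩ : ∃ k, m = k + 1 := ⟨m - 1, by omega⟩
  simp only [Matrix.trace, Matrix.diag, prod_ofFn_apply]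
  rw [Finset.sum_comm, ← (Fin.snocEquiv (fun _ : Fin (m + 2) => Fin N)).sum_comp,
    Fintype.sum_prod_type, Finset.sum_comm]
  refine Finset.sum_congr rfl fun y _ => ?_
  simp only [Fin.snocEquiv, Equiv.coe_fn_mk, Fin.snoc_last, Fin.snoc_castSucc, ite_and]
  have h0 : ∀ x : Fin N, (Fin.snoc y x : Fin (m + 2) → Fin N) 0 = y 0 := fun x => by
    rw [← Fin.castSucc_zero, Fin.snoc_castSucc]
  simp only [h0, Finset.sum_ite_eq, Finset.mem_univ, if_true, Finset.sum_ite_eq']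
  rw [Fin.prod_univ_castSucc, Fin.prod_univ_castSucc]
  congr 1
  · refine Finset.prod_congr rfl fun k _ => ?_
    have : (Fin.snoc y (y 0) : Fin (m + 2) → Fin N) k.castSucc.succ = y k.succ := by
      rw [Fin.succ_castSucc, Fin.snoc_castSucc]
    rw [this, finRotate_apply, Fin.coeSucc_eq_succ]
  · simp

theorem prod_trace_prod_ofFn {ι : Type*} [Fintype ι] [DecidableEq ι] {q : ι → ℕ}
    (hq : ∀ c, 0 < q c) (C : (Σ c, Fin (q c)) → Matrix (Fin N) (Fin N) ℂ) :
    ∏ c, (List.ofFn fun k => C ⟨c, k⟩).prod.trace =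
      ∑ y : (Σ c, Fin (q c)) → Fin N, ∏ a, C a (y a) (y (cycNext q a)) := by
  simp only [fun c => trace_prod_ofFn (hq c) (fun k => C ⟨c, k⟩)]
  rw [Finset.prod_univ_sum, Fintype.piFinset_univ,
    ← (Equiv.piCurry (fun (c : ι) (_ : Fin (q c)) => Fin N)).sum_comp]
  refine Finset.sum_congr rfl fun y _ => ?_
  rw [Fintype.prod_sigma]
  rfl

end TraceExpansion

/-! ## Operator norm bounds for traces -/

section Norms

open scoped Matrix.Norms.L2Operator

variable {N : ℕ}

theorem norm_apply_le_opNorm (B : Matrix (Fin N) (Fin N) ℂ) (i j : Fin N) : ‖B i j‖ ≤ ‖B‖ := by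
  have h := B.l2_opNorm_mulVec (EuclideanSpace.single j 1)
  have h2 : ‖((EuclideanSpace.equiv (Fin N) ℂ).symm <| B.mulVec (EuclideanSpace.single j (1:ℂ))) i‖
      ≤ ‖B‖ := by
    refine (PiLp.norm_apply_le _ i).trans (h.trans ?_)
    simp
  simpa using h2

theorem norm_trace_le (B : Matrix (Fin N) (Fin N) ℂ) : ‖B.trace‖ ≤ N * ‖B‖ := by
  refine (norm_sum_le _ _).trans ((Finset.sum_le_sum fun i _ => norm_apply_le_opNorm B i i).trans ?_)
  simp

theorem norm_bilin_le_opNorm (B : Matrix (Fin N) (Fin N) ℂ) (u v : EuclideanSpace ℂ (Fin N)) :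
    ‖∑ i, ∑ j, u i * B i j * v j‖ ≤ ‖B‖ * ‖u‖ * ‖v‖ := by
  have h := B.l2_opNorm_mulVec v
  have e : ∑ i, ∑ j, u i * B i j * v j = inner ℂ
      (WithLp.toLp 2 (fun i => star (u i)) : EuclideanSpace ℂ (Fin N))
      ((EuclideanSpace.equiv (Fin N) ℂ).symm (B.mulVec v)) := by
    simp [PiLp.inner_apply, Matrix.mulVec, dotProduct, Finset.mul_sum, mul_comm, mul_assoc, mul_left_comm]
  have e2 : ‖(WithLp.toLp 2 fun i => star (u i) : EuclideanSpace ℂ (Fin N))‖ = ‖u‖ := by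
    simp [EuclideanSpace.norm_eq]
  rw [e]
  refine (norm_inner_le_norm _ _).trans ?_
  rw [e2, mul_comm ‖B‖, mul_assoc]
  exact mul_le_mul_of_nonneg_left h (norm_nonneg _)

theorem norm_bilin_le (B : Matrix (Fin N) (Fin N) ℂ) (u v : Fin N → ℂ) (hu : ∀ i, ‖u i‖ ≤ 1)
    (hv : ∀ i, ‖v i‖ ≤ 1) : ‖∑ i, ∑ j, u i * B i j * v j‖ ≤ N * ‖B‖ := by
  have hn : ∀ w : Fin N → ℂ, (∀ i, ‖w i‖ ≤ 1) →
      ‖(WithLp.toLp 2 w : EuclideanSpace ℂ (Fin N))‖ ≤ Real.sqrt N := by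
    intro w hw
    rw [EuclideanSpace.norm_eq]
    refine Real.sqrt_le_sqrt ((Finset.sum_le_sum fun i _ =>
      pow_le_one₀ (norm_nonneg _) (hw i)).trans ?_)
    simp
  refine (norm_bilin_le_opNorm B (WithLp.toLp 2 u) (WithLp.toLp 2 v)).trans ?_
  calc _ ≤ ‖B‖ * Real.sqrt N * Real.sqrt N := by
        gcongr
        exacts [hn u hu, hn v hv]
    _ = N * ‖B‖ := by rw [mul_assoc, Real.mul_self_sqrt (Nat.cast_nonneg _), mul_comm]

/-- Testing with the conjugate of `w = B v` turns the form into `‖w‖ ^ 2`, and one factor `‖w‖`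
cancels. -/
theorem opNorm_le_of_bilin {B : Matrix (Fin N) (Fin N) ℂ} {c : ℝ} (hc : 0 ≤ c)
    (h : ∀ u v : EuclideanSpace ℂ (Fin N), ‖∑ i, ∑ j, u i * B i j * v j‖ ≤ c * ‖u‖ * ‖v‖) :
    ‖B‖ ≤ c := by
  rw [← Matrix.l2_opNorm_toEuclideanCLM]
  refine ContinuousLinearMap.opNorm_le_bound _ hc fun v => ?_
  set w := Matrix.toEuclideanCLM (𝕜 := ℂ) B v with hw
  have h1 := h (WithLp.toLp 2 fun i => star (w i)) v
  have e : ∑ i, ∑ j, (WithLp.toLp 2 fun i => star (w i) : EuclideanSpace ℂ (Fin N)) i * B i j * v j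
      = inner ℂ w w := by
    have : ∀ i, w i = ∑ j, B i j * v j := fun i => by
      simp [hw, Matrix.mulVec, dotProduct]
    rw [PiLp.inner_apply]
    refine Finset.sum_congr rfl fun i _ => ?_
    rw [RCLike.inner_apply]
    conv_rhs => lhs; rw [this i]
    rw [Finset.sum_mul]
    refine Finset.sum_congr rfl fun j _ => ?_
    simp only [RCLike.star_def]
    ring
  have e2 : ‖(WithLp.toLp 2 fun i => star (w i) : EuclideanSpace ℂ (Fin N))‖ = ‖w‖ := by
    simp [EuclideanSpace.norm_eq]
  rw [e, e2, inner_self_eq_norm_sq_to_K] at h1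
  rcases (norm_nonneg w).eq_or_lt with h0 | h0
  · rw [← h0]; positivity
  · have h2 : ‖w‖ * ‖w‖ ≤ (c * ‖v‖) * ‖w‖ := by
      calc ‖w‖ * ‖w‖ = ‖((‖w‖ : ℂ)) ^ 2‖ := by simp [sq]
        _ ≤ c * ‖w‖ * ‖v‖ := h1
        _ = _ := by ring
    exact le_of_mul_le_mul_right h2 h0

/-- Transposition exchanges the two arguments of the bilinear form. It is needed because an Eulerian
trail may travel along edges in either direction. -/
theorem opNorm_transpose_le (B : Matrix (Fin N) (Fin N) ℂ) : ‖B.transpose‖ ≤ ‖B‖ := by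
  refine opNorm_le_of_bilin (norm_nonneg _) fun u v => ?_
  have := norm_bilin_le_opNorm B v u
  rw [Finset.sum_comm] at this
  calc _ = _ := by
        congr 1
        exact Finset.sum_congr rfl fun i _ => Finset.sum_congr rfl fun j _ => by
          rw [Matrix.transpose_apply]; ring
    _ ≤ _ := this
    _ = _ := by ring

end Norms

/-! ## Connected components and parity of degrees -/

/-- Both targets are the quotient of `W` by the same kernel. This is how numbers of components of
different graphs are compared. -/
theorem card_eq_of_surjective_of_iff {W α β : Type*} {f : W → α} {g : W → β}
    (hf : Function.Surjective f) (hg : Function.Surjective g)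
    (h : ∀ u v, f u = f v ↔ g u = g v) : Nat.card α = Nat.card β := by
  have e : Setoid.ker f = Setoid.ker g := Setoid.ext fun u v => h u v
  exact Nat.card_congr ((Setoid.quotientKerEquivOfSurjective f hf).symm.trans
    ((Quotient.congrRight fun u v => by rw [e]).trans
      (Setoid.quotientKerEquivOfSurjective g hg)))

namespace EdgeGraph

variable {W F : Type*} (G : EdgeGraph W F)

theorem compMk_surjective : Function.Surjective G.compMk := Quot.mk_surjective

theorem compMk_src (e : F) : G.compMk (G.src e) = G.compMk (G.trg e) := by
  by_cases h : G.src e = G.trg e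
  · rw [h]
  · refine SimpleGraph.ConnectedComponent.sound (SimpleGraph.Adj.reachable ?_)
    exact (SimpleGraph.fromRel_adj _ _ _).2 ⟨h, Or.inl ⟨e, rfl, rfl⟩⟩

variable {G}

/-- The working principle for connectivity: to show that two connected vertices share a property,
check it along edges. Propositions are allowed as values of `χ`. -/
theorem eq_of_compMk_eq {α : Sort*} {χ : W → α} (h : ∀ e, χ (G.src e) = χ (G.trg e)) {u v : W}
    (huv : G.compMk u = G.compMk v) : χ u = χ v := by
  obtain ⟨w⟩ : G.toSimple.Reachable u v := SimpleGraph.ConnectedComponent.exact huv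
  induction w with
  | nil => rfl
  | cons hadj _ ih =>
    refine Eq.trans ?_ (ih (SimpleGraph.ConnectedComponent.sound ⟨‹_›⟩))
    obtain ⟨_, ⟨e, rfl, rfl⟩ | ⟨e, rfl, rfl⟩⟩ := (SimpleGraph.fromRel_adj _ _ _).1 hadj
    · exact h e
    · exact (h e).symm

open Classical in
theorem degree_eq_sum [Fintype F] (v : W) :
    G.degree v = ∑ e, ((if G.src e = v then 1 else 0) + (if G.trg e = v then 1 else 0)) := by
  rw [Finset.sum_add_distrib, degree, Set.ncard_eq_toFinset_card', Set.ncard_eq_toFinset_card']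
  simp

open Classical in
/-- In a graph with even degrees, the two end points of an edge are still connected when this edge
is removed. -/
theorem compMk_restrict_ne [Finite W] [Finite F] (hG : ∀ v, Even (G.degree v)) (e : F) :
    (G.restrict {f | f ≠ e}).compMk (G.src e) = (G.restrict {f | f ≠ e}).compMk (G.trg e) := by
  have := Fintype.ofFinite W
  have := Fintype.ofFinite F
  by_contra hne
  set H := G.restrict {f | f ≠ e}
  -- `χ` is the side of `src e` after removal of `e`. Its degrees have an even sum, to which every
  -- other edge contributes 0 or 2, but `e` contributes 1.
  set χ : W → Prop := fun w => H.compMk w = H.compMk (G.src e) with hχ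
  have h1 : ∀ f, f ≠ e → (χ (G.src f) ↔ χ (G.trg f)) := fun f hf => by
    have := H.compMk_src ⟨f, hf⟩
    change H.compMk (G.src f) = H.compMk (G.trg f) at this
    simp only [hχ, this]
  have h2 : Even (∑ v ∈ Finset.univ.filter χ, G.degree v) :=
    Finset.even_sum _ fun v _ => hG v
  have h3 : ∑ v ∈ Finset.univ.filter χ, G.degree v =
      ∑ f, ((if χ (G.src f) then 1 else 0) + (if χ (G.trg f) then 1 else 0)) := by
    simp only [degree_eq_sum]
    rw [Finset.sum_comm]
    refine Finset.sum_congr rfl fun f _ => ?_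
    rw [Finset.sum_add_distrib, Finset.sum_ite_eq, Finset.sum_ite_eq]
    simp
  rw [h3, ← Finset.add_sum_erase _ _ (Finset.mem_univ e)] at h2
  have h4 : Even (∑ f ∈ Finset.univ.erase e,
      ((if χ (G.src f) then 1 else 0) + (if χ (G.trg f) then 1 else 0))) := by
    refine Finset.even_sum _ fun f hf => ?_
    simp only [h1 f (Finset.ne_of_mem_erase hf)]
    exact ⟨_, rfl⟩
  have h5 : (if χ (G.src e) then 1 else 0) + (if χ (G.trg e) then 1 else 0) = 1 := by
    have ht : ¬ χ (G.trg e) := fun h => hne h.symm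
    have hs : χ (G.src e) := rfl
    simp [ht, hs]
  rw [h5, Nat.even_add] at h2
  exact absurd (h2.2 h4) (by decide)

theorem compMk_restrict_ne_iff [Finite W] [Finite F] (hG : ∀ v, Even (G.degree v)) (e : F)
    (u v : W) : (G.restrict {f | f ≠ e}).compMk u = (G.restrict {f | f ≠ e}).compMk v ↔
      G.compMk u = G.compMk v := by
  constructor
  · exact fun h => eq_of_compMk_eq (χ := G.compMk) (fun f => G.compMk_src f.1) h
  · refine fun h => eq_of_compMk_eq (χ := (G.restrict {f | f ≠ e}).compMk) (fun f => ?_) h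
    by_cases hf : f = e
    · rw [hf]; exact compMk_restrict_ne hG e
    · exact (G.restrict {f | f ≠ e}).compMk_src ⟨f, hf⟩

theorem not_isCutting [Finite W] [Finite F] (hG : ∀ v, Even (G.degree v)) (e : F) :
    ¬ G.IsCutting e := by
  rw [IsCutting, not_lt]
  exact (card_eq_of_surjective_of_iff (compMk_surjective _) (compMk_surjective _)
    (compMk_restrict_ne_iff hG e)).le

/-- Without cutting edges the forest consists of isolated vertices, each worth two leaves, and these
are the components of `G` itself. -/
theorem numLeaves_eq_of_even [Finite W] [Finite F] (hG : ∀ v, Even (G.degree v)) :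
    G.numLeaves = 2 * Nat.card G.Comp := by
  have hd : ∀ t, G.tec.degree t = 0 := fun t => by
    have h1 : {e | G.tec.src e = t} = ∅ :=
      Set.eq_empty_of_forall_notMem fun e _ => not_isCutting hG _ e.2
    have h2 : {e | G.tec.trg e = t} = ∅ :=
      Set.eq_empty_of_forall_notMem fun e _ => not_isCutting hG _ e.2
    rw [degree, h1, h2]
    simp
  have h1 : {t | G.tec.degree t = 1} = ∅ :=
    Set.eq_empty_of_forall_notMem fun t ht => by simp [hd] at ht
  have h0 : {t | G.tec.degree t = 0} = Set.univ := Set.eq_univ_of_forall hd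
  rw [numLeaves, h1, h0, Set.ncard_empty, Set.ncard_univ, zero_add]
  congr 1
  refine card_eq_of_surjective_of_iff G.core.compMk_surjective G.compMk_surjective fun u v => ?_
  constructor
  · exact fun h => eq_of_compMk_eq (χ := G.compMk) (fun f => G.compMk_src f.1) h
  · exact fun h => eq_of_compMk_eq (χ := G.core.compMk)
      (fun f => G.core.compMk_src ⟨f, not_isCutting hG f⟩) h

end EdgeGraph

/-! ## Eulerian trails -/

namespace EdgeGraph

variable {W F : Type*} (G : EdgeGraph W F)

/-- The starting point of an edge travelled along its direction (`true`) or backwards (`false`). -/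
def dartTail (d : F × Bool) : W := if d.2 then G.src d.1 else G.trg d.1

/-- The end point of an edge travelled along its direction (`true`) or backwards (`false`). -/
def dartHead (d : F × Bool) : W := if d.2 then G.trg d.1 else G.src d.1

/-- Trails: lists of consecutive darts, without repeated edges. -/
structure IsTrail (l : List (F × Bool)) : Prop where
  chain : l.IsChain fun d d' => G.dartHead d = G.dartTail d'
  nodup : (l.map Prod.fst).Nodup

open Classical in
/-- The number of half-edges of `e` at the vertex `v`. -/
def inc (e : F) (v : W) : ℕ := (if G.src e = v then 1 else 0) + (if G.trg e = v then 1 else 0)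

theorem degree_eq_sum_inc [Fintype F] (v : W) : G.degree v = ∑ e, G.inc e v := degree_eq_sum v

variable {G}

theorem compMk_dartTail (d : F × Bool) : G.compMk (G.dartTail d) = G.compMk (G.src d.1) := by
  unfold dartTail; split_ifs <;> simp [compMk_src]

theorem compMk_dartHead (d : F × Bool) : G.compMk (G.dartHead d) = G.compMk (G.src d.1) := by
  unfold dartHead; split_ifs <;> simp [compMk_src]

theorem exists_dart_of_inc_ne_zero {e : F} {v : W} (h : G.inc e v ≠ 0) :
    ∃ b, G.dartTail (e, b) = v := by
  by_cases h1 : G.src e = v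
  · exact ⟨true, by simpa [dartTail] using h1⟩
  · by_cases h2 : G.trg e = v
    · exact ⟨false, by simpa [dartTail] using h2⟩
    · simp [inc, h1, h2] at h

open Classical in
theorem inc_eq_dart (d : F × Bool) (v : W) : G.inc d.1 v =
    (if G.dartTail d = v then 1 else 0) + (if G.dartHead d = v then 1 else 0) := by
  unfold inc dartTail dartHead
  cases d.2 <;> simp [add_comm]

open Classical in
-- Each inner passage through `v` enters and leaves it, so only the two ends of the walk affect the
-- parity of the half-edges at `v`.
theorem IsTrail.even_sum_inc {l : List (F × Bool)} (d : F × Bool)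
    (hl : (d :: l).IsChain fun d d' => G.dartHead d = G.dartTail d') (v : W) :
    Even (((d :: l).map fun d => G.inc d.1 v).sum + (if G.dartTail d = v then 1 else 0)
      + (if G.dartHead ((d :: l).getLast (by simp)) = v then 1 else 0)) := by
  induction l generalizing d with
  | nil =>
    change Even (_ + _ + (if G.dartHead d = v then 1 else 0))
    simp only [List.map_cons, List.map_nil, List.sum_cons, List.sum_nil, inc_eq_dart]
    exact ⟨(if G.dartTail d = v then 1 else 0) + (if G.dartHead d = v then 1 else 0), by omega⟩
  | cons d' l ih =>
    rw [List.isChain_cons_cons] at hl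
    obtain ⟨k, hk⟩ := ih d' hl.2
    rw [List.getLast_cons (by simp), List.map_cons, List.sum_cons, inc_eq_dart, hl.1]
    exact ⟨k + (if G.dartTail d = v then 1 else 0), by omega⟩

theorem IsTrail.append_dart {l : List (F × Bool)} (hl : G.IsTrail l) (hne : l ≠ [])
    {d : F × Bool} (hd : G.dartHead (l.getLast hne) = G.dartTail d)
    (hn : d.1 ∉ l.map Prod.fst) : G.IsTrail (l ++ [d]) where
  chain := by
    refine hl.chain.append (.singleton _) ?_
    intro x hx y hy
    rw [List.getLast?_eq_some_getLast hne, Option.mem_some] at hx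
    simp only [List.head?_cons, Option.mem_some] at hy
    rw [← hx, ← hy, hd]
  nodup := by
    rw [List.map_append, List.nodup_append]
    refine ⟨hl.nodup, by simp, ?_⟩
    simp only [List.map_cons, List.map_nil, List.mem_singleton]
    rintro a ha b rfl rfl
    exact hn ha

/-- A trail that is not closed can be extended when the degrees are even. -/
theorem IsTrail.exists_longer_of_not_closed [Finite F] (hG : ∀ v, Even (G.degree v))
    {l : List (F × Bool)} (hl : G.IsTrail l) (hne : l ≠ [])
    (h : G.dartHead (l.getLast hne) ≠ G.dartTail (l.head hne)) :
    ∃ d, G.dartHead (l.getLast hne) = G.dartTail d ∧ d.1 ∉ l.map Prod.fst := by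
  classical
  have := Fintype.ofFinite F
  set v := G.dartHead (l.getLast hne) with hv
  by_contra hcon
  push Not at hcon
  have hz : ∀ e, e ∉ (l.map Prod.fst).toFinset → G.inc e v = 0 := by
    intro e he
    by_contra h0
    obtain ⟨b, hb⟩ := exists_dart_of_inc_ne_zero h0
    exact he (List.mem_toFinset.2 (hcon (e, b) hb.symm))
  -- If every edge at `v` is used, the trail counts the full degree, which is even, whereas an open
  -- trail that ends at `v` has an odd count there.
  have hs : (l.map fun d => G.inc d.1 v).sum = G.degree v := by
    rw [degree_eq_sum_inc, ← Finset.sum_subset (Finset.subset_univ (l.map Prod.fst).toFinset)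
      (fun e _ he => hz e he), List.sum_toFinset _ hl.nodup, List.map_map]
    rfl
  obtain ⟨d, l', rfl⟩ := List.exists_cons_of_ne_nil hne
  have he := IsTrail.even_sum_inc d hl.chain v
  rw [List.head_cons] at h
  rw [hs, if_neg (Ne.symm h), if_pos hv.symm, add_zero, Nat.even_add] at he
  exact absurd (he.1 (hG v)) (by decide)

/-- Closed trails can be rotated. -/
theorem IsTrail.rotate {l₁ l₂ : List (F × Bool)} (hl : G.IsTrail (l₁ ++ l₂))
    (hc : ((l₁ ++ l₂) ++ (l₁ ++ l₂)).IsChain fun d d' => G.dartHead d = G.dartTail d') :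
    G.IsTrail (l₂ ++ l₁) where
  chain := hc.infix ⟨l₁, l₂, by simp⟩
  nodup := by
    have := hl.nodup
    rw [List.map_append] at this ⊢
    exact List.nodup_append_comm.1 this

/-- Closedness is recorded as `l ++ l` being a chain, because every rotation of `l` is an infix of
it. -/
theorem IsTrail.isChain_append_self {l : List (F × Bool)} (hl : G.IsTrail l) (hne : l ≠ [])
    (h : G.dartHead (l.getLast hne) = G.dartTail (l.head hne)) :
    (l ++ l).IsChain fun d d' => G.dartHead d = G.dartTail d' := by
  refine hl.chain.append hl.chain ?_
  intro x hx y hy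
  rw [List.getLast?_eq_some_getLast hne, Option.mem_some] at hx
  rw [List.head?_eq_some_head hne, Option.mem_some] at hy
  rw [← hx, ← hy, h]

/-- A closed trail that does not use all the edges of its component gives rise to a longer one. -/
theorem IsTrail.exists_longer_of_closed {l : List (F × Bool)} (hl : G.IsTrail l)
    (hne : l ≠ []) (h : G.dartHead (l.getLast hne) = G.dartTail (l.head hne)) {c : G.Comp}
    (hlc : ∀ d ∈ l, G.compMk (G.src d.1) = c) {e : F} (he : G.compMk (G.src e) = c)
    (hel : e ∉ l.map Prod.fst) :
    ∃ l', G.IsTrail l' ∧ l'.length = l.length + 1 ∧ ∀ d ∈ l', G.compMk (G.src d.1) = c := by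
  have hch := hl.isChain_append_self hne h
  have hhead : ∀ d ∈ l, ∃ d' ∈ l, G.dartTail d' = G.dartHead d := by
    intro d hd
    obtain ⟨l₁, l₂, rfl⟩ := List.append_of_mem hd
    have h2 := (List.IsChain.infix hch (l₁ := d :: (l₂ ++ l₁ ++ [d])) ⟨l₁, l₂, by simp⟩)
    rcases l₂ with _ | ⟨a, l₂⟩
    · rcases l₁ with _ | ⟨b, l₁⟩
      · exact ⟨d, by simp, by simpa using Eq.symm (by simpa using h2)⟩
      · simp only [List.nil_append, List.cons_append, List.isChain_cons_cons] at h2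
        exact ⟨b, by simp, h2.1.symm⟩
    · simp only [List.cons_append, List.isChain_cons_cons] at h2
      exact ⟨a, by simp, h2.1.symm⟩
  obtain ⟨f, d, hd, b, hb, hf⟩ : ∃ f, ∃ d ∈ l, ∃ b, G.dartTail (f, b) = G.dartTail d ∧
      f ∉ l.map Prod.fst := by
    by_contra hcon
    push Not at hcon
    -- If every edge at a visited vertex were used, the set `χ` of visited vertices would be stable
    -- along edges, hence fill the component, and `e` would be used.
    set χ : W → Prop := fun w => ∃ d ∈ l, G.dartTail d = w
    have hused : ∀ f b, χ (G.dartTail (f, b)) → χ (G.src f) ∧ χ (G.trg f) := by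
      rintro f b ⟨d, hd, hdw⟩
      obtain ⟨⟨f', b'⟩, hd', rfl⟩ := List.mem_map.1 (hcon f d hd b hdw.symm)
      have h1 : χ (G.dartTail (f', b')) := ⟨_, hd', rfl⟩
      have h2 : χ (G.dartHead (f', b')) := hhead _ hd'
      cases b'
      · exact ⟨by simpa [dartHead] using h2, by simpa [dartTail] using h1⟩
      · exact ⟨by simpa [dartTail] using h1, by simpa [dartHead] using h2⟩
    have hχ : ∀ f, χ (G.src f) = χ (G.trg f) := fun f => propext
      ⟨fun h => (hused f true (by simpa [dartTail] using h)).2,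
        fun h => (hused f false (by simpa [dartTail] using h)).1⟩
    have h1 : χ (G.src e) = χ (G.dartTail (l.head hne)) := eq_of_compMk_eq hχ <| by
      rw [he, compMk_dartTail, hlc _ (List.head_mem hne)]
    have h2 : χ (G.src e) := by rw [h1]; exact ⟨_, List.head_mem hne, rfl⟩
    obtain ⟨d, hd, hdw⟩ := h2
    exact hel (hcon e d hd true (by simpa [dartTail] using hdw.symm))
  -- Rotate the closed trail so that it starts, hence also ends, at the vertex of the unused edge
  -- `f`; then append `f`.
  obtain ⟨l₁, l₂, rfl⟩ := List.append_of_mem hd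
  have hrot := hl.rotate hch
  have hlast : G.dartHead ((d :: l₂ ++ l₁).getLast (by simp)) = G.dartTail d := by
    have h2 := (List.IsChain.infix hch (l₁ := (d :: l₂ ++ l₁) ++ [d]) ⟨l₁, l₂, by simp⟩)
    have := h2.rel_getLast_head_of_append (by simp) (by simp)
    simpa using this
  refine ⟨(d :: l₂ ++ l₁) ++ [(f, b)], hrot.append_dart (by simp) (by rw [hlast, hb]) ?_, ?_, ?_⟩
  · intro hmem
    refine hf ?_
    simp only [List.map_append, List.mem_append] at hmem ⊢
    tauto
  · simp; omega
  · intro d' hd'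
    rw [List.mem_append] at hd'
    rcases hd' with hd' | hd'
    · refine hlc d' ?_
      rw [List.mem_append] at hd' ⊢
      tauto
    · rw [List.mem_singleton] at hd'
      rw [hd', ← compMk_dartTail, hb, compMk_dartTail, hlc d hd]

/-- In a graph with even positive degrees, each component has an Eulerian closed trail. -/
theorem exists_closed_trail [Finite F] (hG : ∀ v, Even (G.degree v)) (hpos : ∀ v, 0 < G.degree v)
    (c : G.Comp) : ∃ l : List (F × Bool), l ≠ [] ∧
      (l ++ l).IsChain (fun d d' => G.dartHead d = G.dartTail d') ∧ (l.map Prod.fst).Nodup ∧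
      ∀ e, e ∈ l.map Prod.fst ↔ G.compMk (G.src e) = c := by
  classical
  have := Fintype.ofFinite F
  by_contra hcon
  push Not at hcon
  -- Without an Eulerian closed trail, trails of every positive length would exist, while the
  -- absence of repetitions bounds the length by the number of edges.
  have key : ∀ n, ∃ l, G.IsTrail l ∧ l.length = n + 1 ∧ ∀ d ∈ l, G.compMk (G.src d.1) = c := by
    intro n
    induction n with
    | zero =>
      obtain ⟨v, rfl⟩ := G.compMk_surjective c
      have h := hpos v
      rw [degree_eq_sum_inc] at h
      obtain ⟨e, -, he⟩ := Finset.exists_ne_zero_of_sum_ne_zero h.ne'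
      obtain ⟨b, hb⟩ := exists_dart_of_inc_ne_zero he
      refine ⟨[(e, b)], ⟨.singleton _, by simp⟩, by simp, ?_⟩
      simp only [List.mem_singleton, forall_eq]
      rw [← hb, compMk_dartTail]
    | succ n ih =>
      obtain ⟨l, hl, hlen, hlc⟩ := ih
      have hne : l ≠ [] := by rintro rfl; simp at hlen
      by_cases hcl : G.dartHead (l.getLast hne) = G.dartTail (l.head hne)
      · obtain ⟨e, he⟩ := hcon l hne (hl.isChain_append_self hne hcl) hl.nodup
        have hec : G.compMk (G.src e) = c ∧ e ∉ l.map Prod.fst := by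
          rcases he with ⟨h1, h2⟩ | ⟨h1, h2⟩
          · obtain ⟨d, hd, rfl⟩ := List.mem_map.1 h1
            exact absurd (hlc d hd) h2
          · exact ⟨h2, h1⟩
        obtain ⟨l', h1, h2, h3⟩ := hl.exists_longer_of_closed hne hcl hlc hec.1 hec.2
        exact ⟨l', h1, by rw [h2, hlen], h3⟩
      · obtain ⟨d, hd, hdn⟩ := hl.exists_longer_of_not_closed hG hne hcl
        refine ⟨l ++ [d], hl.append_dart hne hd hdn, by simp [hlen], fun d' hd' => ?_⟩
        rw [List.mem_append, List.mem_singleton] at hd'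
        rcases hd' with hd' | rfl
        · exact hlc d' hd'
        · rw [← compMk_dartTail, ← hd, compMk_dartHead, hlc _ (List.getLast_mem hne)]
  obtain ⟨l, hl, hlen, -⟩ := key (Fintype.card F)
  have := hl.nodup.length_le_card
  rw [List.length_map, hlen] at this
  omega

/-- The edges of a graph with even positive degrees are arranged along closed trails, one for each
component. -/
theorem exists_eulerian_positions [Finite F] (hG : ∀ v, Even (G.degree v))
    (hpos : ∀ v, 0 < G.degree v) : ∃ (q : G.Comp → ℕ) (d : (Σ c, Fin (q c)) → F × Bool),
      (∀ c, 0 < q c) ∧ Function.Bijective (fun a => (d a).1) ∧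
      (∀ a, G.compMk (G.src (d a).1) = a.1) ∧
      ∀ a, G.dartHead (d a) = G.dartTail (d (cycNext q a)) := by
  choose l hne hch hnd hmem using exists_closed_trail hG hpos
  refine ⟨fun c => (l c).length, fun a => (l a.1).get a.2, fun c => List.length_pos_of_ne_nil (hne c),
    ⟨?_, ?_⟩, ?_, ?_⟩
  · rintro ⟨c, k⟩ ⟨c', k'⟩ h
    have hc : c = c' := by
      rw [← (hmem c _).1 (List.mem_map_of_mem (List.get_mem (l c) k)),
        ← (hmem c' _).1 (List.mem_map_of_mem (List.get_mem (l c') k'))]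
      exact congrArg (fun e => G.compMk (G.src e)) h
    subst hc
    congr 1
    have := hnd c
    rw [List.nodup_iff_injective_get] at this
    have h2 := @this ⟨k.1, by simp⟩ ⟨k'.1, by simp⟩ (by simpa using h)
    exact Fin.ext (by simpa using h2)
  · intro e
    obtain ⟨d, hd, rfl⟩ := List.mem_map.1 ((hmem (G.compMk (G.src e)) e).2 rfl)
    obtain ⟨k, hk⟩ := List.mem_iff_get.1 hd
    exact ⟨⟨_, k⟩, by simp only [hk]⟩
  · rintro ⟨c, k⟩
    exact (hmem c _).1 (List.mem_map_of_mem (List.get_mem (l c) k))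
  · rintro ⟨c, k⟩
    -- In `l ++ l` the positions `k` and `k + 1` are consecutive even when `k` is the last position
    -- of `l`, which covers the wrap-around of `finRotate`.
    have h := List.isChain_iff_getElem.1 (hch c) k.1 (by simp; omega)
    simp only [cycNext, List.get_eq_getElem]
    have hk : k.1 < (l c).length := k.2
    rw [List.getElem_append_left hk] at h
    rw [h]
    have hlen : 0 < (l c).length := List.length_pos_of_ne_nil (hne c)
    by_cases hk1 : k.1 + 1 < (l c).length
    · rw [List.getElem_append_left hk1]
      congr 2
      obtain ⟨k, hk⟩ := k
      have : NeZero (l c).length := ⟨hlen.ne'⟩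
      rw [finRotate_apply, Fin.val_add_one_of_lt']
      exact hk1
    · rw [List.getElem_append_right (by omega)]
      congr 2
      have : NeZero (l c).length := ⟨hlen.ne'⟩
      rw [finRotate_apply, Fin.val_add]
      rcases Nat.lt_or_ge 1 (l c).length with h1 | h1
      · rw [Fin.val_one', Nat.mod_eq_of_lt h1, show k.1 + 1 = (l c).length by omega]
        simp
      · have h2 : (l c).length = 1 := by omega
        have h3 : ∀ m, m % (l c).length = 0 := fun m => by rw [h2, Nat.mod_one]
        rw [h3]
        omega

end EdgeGraph

/-! ## Bounds for traces of graphs of matrices -/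

section TraceBound

open scoped Matrix.Norms.L2Operator

variable {N : ℕ}

/-- Either a matrix of rank one with bounded coordinates (when `J` holds), or a matrix whose
operator norm is at most `K`. -/
def FlatOrBounded (K : ℝ) (J : Prop) (C : Matrix (Fin N) (Fin N) ℂ) : Prop :=
  (J → ∃ u v : Fin N → ℂ, (∀ i, ‖u i‖ ≤ 1) ∧ (∀ i, ‖v i‖ ≤ 1) ∧ C = Matrix.vecMulVec u v) ∧
    (¬ J → ‖C‖ ≤ K)

theorem norm_diagonal_le_one {u : Fin N → ℂ} (hu : ∀ i, ‖u i‖ ≤ 1) :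
    ‖(Matrix.diagonal u : Matrix (Fin N) (Fin N) ℂ)‖ ≤ 1 := by
  rw [Matrix.l2_opNorm_diagonal]
  exact (pi_norm_le_iff_of_nonneg zero_le_one).2 hu

theorem norm_matrix_one_le : ‖(1 : Matrix (Fin N) (Fin N) ℂ)‖ ≤ 1 := by
  rw [← Matrix.diagonal_one]
  exact norm_diagonal_le_one (by simp)

/-- The all-ones matrix `E` satisfies `E* E = N E`, so the C*-identity gives `‖E‖ ≤ N`; the
coordinates of `u` and `v` enter as diagonal contractions. -/
theorem norm_vecMulVec_le {u v : Fin N → ℂ} (hu : ∀ i, ‖u i‖ ≤ 1) (hv : ∀ i, ‖v i‖ ≤ 1) :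
    ‖Matrix.vecMulVec u v‖ ≤ N := by
  set E : Matrix (Fin N) (Fin N) ℂ := Matrix.of fun _ _ => 1 with hE
  have h1 : star E * E = (N : ℂ) • E := by
    ext i j
    simp [hE, Matrix.mul_apply, Matrix.star_eq_conjTranspose]
  have h2 : ‖E‖ * ‖E‖ = N * ‖E‖ := by
    rw [← CStarRing.norm_star_mul_self, h1, norm_smul]
    simp
  have h3 : ‖E‖ ≤ N := by
    rcases (norm_nonneg E).eq_or_lt with h | h
    · rw [← h]; positivity
    · exact (mul_right_cancel₀ h.ne' h2).le
  have h4 : Matrix.vecMulVec u v = Matrix.diagonal u * E * Matrix.diagonal v := by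
    ext i j
    rw [Matrix.mul_diagonal, Matrix.diagonal_mul, Matrix.vecMulVec_apply]
    simp [hE]
  rw [h4]
  calc _ ≤ ‖Matrix.diagonal u‖ * ‖E‖ * ‖Matrix.diagonal v‖ :=
        (norm_mul_le _ _).trans (mul_le_mul_of_nonneg_right (norm_mul_le _ _) (norm_nonneg _))
    _ ≤ 1 * N * 1 := by
        gcongr
        exacts [norm_diagonal_le_one hu, norm_diagonal_le_one hv]
    _ = N := by ring

theorem FlatOrBounded.diagonal_mul {K : ℝ} {J : Prop} {C : Matrix (Fin N) (Fin N) ℂ}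
    (h : FlatOrBounded K J C) {w : Fin N → ℂ} (hw : ∀ i, ‖w i‖ ≤ 1) :
    FlatOrBounded K J (Matrix.diagonal w * C) := by
  refine ⟨fun hJ => ?_, fun hJ => ?_⟩
  · obtain ⟨u, v, hu, hv, rfl⟩ := h.1 hJ
    refine ⟨fun i => w i * u i, v, fun i => ?_, hv, ?_⟩
    · rw [norm_mul]; exact mul_le_one₀ (hw i) (norm_nonneg _) (hu i)
    · ext i j
      simp [Matrix.diagonal_mul, Matrix.vecMulVec_apply, mul_assoc]
  · calc _ ≤ ‖Matrix.diagonal w‖ * ‖C‖ := norm_mul_le _ _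
      _ ≤ 1 * K := mul_le_mul (norm_diagonal_le_one hw) (h.2 hJ) (norm_nonneg _) zero_le_one
      _ = K := one_mul K

theorem FlatOrBounded.transpose {K : ℝ} {J : Prop} {C : Matrix (Fin N) (Fin N) ℂ}
    (h : FlatOrBounded K J C) : FlatOrBounded K J C.transpose := by
  refine ⟨fun hJ => ?_, fun hJ => (opNorm_transpose_le C).trans (h.2 hJ)⟩
  obtain ⟨u, v, hu, hv, rfl⟩ := h.1 hJ
  refine ⟨v, u, hv, hu, ?_⟩
  ext i j
  simp [Matrix.vecMulVec_apply, mul_comm]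

theorem norm_list_prod_le (l : List (Matrix (Fin N) (Fin N) ℂ × ℝ)) (h : ∀ x ∈ l, ‖x.1‖ ≤ x.2) :
    ‖(l.map Prod.fst).prod‖ ≤ (l.map Prod.snd).prod := by
  induction l with
  | nil => simpa using norm_matrix_one_le
  | cons x l ih =>
    simp only [List.map_cons, List.prod_cons]
    have hx := h x (by simp)
    exact (norm_mul_le _ _).trans (mul_le_mul hx (ih fun y hy => h y (by simp [hy]))
      (norm_nonneg _) ((norm_nonneg _).trans hx))

/-- The rank-one factor opens the trace into a bilinear form of `S * P`. This costs a single `N`,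
where bounding trace and norm separately would cost `N ^ 2`. -/
theorem norm_trace_mul_vecMulVec_mul_le (P S : Matrix (Fin N) (Fin N) ℂ) {u v : Fin N → ℂ}
    (hu : ∀ i, ‖u i‖ ≤ 1) (hv : ∀ i, ‖v i‖ ≤ 1) :
    ‖(P * (Matrix.vecMulVec u v * S)).trace‖ ≤ N * (‖P‖ * ‖S‖) := by
  have e : (P * (Matrix.vecMulVec u v * S)).trace = ∑ i, ∑ j, v i * (S * P) i j * u j := by
    rw [Matrix.trace_mul_comm, Matrix.mul_assoc, Matrix.trace, Finset.sum_comm]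
    refine Finset.sum_congr rfl fun i _ => ?_
    rw [Matrix.diag_apply, Matrix.mul_apply]
    refine Finset.sum_congr rfl fun j _ => ?_
    rw [Matrix.vecMulVec_apply]
    ring
  rw [e]
  refine (norm_bilin_le _ _ _ hv hu).trans ?_
  rw [mul_comm ‖P‖]
  exact mul_le_mul_of_nonneg_left (norm_mul_le _ _) (Nat.cast_nonneg _)

/-- The first flat factor opens the cycle and absorbs the factor `N` of the trace; every further
flat factor costs its norm `N`. With no flat factor the trace itself costs `N`, whence `max 1`. -/
theorem norm_trace_prod_ofFn_le (hN : 0 < N) {m : ℕ} {K : ℝ} (hK : 1 ≤ K) (J : Fin m → Prop)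
    [DecidablePred J] (C : Fin m → Matrix (Fin N) (Fin N) ℂ)
    (hC : ∀ k, FlatOrBounded K (J k) (C k)) :
    ‖(List.ofFn C).prod.trace‖ ≤ (N : ℝ) ^ max 1 (Finset.univ.filter J).card * K ^ m := by
  have hN1 : (1 : ℝ) ≤ N := by exact_mod_cast hN
  have hb : ∀ k, ‖C k‖ ≤ (if J k then (N : ℝ) else 1) * K := by
    intro k
    split_ifs with hJ
    · obtain ⟨u, v, hu, hv, h⟩ := (hC k).1 hJ
      rw [h]
      exact (norm_vecMulVec_le hu hv).trans (le_mul_of_one_le_right (by positivity) hK)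
    · simpa using (hC k).2 hJ
  by_cases hJ : ∃ k, J k
  · obtain ⟨k₀, hk₀⟩ := hJ
    obtain ⟨u, v, hu, hv, h⟩ := (hC k₀).1 hk₀
    -- The factor at `k₀` is given no `N` of its own: the bilinear form already accounts for it.
    set g : Fin m → ℝ := fun k => (if k = k₀ then 1 else if J k then (N : ℝ) else 1) * K with hg
    set l := List.ofFn fun k => (C k, g k) with hl
    have hk : k₀.1 < l.length := by simp [hl]
    have hl1 : (l.take k₀).map Prod.fst ++ C k₀ :: (l.drop (k₀ + 1)).map Prod.fst
        = List.ofFn C := by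
      have : List.ofFn C = l.map Prod.fst := by simp [hl, List.map_ofFn, Function.comp_def]
      rw [this]
      conv_rhs => rw [← List.take_append_drop k₀.1 l, List.drop_eq_getElem_cons hk]
      simp [hl]
    have hl2 : ((l.take k₀).map Prod.snd).prod * (g k₀ * ((l.drop (k₀ + 1)).map Prod.snd).prod)
        = ∏ k, g k := by
      have : ∏ k, g k = (l.map Prod.snd).prod := by
        simp [hl, List.map_ofFn, Function.comp_def, List.prod_ofFn]
      rw [this]
      conv_rhs => rw [← List.take_append_drop k₀.1 l, List.drop_eq_getElem_cons hk]
      simp [hl]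
    have hle : ∀ x ∈ l, x ≠ (C k₀, g k₀) → ‖x.1‖ ≤ x.2 := by
      intro x hx hne
      obtain ⟨k, rfl⟩ := List.mem_ofFn.1 hx
      have hkk : k ≠ k₀ := by rintro rfl; exact hne rfl
      simpa [hg, hkk] using hb k
    have hle1 : ∀ x ∈ l.take k₀ ++ l.drop (k₀ + 1), ‖x.1‖ ≤ x.2 := by
      intro x hx
      have : ∃ k, k ≠ k₀ ∧ x = (C k, g k) := by
        rw [List.mem_append] at hx
        rcases hx with hx | hx
        · obtain ⟨i, hi, rfl⟩ := List.mem_take_iff_getElem.1 hx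
          have hi' : i < m := by simp [hl] at hi; omega
          have hik : i < k₀ := by simp [hl] at hi; omega
          exact ⟨⟨i, hi'⟩, fun h => by rw [← h] at hik; simp at hik, by simp [hl]⟩
        · obtain ⟨i, hi, rfl⟩ := List.mem_drop_iff_getElem.1 hx
          have hi' : k₀ + 1 + i < m := by simp [hl] at hi; omega
          refine ⟨⟨k₀ + 1 + i, hi'⟩, fun h => ?_, by simp [hl]⟩
          have := congrArg Fin.val h
          simp at this
          omega
      obtain ⟨k, hkk, rfl⟩ := this
      simpa [hg, hkk] using hb k
    have hg0 : ∀ k, 0 ≤ g k := fun k => by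
      simp only [hg]; split_ifs <;> positivity
    rw [← hl1, List.prod_append, List.prod_cons, h]
    refine (norm_trace_mul_vecMulVec_mul_le _ _ hu hv).trans ?_
    have hP := norm_list_prod_le (l.take k₀) fun x hx => hle1 x (List.mem_append_left _ hx)
    have hS := norm_list_prod_le (l.drop (k₀ + 1)) fun x hx => hle1 x (List.mem_append_right _ hx)
    have hP0 := (norm_nonneg _).trans hP
    have hS0 := (norm_nonneg _).trans hS
    have hgk : 1 ≤ g k₀ := by simpa [hg] using hK
    calc _ ≤ (N : ℝ) * (((l.take k₀).map Prod.snd).prod *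
          (g k₀ * ((l.drop (k₀ + 1)).map Prod.snd).prod)) := by
          gcongr
          exact hS.trans (le_mul_of_one_le_left hS0 hgk)
      _ = (N : ℝ) * ∏ k, g k := by rw [hl2]
      _ = (N : ℝ) * ((N : ℝ) ^ ((Finset.univ.filter J).erase k₀).card * K ^ m) := by
          simp only [hg]
          rw [Finset.prod_mul_distrib, Finset.prod_const, Finset.card_univ, Fintype.card_fin]
          congr 2
          rw [← Finset.prod_const, ← Finset.prod_filter_mul_prod_filter_not Finset.univ
            (· ∈ (Finset.univ.filter J).erase k₀)]
          rw [Finset.filter_mem_eq_inter, Finset.univ_inter]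
          rw [Finset.prod_congr rfl (g := fun _ => (N : ℝ)), Finset.prod_eq_one (s := Finset.filter _ _),
            mul_one]
          · intro k hk
            simp only [Finset.mem_filter, Finset.mem_erase, Finset.mem_univ, true_and, not_and] at hk
            by_cases h1 : k = k₀
            · simp [h1]
            · simp [h1, hk h1]
          · intro k hk
            simp only [Finset.mem_erase, Finset.mem_filter, Finset.mem_univ, true_and] at hk
            simp [hk.1, hk.2]
      _ = (N : ℝ) ^ (Finset.univ.filter J).card * K ^ m := by
          rw [← mul_assoc, ← pow_succ', Finset.card_erase_add_one (by simpa using hk₀)]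
      _ ≤ _ := by
          gcongr
          exact le_max_right _ _
  · push Not at hJ
    have h0 : Finset.univ.filter J = ∅ := Finset.filter_eq_empty_iff.2 fun k _ => hJ k
    have h1 := norm_list_prod_le (List.ofFn fun k => (C k, K)) fun x hx => by
      obtain ⟨k, rfl⟩ := List.mem_ofFn.1 hx
      exact (hC k).2 (hJ k)
    simp only [List.map_ofFn, Function.comp_def, List.prod_ofFn, Finset.prod_const,
      Finset.card_univ, Fintype.card_fin] at h1
    rw [h0, Finset.card_empty, max_eq_left zero_le_one, pow_one]
    exact (norm_trace_le _).trans (mul_le_mul_of_nonneg_left h1 (Nat.cast_nonneg _))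

/-- The indicator of the diagonal is an average of products of unimodular functions. -/
theorem exists_unimodular_average (hN : 0 < N) : ∃ χ : Fin N → Fin N → ℂ, (∀ k i, ‖χ k i‖ = 1) ∧
    ∀ i j, (if i = j then (1 : ℂ) else 0) = (N : ℂ)⁻¹ * ∑ k, χ k i * star (χ k j) := by
  have : NeZero N := ⟨hN.ne'⟩
  -- The functions are the additive characters of the cyclic group of order `N`, and the identity is
  -- their orthogonality.
  set e : Fin N ≃ ZMod N := (ZMod.finEquiv N).toEquiv
  refine ⟨fun k i => ZMod.stdAddChar (e k * e i), fun k i => AddChar.norm_apply _ _, fun i j => ?_⟩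
  have h1 : ∀ k, ZMod.stdAddChar (e k * e i) * star (ZMod.stdAddChar (e k * e j) : ℂ)
      = (ZMod.stdAddChar (e k * (e i - e j)) : ℂ) := fun k => by
    rw [RCLike.star_def, ← AddChar.map_neg_eq_conj, ← AddChar.map_add_eq_mul]
    congr 1; ring
  simp only [h1]
  rw [e.sum_comp (fun k => (ZMod.stdAddChar (k * (e i - e j)) : ℂ)),
    AddChar.sum_mulShift _ (ZMod.isPrimitive_stdAddChar N)]
  have hN' : (N : ℂ) ≠ 0 := by exact_mod_cast hN.ne'
  by_cases h : i = j
  · simp [h, ZMod.card, hN']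
  · have : e i - e j ≠ 0 := fun h' => h (e.injective (sub_eq_zero.1 h'))
    simp [h, this]

variable {ι : Type*} [Fintype ι] [DecidableEq ι] {q : ι → ℕ}

/-- A family of cyclic words of matrices, some indices of which are identified. -/
theorem norm_sum_identified_le (hN : 0 < N) {K : ℝ} (hK : 1 ≤ K) (hq : ∀ c, 0 < q c)
    (J : (Σ c, Fin (q c)) → Prop) [DecidablePred J] (T : Finset ((Σ c, Fin (q c)) × (Σ c, Fin (q c))))
    (C : (Σ c, Fin (q c)) → Matrix (Fin N) (Fin N) ℂ) (hC : ∀ a, FlatOrBounded K (J a) (C a)) :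
    ‖∑ y : (Σ c, Fin (q c)) → Fin N, (∏ t ∈ T, if y t.1 = y t.2 then (1 : ℂ) else 0)
        * ∏ a, C a (y a) (y (cycNext q a))‖
      ≤ ∏ c, ((N : ℝ) ^ max 1 (Finset.univ.filter fun k => J ⟨c, k⟩).card * K ^ q c) := by
  induction T using Finset.induction_on generalizing C with
  | empty =>
    simp only [Finset.prod_empty, one_mul]
    rw [← prod_trace_prod_ofFn hq C, norm_prod]
    exact Finset.prod_le_prod (fun _ _ => norm_nonneg _) fun c _ =>
      norm_trace_prod_ofFn_le hN hK _ _ fun k => hC ⟨c, k⟩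
  | insert t T ht ih =>
    obtain ⟨χ, hχ, hδ⟩ := exists_unimodular_average hN
    set R := ∏ c, ((N : ℝ) ^ max 1 (Finset.univ.filter fun k => J ⟨c, k⟩).card * K ^ q c)
    -- For each character the constraint `t` splits into a unimodular factor at each of its two
    -- positions, absorbed there as a diagonal contraction. The average over `N` characters then
    -- costs nothing.
    set w : Fin N → (Σ c, Fin (q c)) → Fin N → ℂ := fun k a i =>
      (if a = t.1 then χ k i else 1) * (if a = t.2 then star (χ k i) else 1)
    have hw : ∀ k a i, ‖w k a i‖ ≤ 1 := fun k a i => by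
      simp only [w, norm_mul]
      split_ifs <;> simp [hχ]
    have hwy : ∀ k (y : (Σ c, Fin (q c)) → Fin N),
        ∏ a, w k a (y a) = χ k (y t.1) * star (χ k (y t.2)) := fun k y => by
      simp only [w, Finset.prod_mul_distrib, Finset.prod_ite_eq', Finset.mem_univ, if_true]
    have e : ∑ y : (Σ c, Fin (q c)) → Fin N,
        (∏ t ∈ insert t T, if y t.1 = y t.2 then (1 : ℂ) else 0) * ∏ a, C a (y a) (y (cycNext q a))
        = (N : ℂ)⁻¹ * ∑ k, ∑ y : (Σ c, Fin (q c)) → Fin N,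
          (∏ t ∈ T, if y t.1 = y t.2 then (1 : ℂ) else 0)
            * ∏ a, (Matrix.diagonal (w k a) * C a) (y a) (y (cycNext q a)) := by
      rw [Finset.sum_comm, Finset.mul_sum]
      refine Finset.sum_congr rfl fun y _ => ?_
      rw [Finset.prod_insert ht, hδ]
      simp only [Matrix.diagonal_mul, Finset.prod_mul_distrib, hwy]
      rw [Finset.mul_sum, Finset.mul_sum, Finset.sum_mul, Finset.sum_mul]
      refine Finset.sum_congr rfl fun k _ => ?_
      ring
    rw [e, norm_mul]
    have hN' : (0 : ℝ) < N := by exact_mod_cast hN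
    calc _ ≤ ‖(N : ℂ)⁻¹‖ * ∑ _k : Fin N, R := by
          gcongr
          refine (norm_sum_le _ _).trans (Finset.sum_le_sum fun k _ => ?_)
          exact ih _ fun a => (hC a).diagonal_mul (hw k a)
      _ = R := by
          rw [Finset.sum_const, Finset.card_univ, Fintype.card_fin, nsmul_eq_mul, norm_inv,
            Complex.norm_natCast, ← mul_assoc, inv_mul_cancel₀ hN'.ne', one_mul]

/-- Inclusion-exclusion: the indicator of the kernel is a product of `δ` over the pairs in `E` and
of `1 - δ` over the others. Expanding the latter leaves sums with identifications only, at most one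
for each set of pairs. -/
theorem norm_sum_kernel_le (hN : 0 < N) {K : ℝ} (hK : 1 ≤ K) (hq : ∀ c, 0 < q c)
    (J : (Σ c, Fin (q c)) → Prop) [DecidablePred J] {W : Type*} [DecidableEq W]
    (v : (Σ c, Fin (q c)) → W)
    (C : (Σ c, Fin (q c)) → Matrix (Fin N) (Fin N) ℂ) (hC : ∀ a, FlatOrBounded K (J a) (C a)) :
    ‖∑ y : (Σ c, Fin (q c)) → Fin N with ∀ a b, y a = y b ↔ v a = v b,
        ∏ a, C a (y a) (y (cycNext q a))‖
      ≤ 2 ^ (Fintype.card ((Σ c, Fin (q c)) × (Σ c, Fin (q c)))) *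
        ∏ c, ((N : ℝ) ^ max 1 (Finset.univ.filter fun k => J ⟨c, k⟩).card * K ^ q c) := by
  set E : Finset ((Σ c, Fin (q c)) × (Σ c, Fin (q c))) := Finset.univ.filter fun t => v t.1 = v t.2
  set R := ∏ c, ((N : ℝ) ^ max 1 (Finset.univ.filter fun k => J ⟨c, k⟩).card * K ^ q c)
  have hR : 0 ≤ R := Finset.prod_nonneg fun c _ => by positivity
  have hind : ∀ y : (Σ c, Fin (q c)) → Fin N, (if ∀ a b, y a = y b ↔ v a = v b then (1 : ℂ) else 0) =
      ∑ T ∈ Eᶜ.powerset, (-1) ^ T.card * ∏ t ∈ E ∪ T, if y t.1 = y t.2 then (1 : ℂ) else 0 := by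
    intro y
    have h1 : ∑ T ∈ Eᶜ.powerset, (-1) ^ T.card * ∏ t ∈ E ∪ T, (if y t.1 = y t.2 then (1 : ℂ) else 0)
        = (∏ t ∈ E, if y t.1 = y t.2 then (1 : ℂ) else 0) *
          ∏ t ∈ Eᶜ, (1 - if y t.1 = y t.2 then (1 : ℂ) else 0) := by
      rw [Finset.prod_sub, Finset.mul_sum]
      refine Finset.sum_congr rfl fun T hT => ?_
      rw [Finset.prod_union (disjoint_compl_right.mono_right (Finset.mem_powerset.1 hT))]
      simp
      ring
    rw [h1]
    split_ifs with h
    · rw [Finset.prod_eq_one, Finset.prod_eq_one, one_mul]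
      · intro t ht
        have : ¬ v t.1 = v t.2 := by simpa [E] using ht
        rw [if_neg (fun h' => this ((h _ _).1 h')), sub_zero]
      · intro t ht
        have : v t.1 = v t.2 := by simpa [E] using ht
        rw [if_pos ((h _ _).2 this)]
    · push Not at h
      obtain ⟨a, b, h | h⟩ := h
      · rw [Finset.prod_eq_zero (s := Eᶜ) (i := (a, b)), mul_zero]
        · simpa [E] using h.2
        · simp [h.1]
      · rw [Finset.prod_eq_zero (s := E) (i := (a, b)), zero_mul]
        · simpa [E] using h.2
        · simp [h.1]
  rw [Finset.sum_filter]
  have e : ∑ y : (Σ c, Fin (q c)) → Fin N, (if ∀ a b, y a = y b ↔ v a = v b then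
        ∏ a, C a (y a) (y (cycNext q a)) else 0) = ∑ T ∈ Eᶜ.powerset, (-1) ^ T.card *
        ∑ y : (Σ c, Fin (q c)) → Fin N, (∏ t ∈ E ∪ T, if y t.1 = y t.2 then (1 : ℂ) else 0) *
          ∏ a, C a (y a) (y (cycNext q a)) := by
    simp only [Finset.mul_sum]
    rw [Finset.sum_comm]
    refine Finset.sum_congr rfl fun y _ => ?_
    simp only [← mul_assoc]
    rw [← Finset.sum_mul, ← hind y, ite_mul, one_mul, zero_mul]
  rw [e]
  calc _ ≤ ∑ T ∈ Eᶜ.powerset, R := by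
        refine (norm_sum_le _ _).trans (Finset.sum_le_sum fun T _ => ?_)
        rw [norm_mul, norm_pow, norm_neg, norm_one, one_pow, one_mul]
        exact norm_sum_identified_le hN hK hq J _ C hC
    _ = 2 ^ (Eᶜ).card * R := by
        rw [Finset.sum_const, Finset.card_powerset, nsmul_eq_mul]; push_cast; rfl
    _ ≤ _ := by
        gcongr
        · exact one_le_two
        · exact Finset.card_le_univ _

end TraceBound

/-! ### Injective traces of graphs with even degrees -/

namespace EdgeGraph

open scoped Matrix.Norms.L2Operator

variable {W F : Type*} [Fintype F] {G : EdgeGraph W F}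

theorem src_eq_or_trg_eq_of_degree_pos {v : W} (h : 0 < G.degree v) :
    ∃ e, G.src e = v ∨ G.trg e = v := by
  rw [degree_eq_sum_inc] at h
  obtain ⟨e, -, he⟩ := Finset.exists_ne_zero_of_sum_ne_zero h.ne'
  obtain ⟨b, hb⟩ := exists_dart_of_inc_ne_zero he
  refine ⟨e, ?_⟩
  unfold dartTail at hb
  split_ifs at hb
  exacts [Or.inl hb, Or.inr hb]

open Classical in
/-- Bound for the injective trace of a graph of matrices with even degrees, some of the edges of
which carry the matrix with all the entries equal to one. -/
theorem norm_injective_sum_le [Fintype W] (hG : ∀ v, Even (G.degree v)) (hpos : ∀ v, 0 < G.degree v)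
    (J : F → Prop) {K : ℝ} (hK : 1 ≤ K) {N : ℕ} (hN : 0 < N)
    (B : F → Matrix (Fin N) (Fin N) ℂ) (hB : ∀ f, FlatOrBounded K (J f) (B f)) :
    ‖∑ ψ : W ↪ Fin N, ∏ f, B f (ψ (G.trg f)) (ψ (G.src f))‖ ≤
      2 ^ (Fintype.card F * Fintype.card F) * K ^ Fintype.card F * (N : ℝ) ^ (∑ c : G.Comp,
        max 1 (Finset.univ.filter fun f => J f ∧ G.compMk (G.src f) = c).card) := by
  obtain ⟨q, d, hq, hd, hc, hnext⟩ := exists_eulerian_positions hG hpos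
  set Φ := Equiv.ofBijective _ hd with hΦ
  have hΦa : ∀ a, Φ a = (d a).1 := fun a => rfl
  set v : (Σ c, Fin (q c)) → W := fun a => G.dartTail (d a) with hv
  have hvs : Function.Surjective v := by
    intro w
    obtain ⟨e, he⟩ := src_eq_or_trg_eq_of_degree_pos (hpos w)
    obtain ⟨a, ha⟩ := hd.2 e
    have h1 : v (cycNext q a) = G.dartHead (d a) := (hnext a).symm
    have h2 : v a = G.dartTail (d a) := rfl
    simp only at ha
    unfold dartHead at h1
    unfold dartTail at h2
    rw [ha] at h1 h2
    rcases he with rfl | rfl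
    · split_ifs at h1 h2
      exacts [⟨_, h2⟩, ⟨_, h1⟩]
    · split_ifs at h1 h2
      exacts [⟨_, h1⟩, ⟨_, h2⟩]
  -- An edge carries the entry (target, source), so travelling along its direction reads the
  -- transposed matrix.
  set C : (Σ c, Fin (q c)) → Matrix (Fin N) (Fin N) ℂ := fun a =>
    if (d a).2 then (B (d a).1).transpose else B (d a).1 with hCdef
  have hC : ∀ a, FlatOrBounded K (J (d a).1) (C a) := fun a => by
    simp only [hCdef]
    split_ifs
    exacts [(hB _).transpose, hB _]
  have hprod : ∀ ψ : W → Fin N, ∏ f, B f (ψ (G.trg f)) (ψ (G.src f)) =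
      ∏ a, C a (ψ (v a)) (ψ (v (cycNext q a))) := fun ψ => by
    rw [← Φ.prod_comp]
    refine Finset.prod_congr rfl fun a _ => ?_
    rw [hΦa, show v (cycNext q a) = G.dartHead (d a) from (hnext a).symm,
      show v a = G.dartTail (d a) from rfl]
    simp only [hCdef, dartTail, dartHead]
    split_ifs <;> rfl
  -- The trails visit every vertex, so an injective map on `W` is the same as a map on positions
  -- that has exactly the kernel of `v`.
  have hsum : ∑ ψ : W ↪ Fin N, ∏ f, B f (ψ (G.trg f)) (ψ (G.src f)) =
      ∑ y : (Σ c, Fin (q c)) → Fin N with ∀ a b, y a = y b ↔ v a = v b,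
        ∏ a, C a (y a) (y (cycNext q a)) := by
    refine Finset.sum_bij (fun ψ _ => ψ ∘ v) ?_ ?_ ?_ ?_
    · intro ψ _
      simp
    · intro ψ _ ψ' _ h
      ext w
      obtain ⟨a, rfl⟩ := hvs w
      exact congrArg Fin.val (congrFun h a)
    · intro y hy
      simp only [Finset.mem_filter, Finset.mem_univ, true_and] at hy
      obtain ⟨s, hs⟩ := hvs.hasRightInverse
      refine ⟨⟨fun w => y (s w), fun w w' h => ?_⟩, Finset.mem_univ _, ?_⟩
      · have := (hy _ _).1 h
        rwa [hs, hs] at this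
      · funext a
        exact (hy _ _).2 (hs _)
    · intro ψ _
      exact hprod ψ
  have hcard : Fintype.card (Σ c, Fin (q c)) = Fintype.card F := Fintype.card_congr Φ
  have hJ : ∀ c, (Finset.univ.filter fun k : Fin (q c) => J (d ⟨c, k⟩).1).card =
      (Finset.univ.filter fun f => J f ∧ G.compMk (G.src f) = c).card := fun c => by
    refine Finset.card_bij (fun k _ => Φ ⟨c, k⟩) ?_ ?_ ?_
    · intro k hk
      simp only [Finset.mem_filter, Finset.mem_univ, true_and] at hk ⊢
      exact ⟨hk, hc _⟩
    · intro k _ k' _ h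
      simpa using Φ.injective h
    · intro f hf
      simp only [Finset.mem_filter, Finset.mem_univ, true_and] at hf
      obtain ⟨⟨c', k⟩, rfl⟩ := Φ.surjective f
      have : c' = c := (hc ⟨c', k⟩).symm.trans hf.2
      subst this
      exact ⟨k, Finset.mem_filter.2 ⟨Finset.mem_univ _, hf.1⟩, rfl⟩
  rw [hsum]
  refine (norm_sum_kernel_le hN hK hq (fun a => J (d a).1) v C hC).trans (le_of_eq ?_)
  rw [Fintype.card_prod, hcard, Finset.prod_mul_distrib, Finset.prod_pow_eq_pow_sum,
    Finset.prod_pow_eq_pow_sum]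
  have : ∑ c, q c = Fintype.card F := by rw [← hcard]; simp
  rw [this]
  have e : ∀ c, (Finset.univ.filter fun k : Fin (q c) => (fun a => J (d a).1) ⟨c, k⟩).card =
      (Finset.univ.filter fun f => J f ∧ G.compMk (G.src f) = c).card := fun c => by
    rw [← hJ c]
  simp only [e]
  ring

end EdgeGraph

/-! ## Bundles of edges of the graph of deterministic components -/

/-- Take for `d` the distance to `R`: the first edge of a shortest walk decreases it. -/
theorem EdgeGraph.exists_lt_of_reaches {U F : Type*} (H : EdgeGraph U F) (R : Set U) :
    ∃ d : U → ℕ, ∀ u ∉ R, (∃ r ∈ R, H.compMk u = H.compMk r) →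
      ∃ f, ∃ u', u' ≠ u ∧ H.ends f = s(u, u') ∧ d u' < d u := by
  set S : U → Set ℕ := fun u => {m | ∃ r ∈ R, ∃ w : H.toSimple.Walk u r, w.length = m} with hS
  refine ⟨fun u => sInf (S u), fun u hu hr => ?_⟩
  have hne : (S u).Nonempty := by
    obtain ⟨r, hr, h⟩ := hr
    obtain ⟨w⟩ : H.toSimple.Reachable u r := SimpleGraph.ConnectedComponent.exact h
    exact ⟨_, r, hr, w, rfl⟩
  obtain ⟨r, hr, w, hw⟩ := Nat.sInf_mem hne
  cases w with
  | nil => exact absurd hr hu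
  | @cons _ u' _ hadj w =>
    have hlt : sInf (S u') < sInf (S u) := by
      have : sInf (S u') ≤ w.length := Nat.sInf_le ⟨r, hr, w, rfl⟩
      rw [SimpleGraph.Walk.length_cons] at hw
      omega
    obtain ⟨hne', ⟨f, h1, h2⟩ | ⟨f, h1, h2⟩⟩ := (SimpleGraph.fromRel_adj _ _ _).1 hadj
    · exact ⟨f, u', hne'.symm, by rw [EdgeGraph.ends, h1, h2], hlt⟩
    · exact ⟨f, u', hne'.symm, by rw [EdgeGraph.ends, h1, h2, Sym2.eq_swap], hlt⟩

/-- If the vertices of a set are connected to a set of roots, then they are at most as many as the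
edges counted without multiplicity that touch them. -/
theorem EdgeGraph.card_le_card_of_reaches {U F β : Type*} (H : EdgeGraph U F) (R : Set U)
    (A : Finset U) (hA : ∀ u ∈ A, u ∉ R ∧ ∃ r ∈ R, H.compMk u = H.compMk r) (b : F → β)
    (e : β → Sym2 U) (hb : ∀ f, e (b f) = H.ends f) (S : Finset β)
    (hS : ∀ f, ∀ u ∈ A, u ∈ H.ends f → b f ∈ S) : A.card ≤ S.card := by
  obtain ⟨d, hd⟩ := H.exists_lt_of_reaches R
  rcases A.eq_empty_or_nonempty with rfl | ⟨a, ha⟩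
  · simp
  have : Nonempty F := ⟨(hd a (hA a ha).1 (hA a ha).2).choose⟩
  choose! f hf using fun u (hu : u ∈ A) => hd u (hA u hu).1 (hA u hu).2
  -- Send each vertex to the bundle of its first edge towards the roots. Two distinct vertices with
  -- the same bundle would be its two ends, each closer to `R` than the other.
  refine Finset.card_le_card_of_injOn (fun u => b (f u)) (fun u hu => ?_) fun u hu v hv h => ?_
  · obtain ⟨u', -, h1, -⟩ := hf u hu
    exact hS _ u hu (by rw [h1]; exact Sym2.mem_mk_left _ _)
  · obtain ⟨u', -, h1, h2⟩ := hf u hu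
    obtain ⟨v', -, h3, h4⟩ := hf v hv
    simp only at h
    rw [← hb, h, hb, h3, Sym2.eq_iff] at h1
    rcases h1 with ⟨h, -⟩ | ⟨rfl, rfl⟩
    · exact h.symm
    · omega

section Bundles

variable {n : ℕ} {p : Fin n → ℕ} (π : Setoid (Vtx p))

/-- The subgraph `T_A^π`. -/
abbrev gA : EdgeGraph (Quotient π) (Pos p) := (cycA p).quot π

/-- The subgraph `T_X^π`. -/
abbrev gX : EdgeGraph (Quotient π) (Pos p) := (cycX p).quot π

/-- The bundle of twin edges that contains an edge of `T_X^π`. -/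
def bundle (k : Pos p) : Sym2 (Quotient π) := (gX π).ends k

open Classical in
/-- The multiplicity of a bundle. -/
def mult (s : Sym2 (Quotient π)) : ℕ := (Finset.univ.filter fun k => bundle π k = s).card

/-- The component of the graph of deterministic components that contains an edge of `T_X^π`. -/
def edgeComp (k : Pos p) : (gdc π).Comp := (gdc π).compMk (Sum.inl ((gX π).src k))

variable {π}

theorem edgeComp_eq_trg (k : Pos p) :
    edgeComp π k = (gdc π).compMk (Sum.inl ((gX π).trg k)) :=
  (gdc π).compMk_src (Sum.inl k)

theorem gdc_compMk_inl (v : Quotient π) :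
    (gdc π).compMk (Sum.inl v) = (gdc π).compMk (Sum.inr ((gA π).compMk v)) :=
  (gdc π).compMk_src (Sum.inr v)

theorem gdc_compMk_eq_of_gA {u v : Quotient π} (h : (gA π).compMk u = (gA π).compMk v) :
    (gdc π).compMk (Sum.inl u) = (gdc π).compMk (Sum.inl v) := by
  rw [gdc_compMk_inl, gdc_compMk_inl, h]

theorem mem_bundle {k : Pos p} {v : Quotient π} :
    v ∈ bundle π k ↔ v = (gX π).src k ∨ v = (gX π).trg k := by
  rw [bundle, EdgeGraph.ends, Sym2.mem_iff]

theorem edgeComp_of_mem_bundle {k : Pos p} {v : Quotient π} (h : v ∈ bundle π k) :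
    (gdc π).compMk (Sum.inl v) = edgeComp π k := by
  rcases mem_bundle.1 h with rfl | rfl
  · rfl
  · exact (edgeComp_eq_trg k).symm

theorem edgeComp_eq_of_bundle {k k' : Pos p} (h : bundle π k = bundle π k') :
    edgeComp π k = edgeComp π k' := by
  rw [← edgeComp_of_mem_bundle (v := (gX π).src k) (k := k')]
  · rfl
  · rw [← h]; exact mem_bundle.2 (Or.inl rfl)

theorem exists_edge_of_vertex (v : Quotient π) : ∃ k, v ∈ bundle π k := by
  obtain ⟨w, rfl⟩ := Quotient.exists_rep v
  rcases w with k | k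
  · exact ⟨k, mem_bundle.2 (Or.inr rfl)⟩
  · exact ⟨k, mem_bundle.2 (Or.inl rfl)⟩

theorem exists_edgeComp_eq (i : (gdc π).Comp) : ∃ k, edgeComp π k = i := by
  obtain ⟨w, rfl⟩ := (gdc π).compMk_surjective i
  have : ∃ v, (gdc π).compMk (Sum.inl v) = (gdc π).compMk w := by
    rcases w with v | c
    · exact ⟨v, rfl⟩
    · obtain ⟨v, rfl⟩ := (gA π).compMk_surjective c
      exact ⟨v, gdc_compMk_inl v⟩
  obtain ⟨v, hv⟩ := this
  obtain ⟨k, hk⟩ := exists_edge_of_vertex v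
  exact ⟨k, by rw [← edgeComp_of_mem_bundle hk, hv]⟩

theorem edgeComp_next (k : Pos p) : edgeComp π (next p k) = edgeComp π k := by
  rw [edgeComp_eq_trg]
  have h := (gA π).compMk_src k
  exact gdc_compMk_eq_of_gA h

theorem edgeComp_eq_of_fst_eq {k k' : Pos p} (h : k.1 = k'.1) : edgeComp π k = edgeComp π k' := by
  obtain ⟨j, k⟩ := k
  obtain ⟨j', k'⟩ := k'
  obtain rfl : j = j' := h
  have hm : 0 < p j := (Nat.zero_le _).trans_lt k.2
  have : ∀ m : ℕ, ∀ hm : m < p j, edgeComp π ⟨j, ⟨m, hm⟩⟩ = edgeComp π ⟨j, ⟨0, by omega⟩⟩ := by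
    intro m
    induction m with
    | zero => intro _; rfl
    | succ m ih =>
      intro hm1
      rw [← ih (by omega), ← edgeComp_next ⟨j, ⟨m, by omega⟩⟩]
      congr 1
      have : NeZero (p j) := ⟨hm.ne'⟩
      refine Sigma.ext rfl (heq_of_eq (Fin.ext ?_))
      simp only [next]
      rw [finRotate_apply, Fin.val_add_one_of_lt' (by simpa using hm1)]
  rw [this k.1 k.2, this k'.1 k'.2]

/-! ### The numbers `q₁` and `q₂` -/

open Classical in
variable (π) in
/-- The edges of `T_X^π` in a component. -/
def edgesIn (i : (gdc π).Comp) : Finset (Pos p) := Finset.univ.filter fun k => edgeComp π k = i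

open Classical in
variable (π) in
/-- The bundles in a component. -/
def bundlesIn (i : (gdc π).Comp) : Finset (Sym2 (Quotient π)) := (edgesIn π i).image (bundle π)

variable (π) in
/-- The components of `T_A^π` in a component of the graph of deterministic components. -/
def detCompsIn (i : (gdc π).Comp) : Set (gA π).Comp := {c | (gdc π).compMk (Sum.inr c) = i}

instance finite_comp {W F : Type*} [Finite W] (G : EdgeGraph W F) : Finite G.Comp :=
  Finite.of_surjective _ G.compMk_surjective

theorem mem_edgesIn {i : (gdc π).Comp} {k : Pos p} : k ∈ edgesIn π i ↔ edgeComp π k = i := by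
  simp [edgesIn]

theorem mem_bundlesIn {i : (gdc π).Comp} {k : Pos p} :
    bundle π k ∈ bundlesIn π i ↔ edgeComp π k = i := by
  simp only [bundlesIn, Finset.mem_image, mem_edgesIn]
  constructor
  · rintro ⟨k', rfl, h⟩
    exact (edgeComp_eq_of_bundle h).symm
  · exact fun h => ⟨k, h, rfl⟩

theorem gdc_ends_inl (k : Pos p) :
    (gdc π).ends (Sum.inl k) = Sym2.map Sum.inl (bundle π k) := rfl

theorem gdc_bundles_ncard (i : (gdc π).Comp) :
    Set.ncard {s : Sym2 (Quotient π ⊕ ((cycA p).quot π).Comp) | ∃ k : Pos p,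
      (gdc π).compMk ((gdc π).src (Sum.inl k)) = i ∧ (gdc π).ends (Sum.inl k) = s} =
      (bundlesIn π i).card := by
  rw [← Set.ncard_coe_finset, ← Set.ncard_image_of_injective _ (Sym2.map.injective
    (Sum.inl_injective (α := Quotient π) (β := ((cycA p).quot π).Comp)))]
  congr 1
  ext s
  simp only [Set.mem_ofPred_eq, Set.mem_image, Finset.mem_coe, bundlesIn, Finset.mem_image,
    mem_edgesIn, gdc_ends_inl]
  constructor
  · rintro ⟨k, h1, h2⟩
    exact ⟨_, ⟨k, h1, rfl⟩, h2⟩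
  · rintro ⟨_, ⟨k, h1, rfl⟩, h2⟩
    exact ⟨k, h1, h2⟩

theorem q₁_eq (i : (gdc π).Comp) :
    q₁ π i = (bundlesIn π i).card - ((edgesIn π i).card : ℚ) / 2 := by
  rw [q₁, gdc_bundles_ncard]
  congr 3
  rw [← Set.ncard_coe_finset]
  congr 1
  ext k
  simp only [Set.mem_ofPred_eq, Finset.mem_coe, mem_edgesIn]
  rfl

/-- Each vertex of `T^π` comes with exactly one edge towards its component of `T_A^π`, so the two
cancel. What remains is deterministic components minus bundles, an Euler characteristic of `T^π`
with its A-components contracted. -/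
theorem q₂_eq (i : (gdc π).Comp) :
    q₂ π i = (detCompsIn π i).ncard - ((bundlesIn π i).card : ℚ) := by
  set V : Set (Quotient π) := {v | (gdc π).compMk (Sum.inl v) = i} with hV
  have h1 : Set.ncard {w | (gdc π).compMk w = i} = V.ncard + (detCompsIn π i).ncard := by
    rw [← Set.ncard_image_of_injective V Sum.inl_injective,
      ← Set.ncard_image_of_injective (detCompsIn π i) Sum.inr_injective, ← Set.ncard_union_eq]
    · congr 1
      ext w
      rcases w with v | c <;> simp [hV, detCompsIn]
    · rw [Set.disjoint_left]
      rintro _ ⟨v, -, rfl⟩ ⟨c, -, h⟩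
      exact absurd h (by simp)
  set f : Quotient π → Sym2 (Quotient π ⊕ ((cycA p).quot π).Comp) :=
    fun v => s(Sum.inl v, Sum.inr ((gA π).compMk v)) with hf
  have hfi : Function.Injective f := by
    intro v w h
    simp only [hf, Sym2.eq_iff] at h
    rcases h with ⟨h, -⟩ | ⟨h, -⟩
    · exact Sum.inl_injective h
    · exact absurd h (by simp)
  have h2 : Set.ncard {s : Sym2 (Quotient π ⊕ ((cycA p).quot π).Comp) |
      ∃ e, (gdc π).compMk ((gdc π).src e) = i ∧ (gdc π).ends e = s} =
      (bundlesIn π i).card + V.ncard := by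
    rw [← gdc_bundles_ncard, ← Set.ncard_image_of_injective V hfi, ← Set.ncard_union_eq]
    · congr 1
      ext s
      simp only [Set.mem_ofPred_eq, Set.mem_union, Set.mem_image]
      constructor
      · rintro ⟨k | v, h1, h2⟩
        · exact Or.inl ⟨k, h1, h2⟩
        · exact Or.inr ⟨v, h1, h2⟩
      · rintro (⟨k, h1, h2⟩ | ⟨v, h1, h2⟩)
        · exact ⟨Sum.inl k, h1, h2⟩
        · exact ⟨Sum.inr v, h1, h2⟩
    · rw [Set.disjoint_left]
      rintro _ ⟨k, -, rfl⟩ ⟨v, -, h⟩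
      rw [gdc_ends_inl] at h
      have : Sum.inr ((gA π).compMk v) ∈ Sym2.map Sum.inl (bundle π k) := by
        rw [← h]; exact Sym2.mem_mk_right _ _
      rw [Sym2.mem_map] at this
      obtain ⟨_, _, h⟩ := this
      exact absurd h (by simp)
  rw [q₂, h1, h2]
  push_cast
  ring

theorem card_edgesIn_eq_sum (i : (gdc π).Comp) :
    (edgesIn π i).card = ∑ s ∈ bundlesIn π i, mult π s := by
  classical
  rw [bundlesIn, Finset.card_eq_sum_card_image (bundle π)]
  refine Finset.sum_congr rfl fun s hs => ?_
  rw [mult]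
  congr 1
  ext k
  obtain ⟨k', hk', rfl⟩ := Finset.mem_image.1 hs
  simp only [Finset.mem_filter, Finset.mem_univ, true_and, mem_edgesIn, and_iff_right_iff_imp]
  exact fun h => (edgeComp_eq_of_bundle h).trans (mem_edgesIn.1 hk')

theorem sum_card_edgesIn [Fintype (gdc π).Comp] :
    ∑ i, (edgesIn π i).card = Fintype.card (Pos p) := by
  classical
  rw [← Finset.card_univ, Finset.card_eq_sum_card_fiberwise (f := edgeComp π) (t := Finset.univ)
    (by simp)]
  rfl

theorem sum_ncard_detCompsIn [Fintype (gdc π).Comp] :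
    ∑ i, (detCompsIn π i).ncard = Nat.card (gA π).Comp := by
  classical
  have := Fintype.ofFinite (gA π).Comp
  rw [Nat.card_eq_fintype_card, ← Finset.card_univ, Finset.card_eq_sum_card_fiberwise
    (f := fun c => (gdc π).compMk (Sum.inr c)) (t := Finset.univ) (by simp)]
  refine Finset.sum_congr rfl fun i _ => ?_
  rw [← Set.ncard_coe_finset]
  congr 1
  ext c
  simp [detCompsIn]

end Bundles

/-! ### Power counting, component by component -/

section Exponents

variable {n : ℕ} {p : Fin n → ℕ} {π : Setoid (Vtx p)}

/-! ### Counting deterministic components -/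

variable (π) in
/-- The graph whose vertices are the components of `T_A^π` and whose edges are those of `T_X^π`. -/
def detGraph : EdgeGraph (gA π).Comp (Pos p) where
  src k := (gA π).compMk ((gX π).src k)
  trg k := (gA π).compMk ((gX π).trg k)

theorem detGraph_ends (k : Pos p) :
    Sym2.map (gA π).compMk (bundle π k) = (detGraph π).ends k := rfl

theorem detGraph_compMk_eq {c d : (gA π).Comp}
    (h : (gdc π).compMk (Sum.inr c) = (gdc π).compMk (Sum.inr d)) :
    (detGraph π).compMk c = (detGraph π).compMk d := by
  refine EdgeGraph.eq_of_compMk_eq (G := gdc π)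
    (χ := Sum.elim (fun v => (detGraph π).compMk ((gA π).compMk v)) (detGraph π).compMk) ?_ h
  rintro (k | v)
  · exact (detGraph π).compMk_src k
  · rfl

theorem edgeComp_of_mem_detGraph_ends {c : (gA π).Comp} {k : Pos p}
    (h : c ∈ (detGraph π).ends k) : (gdc π).compMk (Sum.inr c) = edgeComp π k := by
  rw [← detGraph_ends, Sym2.mem_map] at h
  obtain ⟨v, hv, rfl⟩ := h
  rw [← gdc_compMk_inl, edgeComp_of_mem_bundle hv]

/-- A connected graph has at most one more vertex than edges. Here this is applied to `detGraph`,
with root `c₀`. -/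
theorem ncard_detCompsIn_le (i : (gdc π).Comp) :
    (detCompsIn π i).ncard ≤ (bundlesIn π i).card + 1 := by
  classical
  have := Fintype.ofFinite (gA π).Comp
  obtain ⟨k, rfl⟩ := exists_edgeComp_eq i
  set c₀ := (gA π).compMk ((gX π).src k)
  rw [Set.ncard_eq_toFinset_card']
  have hle := (detGraph π).card_le_card_of_reaches {c₀}
    ((detCompsIn π (edgeComp π k)).toFinset.erase c₀) (fun c hc => by
      rw [Finset.mem_erase, Set.mem_toFinset] at hc
      exact ⟨hc.1, c₀, rfl, detGraph_compMk_eq (hc.2.trans (gdc_compMk_inl _))⟩)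
    (bundle π) _ detGraph_ends (bundlesIn π (edgeComp π k)) (fun f c hc hcf => by
      rw [Finset.mem_erase, Set.mem_toFinset] at hc
      rw [mem_bundlesIn, ← edgeComp_of_mem_detGraph_ends hcf]
      exact hc.2)
  have := Finset.pred_card_le_card_erase (a := c₀) (s := (detCompsIn π (edgeComp π k)).toFinset)
  omega

/-- In a component of tree type, each bundle is a bridge. -/
theorem exists_cut {k₀ : Pos p} (h : q₂ π (edgeComp π k₀) = 1) : ∃ χ : Quotient π → Prop,
    (∀ k, χ ((gA π).src k) = χ ((gA π).trg k)) ∧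
    (∀ k, bundle π k ≠ bundle π k₀ → χ ((gX π).src k) = χ ((gX π).trg k)) ∧
    χ ((gX π).src k₀) ∧ ¬ χ ((gX π).trg k₀) := by
  classical
  have := Fintype.ofFinite (gA π).Comp
  set H := (detGraph π).restrict {k | bundle π k ≠ bundle π k₀} with hH
  set c₀ := (gA π).compMk ((gX π).src k₀) with hc₀
  refine ⟨fun v => H.compMk ((gA π).compMk v) = H.compMk c₀, fun k => ?_, fun k hk => ?_, rfl, ?_⟩
  · simp only [(gA π).compMk_src k]
  · have := H.compMk_src ⟨k, hk⟩
    change H.compMk ((gA π).compMk ((gX π).src k)) = H.compMk ((gA π).compMk ((gX π).trg k)) at this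
    simp only [this]
  -- If the ends of `k₀` stayed connected without its bundle, the component would remain connected
  -- with one bundle fewer, so the deterministic components would be no more than the bundles,
  -- against `q₂ = 1`.
  · intro hcon
    have hconn : ∀ c d, (detGraph π).compMk c = (detGraph π).compMk d →
        H.compMk c = H.compMk d := fun c d hcd => by
      refine EdgeGraph.eq_of_compMk_eq (G := detGraph π) (fun k => ?_) hcd
      by_cases hk : bundle π k = bundle π k₀
      · have h1 : ∀ v ∈ bundle π k, H.compMk ((gA π).compMk v) = H.compMk c₀ := by
          rw [hk]
          intro v hv
          rcases mem_bundle.1 hv with rfl | rfl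
          exacts [rfl, hcon]
        exact (h1 _ (mem_bundle.2 (Or.inl rfl))).trans (h1 _ (mem_bundle.2 (Or.inr rfl))).symm
      · exact H.compMk_src ⟨k, hk⟩
    have hle := H.card_le_card_of_reaches {c₀}
      ((detCompsIn π (edgeComp π k₀)).toFinset.erase c₀) (fun c hc => by
        rw [Finset.mem_erase, Set.mem_toFinset] at hc
        exact ⟨hc.1, c₀, rfl, hconn _ _ (detGraph_compMk_eq (hc.2.trans (gdc_compMk_inl _)))⟩)
      (fun k => bundle π k.1) _ (fun k => detGraph_ends k.1)
      ((bundlesIn π (edgeComp π k₀)).erase (bundle π k₀)) (fun f c hc hcf => by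
        rw [Finset.mem_erase, Set.mem_toFinset] at hc
        rw [Finset.mem_erase, mem_bundlesIn]
        exact ⟨f.2, (edgeComp_of_mem_detGraph_ends (k := f.1) hcf).symm.trans hc.2⟩)
    have h1 := Finset.pred_card_le_card_erase (a := c₀)
      (s := (detCompsIn π (edgeComp π k₀)).toFinset)
    have h2 := Finset.card_erase_add_one (mem_bundlesIn.2 (rfl : edgeComp π k₀ = edgeComp π k₀))
    rw [q₂_eq, Set.ncard_eq_toFinset_card', sub_eq_iff_eq_add] at h
    have h3 : (detCompsIn π (edgeComp π k₀)).toFinset.card =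
      1 + (bundlesIn π (edgeComp π k₀)).card := by exact_mod_cast h
    omega

open Classical in
/-- In a component of tree type, each cycle travels along a bundle as often in both directions. -/
theorem card_forward_eq_card_backward {k₀ : Pos p} (h : q₂ π (edgeComp π k₀) = 1) (j : Fin n) :
    (Finset.univ.filter fun k : Fin (p j) => bundle π ⟨j, k⟩ = bundle π k₀ ∧
      (gX π).src ⟨j, k⟩ = (gX π).src k₀).card =
    (Finset.univ.filter fun k : Fin (p j) => bundle π ⟨j, k⟩ = bundle π k₀ ∧
      (gX π).src ⟨j, k⟩ = (gX π).trg k₀).card := by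
  obtain ⟨χ, hA, hX, h1, h2⟩ := exists_cut h
  -- Along the closed cycle `j` the total variation of the indicator of the cut is zero. A-edges and
  -- other bundles do not change it, and passages through the bundle of `k₀` change it by one, with
  -- the sign of the direction.
  set f : Quotient π → ℤ := fun v => if χ v then 1 else 0 with hf
  have hs : ∑ k : Fin (p j), (f ((gX π).src ⟨j, k⟩) - f ((gX π).trg ⟨j, k⟩)) = 0 := by
    have e1 : ∀ k : Fin (p j), f ((gX π).src ⟨j, k⟩) =
        f ((gX π).trg ⟨j, finRotate (p j) k⟩) := fun k => by
      have := hA ⟨j, k⟩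
      change χ ((gX π).trg ⟨j, finRotate (p j) k⟩) = χ ((gX π).src ⟨j, k⟩) at this
      simp only [hf, this]
    rw [Finset.sum_sub_distrib]
    simp only [e1]
    rw [Equiv.sum_comp (finRotate (p j)) (fun k => f ((gX π).trg ⟨j, k⟩)), sub_self]
  have hne : (gX π).src k₀ ≠ (gX π).trg k₀ := fun h => h2 (h ▸ h1)
  have ht : ∀ k : Fin (p j), f ((gX π).src ⟨j, k⟩) - f ((gX π).trg ⟨j, k⟩) =
      (if bundle π ⟨j, k⟩ = bundle π k₀ ∧ (gX π).src ⟨j, k⟩ = (gX π).src k₀ then 1 else 0) -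
      (if bundle π ⟨j, k⟩ = bundle π k₀ ∧ (gX π).src ⟨j, k⟩ = (gX π).trg k₀ then 1 else 0) := by
    intro k
    by_cases hb : bundle π ⟨j, k⟩ = bundle π k₀
    · have hb' := hb
      rw [bundle, bundle, EdgeGraph.ends, EdgeGraph.ends, Sym2.eq_iff] at hb'
      rcases hb' with ⟨e1, e2⟩ | ⟨e1, e2⟩
      · simp [hf, hb, e1, e2, h1, h2, hne]
      · simp [hf, hb, e1, e2, h1, h2, hne.symm]
    · simp [hf, hb, hX _ hb]
  simp only [ht, Finset.sum_sub_distrib, Finset.sum_boole] at hs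
  exact_mod_cast sub_eq_zero.1 hs

theorem src_ne_trg_of_tree {k₀ : Pos p} (h : q₂ π (edgeComp π k₀) = 1) :
    (gX π).src k₀ ≠ (gX π).trg k₀ := by
  obtain ⟨χ, -, -, h1, h2⟩ := exists_cut h
  exact fun h => h2 (h ▸ h1)

open Classical in
theorem card_cycle_bundle_eq {k₀ : Pos p} (h : q₂ π (edgeComp π k₀) = 1) (j : Fin n) :
    (Finset.univ.filter fun k : Fin (p j) => bundle π ⟨j, k⟩ = bundle π k₀).card =
    2 * (Finset.univ.filter fun k : Fin (p j) => bundle π ⟨j, k⟩ = bundle π k₀ ∧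
      (gX π).src ⟨j, k⟩ = (gX π).src k₀).card := by
  have hne := src_ne_trg_of_tree h
  rw [two_mul]
  nth_rw 2 [card_forward_eq_card_backward h j]
  rw [← Finset.card_union_of_disjoint]
  · congr 1
    ext k
    simp only [Finset.mem_filter, Finset.mem_univ, true_and, Finset.mem_union, ← and_or_left,
      iff_self_and]
    intro hb
    rw [← mem_bundle, ← hb]
    exact mem_bundle.2 (Or.inl rfl)
  · rw [Finset.disjoint_filter]
    rintro k - ⟨-, h1⟩ ⟨-, h2⟩
    exact hne (h1.symm.trans h2)

theorem mult_eq_sum (s : Sym2 (Quotient π)) [DecidableEq (Sym2 (Quotient π))] :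
    mult π s = ∑ j, (Finset.univ.filter fun k : Fin (p j) => bundle π ⟨j, k⟩ = s).card := by
  classical
  rw [mult, Finset.card_filter, Fintype.sum_sigma]
  refine Finset.sum_congr rfl fun j _ => ?_
  rw [Finset.card_filter]
  refine Finset.sum_congr rfl fun k _ => ?_
  congr

theorem even_mult_of_tree {k₀ : Pos p} (h : q₂ π (edgeComp π k₀) = 1) :
    Even (mult π (bundle π k₀)) := by
  classical
  rw [mult_eq_sum]
  exact Finset.even_sum _ fun j _ => by rw [card_cycle_bundle_eq h]; exact even_two_mul _

/-! ### Inequalities in one component -/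

theorem mult_pos {i : (gdc π).Comp} {s : Sym2 (Quotient π)} (hs : s ∈ bundlesIn π i) :
    ∃ k, edgeComp π k = i ∧ bundle π k = s := by
  classical
  obtain ⟨k, hk, rfl⟩ := Finset.mem_image.1 hs
  exact ⟨k, mem_edgesIn.1 hk, rfl⟩

variable (π) in
open Classical in
/-- The bundles of odd multiplicity in a component. -/
def oddIn (i : (gdc π).Comp) : Finset (Sym2 (Quotient π)) :=
  (bundlesIn π i).filter fun s => Odd (mult π s)

variable (π) in
/-- A component of `T_A^π` that is touched by a bundle of odd multiplicity. -/
def Touched (c : (gA π).Comp) : Prop :=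
  ∃ k, Odd (mult π (bundle π k)) ∧ c ∈ (detGraph π).ends k

variable (π) in
/-- The components of `T_A^π` that are not touched by a bundle of odd multiplicity. -/
def untouchedIn (i : (gdc π).Comp) : Set (gA π).Comp := {c | c ∈ detCompsIn π i ∧ ¬ Touched π c}

theorem untouchedIn_of_oddIn_eq_empty {i : (gdc π).Comp} (h : oddIn π i = ∅) :
    untouchedIn π i = detCompsIn π i := by
  ext c
  simp only [untouchedIn, Set.mem_ofPred_eq, and_iff_left_iff_imp]
  rintro hc ⟨k, hk, hck⟩
  have : bundle π k ∈ oddIn π i := by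
    rw [oddIn, Finset.mem_filter, mem_bundlesIn]
    exact ⟨(edgeComp_of_mem_detGraph_ends hck).symm.trans hc, hk⟩
  rw [h] at this
  simp at this

/-- Take the touched components as roots. A bundle that meets an untouched component is not odd, so
the untouched components inject into the bundles of even multiplicity. -/
theorem ncard_untouchedIn_le {i : (gdc π).Comp} (h : (oddIn π i).Nonempty) :
    (untouchedIn π i).ncard + (oddIn π i).card ≤ (bundlesIn π i).card := by
  classical
  have := Fintype.ofFinite (gA π).Comp
  obtain ⟨s, hs⟩ := h
  rw [oddIn, Finset.mem_filter] at hs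
  obtain ⟨k, hki, rfl⟩ := mult_pos hs.1
  have ht : Touched π ((gA π).compMk ((gX π).src k)) := ⟨k, hs.2, Sym2.mem_mk_left _ _⟩
  have hle := (detGraph π).card_le_card_of_reaches {c | Touched π c}
    (untouchedIn π i).toFinset (fun c hc => by
      rw [Set.mem_toFinset] at hc
      exact ⟨hc.2, _, ht, detGraph_compMk_eq
        (Eq.trans hc.1 (hki.symm.trans (gdc_compMk_inl _)))⟩)
    (bundle π) _ detGraph_ends (bundlesIn π i \ oddIn π i) (fun f c hc hcf => by
      rw [Set.mem_toFinset] at hc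
      have h1 : bundle π f ∈ bundlesIn π i := by
        rw [mem_bundlesIn, ← edgeComp_of_mem_detGraph_ends hcf]
        exact hc.1
      rw [Finset.mem_sdiff]
      refine ⟨h1, fun h2 => hc.2 ⟨f, ?_, hcf⟩⟩
      rw [oddIn, Finset.mem_filter] at h2
      exact h2.2)
  rw [Set.ncard_eq_toFinset_card']
  have h3 : oddIn π i ⊆ bundlesIn π i := Finset.filter_subset _ _
  have h4 := Finset.card_sdiff_add_card_eq_card h3
  omega

/-- An odd multiplicity that is at least two is at least three. -/
theorem card_edgesIn_ge (hm : ∀ k, 2 ≤ mult π (bundle π k)) (i : (gdc π).Comp) :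
    2 * (bundlesIn π i).card + (oddIn π i).card ≤ (edgesIn π i).card := by
  classical
  have h1 : (oddIn π i).card = ∑ s ∈ bundlesIn π i, if Odd (mult π s) then 1 else 0 := by
    rw [oddIn, Finset.card_filter]
  rw [card_edgesIn_eq_sum, h1, Finset.card_eq_sum_ones, Finset.mul_sum, ← Finset.sum_add_distrib]
  refine Finset.sum_le_sum fun s hs => ?_
  obtain ⟨k, -, rfl⟩ := mult_pos hs
  have := hm k
  split_ifs with ho
  · obtain ⟨m, hm⟩ := ho
    omega
  · omega

theorem mult_eq_two_of_q₁ (hm : ∀ k, 2 ≤ mult π (bundle π k)) {i : (gdc π).Comp}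
    (h : q₁ π i = 0) {k : Pos p} (hk : edgeComp π k = i) : mult π (bundle π k) = 2 := by
  have h1 : (edgesIn π i).card = 2 * (bundlesIn π i).card := by
    rw [q₁_eq] at h
    have : ((edgesIn π i).card : ℚ) = 2 * (bundlesIn π i).card := by linarith
    exact_mod_cast this
  rw [card_edgesIn_eq_sum, Finset.card_eq_sum_ones, Finset.mul_sum, eq_comm,
    Finset.sum_eq_sum_iff_of_le] at h1
  · simpa using (h1 _ (mem_bundlesIn.2 hk)).symm
  · intro s hs
    obtain ⟨k, -, rfl⟩ := mult_pos hs
    exact hm k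

variable (π) in
/-- Each cycle shares a bundle with another cycle. -/
def Linked : Prop := ∀ j : Fin n, ∃ k k' : Pos p, k.1 = j ∧ k'.1 ≠ j ∧ bundle π k = bundle π k'

/-- In a double tree a bundle has two edges, and each cycle uses it an even number of times: two
cycles sharing it would need four. -/
theorem not_isDoubleTree_of_linked (hm : ∀ k, 2 ≤ mult π (bundle π k)) (hl : Linked π)
    (i : (gdc π).Comp) : ¬ IsDoubleTree π i := by
  classical
  rintro ⟨h1, h2⟩
  obtain ⟨k₀, rfl⟩ := exists_edgeComp_eq i
  obtain ⟨k, k', hk, hk', hb⟩ := hl k₀.1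
  have hc : edgeComp π k = edgeComp π k₀ := edgeComp_eq_of_fst_eq hk
  have h3 := mult_eq_two_of_q₁ hm h1 hc
  rw [← hc] at h2
  have h4 := fun j => card_cycle_bundle_eq h2 j
  rw [mult_eq_sum] at h3
  have h5 : ∀ l : Pos p, bundle π l = bundle π k →
      2 ≤ (Finset.univ.filter fun m : Fin (p l.1) => bundle π ⟨l.1, m⟩ = bundle π k).card := by
    intro l hl
    have : 0 < (Finset.univ.filter fun m : Fin (p l.1) => bundle π ⟨l.1, m⟩ = bundle π k).card :=
      Finset.card_pos.2 ⟨l.2, by simpa using hl⟩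
    rw [h4] at this ⊢
    omega
  have h6 := Finset.add_le_sum (f := fun j =>
    (Finset.univ.filter fun m : Fin (p j) => bundle π ⟨j, m⟩ = bundle π k).card)
    (s := Finset.univ) (fun _ _ => Nat.zero_le _) (Finset.mem_univ k.1) (Finset.mem_univ k'.1)
    (by rw [hk]; exact hk'.symm)
  have h7 := h5 k rfl
  have h8 := h5 k' hb.symm
  omega

theorem even_card_edgesIn {i : (gdc π).Comp} (h : oddIn π i = ∅) : Even (edgesIn π i).card := by
  rw [card_edgesIn_eq_sum]
  refine Finset.even_sum _ fun s hs => ?_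
  by_contra hne
  have : s ∈ oddIn π i := by
    rw [oddIn, Finset.mem_filter]
    exact ⟨hs, Nat.not_even_iff_odd.1 hne⟩
  rw [h] at this
  simp at this

/-- Let `b` count bundles and `d` deterministic components. Without odd bundles there are `2m`
edges, with `m ≥ b` and `d ≤ b + 1`, and `(m, d) = (b, b + 1)` is a double tree, which is excluded.
So `d ≤ m`, with equality only at `m = d = b` (unicyclic) or `m = d = b + 1` (2-4 tree). An odd
bundle makes the inequality strict: the exponent is at most `b`, while there are more than `2b`
edges. -/
theorem exponent_le_of_linked (hm : ∀ k, 2 ≤ mult π (bundle π k)) (hl : Linked π)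
    (i : (gdc π).Comp) :
    2 * ((oddIn π i).card + (untouchedIn π i).ncard) ≤ (edgesIn π i).card ∧
    (2 * ((oddIn π i).card + (untouchedIn π i).ncard) = (edgesIn π i).card →
      IsDoubleUnicyclic π i ∨ IsTwoFourTree π i) := by
  have h1 := card_edgesIn_ge hm i
  rcases (oddIn π i).eq_empty_or_nonempty with h | h
  · obtain ⟨m, hmm⟩ := even_card_edgesIn h
    have h2 := ncard_detCompsIn_le i
    have h3 := not_isDoubleTree_of_linked hm hl i
    rw [untouchedIn_of_oddIn_eq_empty h, h, Finset.card_empty]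
    simp only [IsDoubleTree, IsDoubleUnicyclic, IsTwoFourTree, q₁_eq, q₂_eq, hmm] at h3 ⊢
    rw [h, Finset.card_empty] at h1
    have h4 : ¬ (m = (bundlesIn π i).card ∧ (detCompsIn π i).ncard = (bundlesIn π i).card + 1) := by
      rintro ⟨e1, e2⟩
      exact h3 ⟨by rw [e1]; push_cast; ring, by rw [e2]; push_cast; ring⟩
    refine ⟨by omega, fun h5 => ?_⟩
    rcases Nat.lt_or_ge (bundlesIn π i).card m with h6 | h6
    · right
      have e1 : m = (bundlesIn π i).card + 1 := by omega
      have e2 : (detCompsIn π i).ncard = (bundlesIn π i).card + 1 := by omega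
      rw [e1, e2]
      constructor <;> (push_cast; ring)
    · left
      have e1 : m = (bundlesIn π i).card := by omega
      have e2 : (detCompsIn π i).ncard = (bundlesIn π i).card := by omega
      rw [e1, e2]
      constructor <;> (push_cast; ring)
  · have h2 := ncard_untouchedIn_le h
    have h3 := h.card_pos
    exact ⟨by omega, fun h => by omega⟩

/-- The same count as in the linked case, where double trees are now allowed and realize the
maximum. -/
theorem exponent_le_add_two (hm : ∀ k, 2 ≤ mult π (bundle π k)) (i : (gdc π).Comp) :
    2 * ((oddIn π i).card + (untouchedIn π i).ncard) ≤ (edgesIn π i).card + 2 ∧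
    (2 * ((oddIn π i).card + (untouchedIn π i).ncard) = (edgesIn π i).card + 2 →
      IsDoubleTree π i) := by
  have h1 := card_edgesIn_ge hm i
  rcases (oddIn π i).eq_empty_or_nonempty with h | h
  · have h2 := ncard_detCompsIn_le i
    rw [untouchedIn_of_oddIn_eq_empty h, h, Finset.card_empty]
    rw [h, Finset.card_empty] at h1
    refine ⟨by omega, fun h5 => ?_⟩
    simp only [IsDoubleTree, q₁_eq, q₂_eq]
    have e1 : (edgesIn π i).card = 2 * (bundlesIn π i).card := by omega
    have e2 : (detCompsIn π i).ncard = (bundlesIn π i).card + 1 := by omega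
    rw [e1, e2]
    constructor <;> (push_cast; ring)
  · have h2 := ncard_untouchedIn_le h
    have h3 := h.card_pos
    exact ⟨by omega, fun h => by omega⟩

end Exponents

/-! ### Growth of the injective trace of `T_A^π` -/

section InjectiveTrace

variable {n : ℕ} {p : Fin n → ℕ} {π : Setoid (Vtx p)}

/-! ### Making the degrees even -/

open Classical in
/-- The number of end points of an unordered pair that are equal to a given vertex. -/
def symInc {W : Type*} (w : W) : Sym2 W → ℕ :=
  Sym2.lift ⟨fun a b => (if a = w then 1 else 0) + (if b = w then 1 else 0),
    fun _ _ => add_comm _ _⟩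

variable (π) in
/-- The bundles of odd multiplicity. -/
abbrev OddBundle : Type := {s : Sym2 (Quotient π) // Odd (mult π s)}

theorem exists_bundle_eq {s : Sym2 (Quotient π)} (h : 0 < mult π s) : ∃ k, bundle π k = s := by
  classical
  obtain ⟨k, hk⟩ := Finset.card_pos.1 h
  exact ⟨k, by simpa using hk⟩

/-- A representative of a bundle of odd multiplicity. -/
def OddBundle.rep (s : OddBundle π) : Pos p := (exists_bundle_eq s.2.pos).choose

theorem OddBundle.bundle_rep (s : OddBundle π) : bundle π s.rep = s.1 :=
  (exists_bundle_eq s.2.pos).choose_spec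

variable (π) in
/-- One edge for each bundle of odd multiplicity. -/
def oddGraph : EdgeGraph (Quotient π) (OddBundle π) where
  src s := (gX π).src s.rep
  trg s := (gX π).trg s.rep

theorem oddGraph_ends (s : OddBundle π) : (oddGraph π).ends s = s.1 := s.bundle_rep

variable (π) in
/-- The graph `T_A^π` with one more edge for each bundle of odd multiplicity. -/
def evenGraph : EdgeGraph (Quotient π) (Pos p ⊕ OddBundle π) := (gA π).union (oddGraph π)

theorem next_bijective (p : Fin n → ℕ) : Function.Bijective (next p) := by
  constructor
  · rintro ⟨j, k⟩ ⟨j', k'⟩ h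
    obtain rfl : j = j' := congrArg Sigma.fst h
    have : finRotate (p j) k = finRotate (p j) k' := by simpa [next] using h
    rw [(finRotate (p j)).injective this]
  · rintro ⟨j, k⟩
    exact ⟨⟨j, (finRotate (p j)).symm k⟩, by simp only [next, Equiv.apply_symm_apply]⟩

/-- In `T` each vertex is an end of exactly one A-edge and one X-edge, since `next` is a bijection.
Hence both subgraphs have the same degrees in every quotient. -/
theorem gA_degree (w : Quotient π) : (gA π).degree w = ∑ k, symInc w (bundle π k) := by
  classical
  rw [EdgeGraph.degree_eq_sum_inc]
  simp only [EdgeGraph.inc, bundle, EdgeGraph.ends, symInc, Sym2.lift_mk]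
  rw [Finset.sum_add_distrib, Finset.sum_add_distrib, add_comm]
  congr 1
  exact Fintype.sum_equiv (Equiv.ofBijective _ (next_bijective p)) _ _ fun k => rfl

open Classical in
theorem sum_symInc_bundle (w : Quotient π) :
    ∑ k, symInc w (bundle π k) = ∑ s, mult π s * symInc w s := by
  rw [← Finset.sum_fiberwise_of_maps_to (s := Finset.univ) (t := Finset.univ)
    (g := bundle π) (by simp)]
  refine Finset.sum_congr rfl fun s _ => ?_
  rw [mult, Finset.card_eq_sum_ones, Finset.sum_mul]
  refine Finset.sum_congr rfl fun k hk => ?_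
  rw [(Finset.mem_filter.1 hk).2, one_mul]

theorem gA_degree_pos (w : Quotient π) : 0 < (gA π).degree w := by
  classical
  rw [gA_degree]
  obtain ⟨k, hk⟩ := exists_edge_of_vertex w
  refine Finset.sum_pos' (fun _ _ => Nat.zero_le _) ⟨k, Finset.mem_univ _, ?_⟩
  simp only [bundle, EdgeGraph.ends, symInc, Sym2.lift_mk]
  rcases mem_bundle.1 hk with rfl | rfl <;> simp

theorem gA_degree_even (h : ∀ k, Even (mult π (bundle π k))) (w : Quotient π) :
    Even ((gA π).degree w) := by
  classical
  rw [gA_degree, sum_symInc_bundle]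
  refine Finset.even_sum _ fun s _ => ?_
  rcases (mult π s).eq_zero_or_pos with h0 | h0
  · simp [h0]
  · obtain ⟨k, rfl⟩ := exists_bundle_eq h0
    exact (h k).mul_right _

open Classical in
theorem evenGraph_degree (w : Quotient π) :
    (evenGraph π).degree w = (gA π).degree w + ∑ s : OddBundle π, symInc w s.1 := by
  rw [EdgeGraph.degree_eq_sum_inc, Fintype.sum_sum_type, EdgeGraph.degree_eq_sum_inc]
  congr 1
  refine Finset.sum_congr rfl fun s _ => ?_
  rw [← oddGraph_ends s]
  rfl

/-- Modulo two only the odd bundles contribute to the degree in `T_A^π`, and the added edges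
contribute the same amount a second time. -/
theorem evenGraph_degree_even (w : Quotient π) : Even ((evenGraph π).degree w) := by
  classical
  rw [evenGraph_degree, gA_degree, sum_symInc_bundle,
    ← Finset.sum_subtype (Finset.univ.filter fun s => Odd (mult π s)) (by simp) (symInc w),
    Finset.sum_filter, ← Finset.sum_add_distrib]
  refine Finset.even_sum _ fun s _ => ?_
  split_ifs with h
  · obtain ⟨m, hm⟩ := h
    exact ⟨(m + 1) * symInc w s, by rw [hm]; ring⟩
  · rw [Nat.not_odd_iff_even] at h
    simpa using h.mul_right _

theorem evenGraph_degree_pos (w : Quotient π) : 0 < (evenGraph π).degree w := by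
  classical
  rw [evenGraph_degree]
  exact Nat.add_pos_left (gA_degree_pos w) _

/-! ### The bound for the injective trace -/

variable (π) in
/-- The exponent in the bound for the injective trace of `T_A^π`. -/
def traceExponent : ℕ := ∑ᶠ i : (gdc π).Comp, ((oddIn π i).card + (untouchedIn π i).ncard)

theorem sum_card_oddIn [Fintype (gdc π).Comp] [Fintype (OddBundle π)] :
    ∑ i, (oddIn π i).card = Fintype.card (OddBundle π) := by
  classical
  rw [← Finset.card_univ, Finset.card_eq_sum_card_fiberwise
    (f := fun s : OddBundle π => edgeComp π s.rep) (t := Finset.univ) (by simp)]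
  refine Finset.sum_congr rfl fun i _ => ?_
  symm
  refine Finset.card_bij (fun s _ => s.1) ?_ ?_ ?_
  · intro s hs
    rw [Finset.mem_filter] at hs
    rw [oddIn, Finset.mem_filter, ← s.bundle_rep, mem_bundlesIn]
    exact ⟨hs.2, by rw [s.bundle_rep]; exact s.2⟩
  · intro s _ s' _ h
    exact Subtype.ext h
  · intro s hs
    rw [oddIn, Finset.mem_filter] at hs
    refine ⟨⟨s, hs.2⟩, ?_, rfl⟩
    rw [Finset.mem_filter]
    refine ⟨Finset.mem_univ _, ?_⟩
    rw [← mem_bundlesIn, OddBundle.bundle_rep]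
    exact hs.1

theorem sum_ncard_untouchedIn [Fintype (gdc π).Comp] :
    ∑ i, (untouchedIn π i).ncard = {c : (gA π).Comp | ¬ Touched π c}.ncard := by
  classical
  have := Fintype.ofFinite (gA π).Comp
  rw [Set.ncard_eq_toFinset_card', Finset.card_eq_sum_card_fiberwise
    (f := fun c => (gdc π).compMk (Sum.inr c)) (t := Finset.univ) (by simp)]
  refine Finset.sum_congr rfl fun i _ => ?_
  rw [← Set.ncard_coe_finset]
  congr 1
  ext c
  simp [untouchedIn, detCompsIn, and_comm]

theorem evenGraph_compMk_of_gA {u v : Quotient π} (h : (gA π).compMk u = (gA π).compMk v) :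
    (evenGraph π).compMk u = (evenGraph π).compMk v :=
  EdgeGraph.eq_of_compMk_eq (fun k => (evenGraph π).compMk_src (Sum.inl k)) h

open Classical in
-- Write `max 1 m` as `m` plus one when `m = 0`. The values `m` add up to the number of odd bundles,
-- and a component with `m = 0` contains an untouched component of `T_A^π`, selected through `r`.
theorem sum_max_le_traceExponent [Fintype (evenGraph π).Comp] :
    ∑ c : (evenGraph π).Comp, max 1 (Finset.univ.filter fun f : Pos p ⊕ OddBundle π =>
      f.isRight = true ∧ (evenGraph π).compMk ((evenGraph π).src f) = c).card
      ≤ traceExponent π := by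
  have := Fintype.ofFinite (gdc π).Comp
  have := Fintype.ofFinite (gA π).Comp
  rw [traceExponent, finsum_eq_sum_of_fintype, Finset.sum_add_distrib, sum_card_oddIn,
    sum_ncard_untouchedIn]
  set m : (evenGraph π).Comp → ℕ := fun c => (Finset.univ.filter fun f : Pos p ⊕ OddBundle π =>
      f.isRight = true ∧ (evenGraph π).compMk ((evenGraph π).src f) = c).card with hm
  have h1 : ∑ c, max 1 (m c) = ∑ c, m c + (Finset.univ.filter fun c => m c = 0).card := by
    rw [Finset.card_filter, ← Finset.sum_add_distrib]
    refine Finset.sum_congr rfl fun c _ => ?_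
    split_ifs <;> omega
  have h2 : ∑ c, m c = Fintype.card (OddBundle π) := by
    have e : Fintype.card (OddBundle π) =
        (Finset.univ.filter fun f : Pos p ⊕ OddBundle π => f.isRight = true).card := by
      rw [Finset.card_filter, Fintype.sum_sum_type]
      simp
    rw [e, Finset.card_eq_sum_card_fiberwise
      (f := fun f => (evenGraph π).compMk ((evenGraph π).src f)) (t := Finset.univ) (by simp)]
    simp only [hm, Finset.filter_filter]
  rw [h1, h2]
  refine Nat.add_le_add_left ?_ _
  rw [Set.ncard_eq_toFinset_card']
  obtain ⟨r, hr⟩ := (evenGraph π).compMk_surjective.hasRightInverse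
  refine Finset.card_le_card_of_injOn (fun c => (gA π).compMk (r c)) (fun c hc => ?_)
    fun c _ c' _ h => ?_
  · simp only [Finset.coe_filter, Finset.mem_univ, true_and, Set.mem_ofPred_eq] at hc
    simp only [Set.coe_toFinset, Set.mem_ofPred_eq]
    rintro ⟨k, hk, hck⟩
    set s : OddBundle π := ⟨_, hk⟩
    have hmem : (gA π).compMk (r c) ∈ Sym2.map (gA π).compMk ((oddGraph π).ends s) := by
      rw [oddGraph_ends]; exact hck
    have h3 : (evenGraph π).compMk ((evenGraph π).src (Sum.inr s)) = c := by
      rw [Sym2.mem_map] at hmem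
      obtain ⟨v, hv, hvc⟩ := hmem
      have h4 := evenGraph_compMk_of_gA hvc
      rw [hr] at h4
      rw [← h4]
      rw [EdgeGraph.ends, Sym2.mem_iff] at hv
      rcases hv with rfl | rfl
      · rfl
      · exact (evenGraph π).compMk_src (Sum.inr s)
    simp only [hm, Finset.card_eq_zero, Finset.filter_eq_empty_iff] at hc
    exact hc (Finset.mem_univ (Sum.inr s)) ⟨rfl, h3⟩
  · have := evenGraph_compMk_of_gA h
    rwa [hr, hr] at this

open scoped Matrix.Norms.L2Operator in
theorem exists_norm_injTraceA_le {J : Type*} (a : Pos p → J)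
    (A : ∀ N, J → Matrix (Fin N) (Fin N) ℂ) (hA : ∀ b, ∃ C : ℝ, ∀ N, opNorm (A N b) ≤ C)
    (π : Setoid (Vtx p)) : ∃ C : ℝ, ∀ N : ℕ, 0 < N →
      ‖injTraceA a A N π‖ ≤ C * (N : ℝ) ^ traceExponent π := by
  classical
  choose C hC using hA
  have := Fintype.ofFinite (evenGraph π).Comp
  set K : ℝ := 1 + ∑ k, |C (a k)| with hK
  have hK1 : 1 ≤ K := by
    have : 0 ≤ ∑ k, |C (a k)| := Finset.sum_nonneg fun _ _ => abs_nonneg _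
    linarith
  have hKC : ∀ k, C (a k) ≤ K := fun k => by
    have h1 := Finset.single_le_sum (f := fun k => |C (a k)|) (fun _ _ => abs_nonneg _)
      (Finset.mem_univ k)
    have h2 := le_abs_self (C (a k))
    linarith
  refine ⟨2 ^ (Fintype.card (Pos p ⊕ OddBundle π) * Fintype.card (Pos p ⊕ OddBundle π)) *
    K ^ Fintype.card (Pos p ⊕ OddBundle π), fun N hN => ?_⟩
  -- The extra edges carry the all-ones matrix, so each of them contributes a factor one to the
  -- product.
  set B : Pos p ⊕ OddBundle π → Matrix (Fin N) (Fin N) ℂ :=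
    Sum.elim (fun k => A N (a k)) fun _ => Matrix.vecMulVec (fun _ => 1) (fun _ => 1) with hB
  have hBB : ∀ f, FlatOrBounded K (f.isRight = true) (B f) := by
    rintro (k | s)
    · exact ⟨by simp, fun _ => (hC (a k) N).trans (hKC k)⟩
    · exact ⟨fun _ => ⟨fun _ => 1, fun _ => 1, by simp, by simp, rfl⟩, by simp⟩
  have h := EdgeGraph.norm_injective_sum_le (evenGraph_degree_even (π := π)) evenGraph_degree_pos
    (fun f => f.isRight = true) hK1 hN B hBB
  have e : injTraceA a A N π = ∑ ψ : Quotient π ↪ Fin N,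
      ∏ f, B f (ψ ((evenGraph π).trg f)) (ψ ((evenGraph π).src f)) := by
    rw [injTraceA]
    refine Fintype.sum_equiv (Equiv.refl _) _ _ fun ψ => ?_
    rw [Fintype.prod_sum_type]
    have : ∏ s : OddBundle π, B (Sum.inr s) (ψ ((evenGraph π).trg (Sum.inr s)))
        (ψ ((evenGraph π).src (Sum.inr s))) = 1 :=
      Finset.prod_eq_one fun s _ => by simp [hB, Matrix.vecMulVec_apply]
    rw [Equiv.refl_apply, this, mul_one]
    rfl
  rw [e]
  refine h.trans ?_
  have hN1 : (1 : ℝ) ≤ N := by exact_mod_cast hN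
  have hle := sum_max_le_traceExponent (π := π)
  gcongr
  convert hle

/-! ### Exponents -/

theorem two_mul_traceExponent_lt_of_linked (hm : ∀ k, 2 ≤ mult π (bundle π k)) (hl : Linked π)
    (h : π ∉ DUFT p) : 2 * traceExponent π < Fintype.card (Pos p) := by
  have := Fintype.ofFinite (gdc π).Comp
  have h0 : ∃ i, ¬ (IsDoubleUnicyclic π i ∨ IsTwoFourTree π i) := by
    by_contra hcon
    push Not at hcon
    exact h fun i => by simpa only [or_iff_not_imp_left] using hcon i
  obtain ⟨i, hi⟩ := h0
  rw [traceExponent, finsum_eq_sum_of_fintype, Finset.mul_sum, ← sum_card_edgesIn (π := π)]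
  refine Finset.sum_lt_sum (fun i _ => (exponent_le_of_linked hm hl i).1) ⟨i, Finset.mem_univ _, ?_⟩
  exact lt_of_le_of_ne (exponent_le_of_linked hm hl i).1 fun he =>
    hi ((exponent_le_of_linked hm hl i).2 he)

theorem card_cyc_comp (π : Setoid (Vtx p)) :
    Nat.card ((cyc p).quot π).Comp = Nat.card (gdc π).Comp := by
  set H := (cyc p).quot π with hH
  have hsur : Function.Surjective fun v => (gdc π).compMk (Sum.inl v) := fun i => by
    obtain ⟨k, hk⟩ := exists_edgeComp_eq i
    exact ⟨_, hk⟩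
  refine card_eq_of_surjective_of_iff H.compMk_surjective hsur fun u v => ⟨fun h => ?_, fun h => ?_⟩
  · refine EdgeGraph.eq_of_compMk_eq (G := H) (χ := fun v => (gdc π).compMk (Sum.inl v)) ?_ h
    rintro (k | k)
    · exact edgeComp_eq_trg k
    · exact gdc_compMk_eq_of_gA ((gA π).compMk_src k)
  · obtain ⟨r, hr⟩ := (gA π).compMk_surjective.hasRightInverse
    refine EdgeGraph.eq_of_compMk_eq (G := gdc π)
      (χ := Sum.elim H.compMk fun c => H.compMk (r c)) ?_ h
    rintro (k | v)
    · exact H.compMk_src (Sum.inl k)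
    · refine EdgeGraph.eq_of_compMk_eq (G := gA π) (χ := H.compMk)
        (fun k => H.compMk_src (Sum.inr k)) (hr _).symm

theorem card_gdc_comp_le (π : Setoid (Vtx p)) : Nat.card (gdc π).Comp ≤ n := by
  choose k hk using exists_edgeComp_eq (π := π)
  have : Function.Injective fun i => (k i).1 := fun i i' h => by
    rw [← hk i, ← hk i']; exact edgeComp_eq_of_fst_eq h
  simpa using Nat.card_le_card_of_injective _ this

/-- Summing over `c ≤ n` components bounds twice the exponent by edges plus `2c`. Strictness comes
either from `c < n` or from a component that is not a double tree. -/
theorem two_mul_traceExponent_lt (hm : ∀ k, 2 ≤ mult π (bundle π k)) (h : π ∉ DT p n) :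
    2 * traceExponent π < Fintype.card (Pos p) + 2 * n := by
  have := Fintype.ofFinite (gdc π).Comp
  have hn := card_gdc_comp_le π
  have hc := card_cyc_comp π
  rw [Nat.card_eq_fintype_card] at hn
  rw [Nat.card_eq_fintype_card (α := (gdc π).Comp)] at hc
  have hsum : ∑ i : (gdc π).Comp, ((edgesIn π i).card + 2) =
      Fintype.card (Pos p) + 2 * Fintype.card (gdc π).Comp := by
    rw [Finset.sum_add_distrib, sum_card_edgesIn]
    simp [mul_comm]
  rw [traceExponent, finsum_eq_sum_of_fintype, Finset.mul_sum]
  by_cases hcard : Fintype.card (gdc π).Comp = n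
  · have h0 : ∃ i, ¬ IsDoubleTree π i := by
      by_contra hcon
      push Not at hcon
      exact h ⟨hc.trans hcard, hcon⟩
    obtain ⟨i, hi⟩ := h0
    refine lt_of_lt_of_eq ?_ (hsum.trans (by rw [hcard]))
    refine Finset.sum_lt_sum (fun i _ => (exponent_le_add_two hm i).1) ⟨i, Finset.mem_univ _, ?_⟩
    exact lt_of_le_of_ne (exponent_le_add_two hm i).1 fun he =>
      hi ((exponent_le_add_two hm i).2 he)
  · have := Finset.sum_le_sum fun i (_ : i ∈ Finset.univ) => (exponent_le_add_two hm i).1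
    rw [hsum] at this
    omega

/-- In `q₁ + q₂` the bundles cancel, which leaves deterministic components minus half the edges. It
is used with `r = 1` for `DT` and `r = 0` for `DUFT`. -/
theorem numLeaves_eq_of_even_mult (h : ∀ k, Even (mult π (bundle π k))) {r : ℕ}
    (hr : ∀ i, q₁ π i + q₂ π i = r) :
    ((cycA p).quot π).numLeaves = Fintype.card (Pos p) + 2 * r * Nat.card (gdc π).Comp := by
  have := Fintype.ofFinite (gdc π).Comp
  rw [EdgeGraph.numLeaves_eq_of_even (gA_degree_even h), ← sum_ncard_detCompsIn,
    ← sum_card_edgesIn (π := π), Finset.mul_sum, Nat.card_eq_fintype_card, mul_comm (2 * r),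
    ← smul_eq_mul, ← Finset.card_univ, ← Finset.sum_const, ← Finset.sum_add_distrib]
  refine Finset.sum_congr rfl fun i _ => ?_
  have hi := hr i
  rw [q₁_eq, q₂_eq] at hi
  have : (2 * (detCompsIn π i).ncard : ℚ) = (edgesIn π i).card + 2 * r := by linarith
  exact_mod_cast this

theorem numLeaves_of_mem_DUFT (hm : ∀ k, 2 ≤ mult π (bundle π k)) (h : π ∈ DUFT p) :
    ((cycA p).quot π).numLeaves = Fintype.card (Pos p) := by
  rw [numLeaves_eq_of_even_mult (r := 0) (fun k => ?_) fun i => ?_, mul_zero, zero_mul, add_zero]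
  · rcases h (edgeComp π k) with h | h
    · rw [mult_eq_two_of_q₁ hm h.1 rfl]; exact even_two
    · exact even_mult_of_tree h.2
  · rcases h i with h | h <;> (rw [h.1, h.2]; norm_num)

theorem numLeaves_of_mem_DT {c : ℕ} (h : π ∈ DT p c) :
    ((cycA p).quot π).numLeaves = Fintype.card (Pos p) + 2 * c := by
  rw [numLeaves_eq_of_even_mult (r := 1) (fun k => even_mult_of_tree (h.2 _).2) fun i => ?_,
    ← card_cyc_comp, h.1, mul_one]
  rw [(h.2 i).1, (h.2 i).2]
  norm_num

end InjectiveTrace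

/-! ### Mixed moments of the Wigner entries -/

section Moments

variable {n : ℕ} {Λ : Type*} {Ω : ℕ → Type*} [∀ N, MeasurableSpace (Ω N)] {p : Fin n → ℕ}
  {μ : ∀ N, Measure (Ω N)} {x : ∀ N, Λ → Ω N → Matrix (Fin N) (Fin N) ℂ} {π : Setoid (Vtx p)}

/-! ### Laws of the entries -/

theorem exists_perm_apply_eq {α : Type*} [DecidableEq α] {i j i' j' : α} (h : i ≠ j)
    (h' : i' ≠ j') : ∃ σ : Equiv.Perm α, σ i = i' ∧ σ j = j' := by
  refine ⟨(Equiv.swap i i').trans (Equiv.swap (Equiv.swap i i' j) j'), ?_, by simp⟩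
  have h1 : i' ≠ Equiv.swap i i' j := fun e => h (by
    have := congrArg (Equiv.swap i i') e
    simpa using this)
  simp [Equiv.swap_apply_of_ne_of_ne h1 h']

/-- Permutation invariance moves an off-diagonal entry to place (0, 1), and the common diagonal law
moves a diagonal one to (0, 0); at these fixed places the size can be changed. -/
theorem WignerHypothesis.identDistrib_entry (hx : WignerHypothesis μ x) {N N' : ℕ} (l : Λ)
    {i j : Fin N} {i' j' : Fin N'} (h : i = j ↔ i' = j') :
    IdentDistrib (fun ω => x N l ω i j) (fun ω => x N' l ω i' j') (μ N) (μ N') := by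
  by_cases hij : i = j
  · obtain rfl := hij
    obtain rfl := h.1 rfl
    have h1 := hx.diag_identDistrib N l i ⟨0, i.pos⟩
    have h2 := hx.law_eq N N' l ⟨0, i.pos⟩ ⟨0, i.pos⟩ ⟨0, i'.pos⟩ ⟨0, i'.pos⟩ rfl rfl
    exact (h1.trans h2).trans (hx.diag_identDistrib N' l ⟨0, i'.pos⟩ i')
  · have hij' : i' ≠ j' := fun e => hij (h.2 e)
    have key : ∀ {M : ℕ} {a b : Fin M} (hab : a ≠ b), ∃ (h0 : 0 < M) (h1 : 1 < M),
        IdentDistrib (fun ω => x M l ω a b) (fun ω => x M l ω ⟨0, h0⟩ ⟨1, h1⟩) (μ M) (μ M) := by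
      intro M a b hab
      have hab' : (a : ℕ) ≠ b := fun e => hab (Fin.ext e)
      have h1 : 1 < M := by have := a.2; have := b.2; omega
      refine ⟨by omega, h1, ?_⟩
      obtain ⟨σ, hσ, hσ'⟩ := exists_perm_apply_eq (i := (⟨0, by omega⟩ : Fin M)) (j := ⟨1, h1⟩)
        (by simp) hab
      have hm : Measurable fun M' : Fin M → Fin M → ℂ => M' ⟨0, by omega⟩ ⟨1, h1⟩ := by fun_prop
      have := (hx.perm_invariant M l σ).comp hm
      simp only [Function.comp_def, hσ, hσ'] at this
      exact this
    obtain ⟨h0, h1, e1⟩ := key hij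
    obtain ⟨h0', h1', e2⟩ := key hij'
    exact (e1.trans (hx.law_eq N N' l _ _ _ _ rfl rfl)).trans e2.symm

variable (l : Pos p → Λ) (x) in
/-- The entry of the Wigner matrix that is carried by an edge of `T_X^π`. -/
def edgeEntry {N : ℕ} (ψ : Quotient π → Fin N) (k : Pos p) (ω : Ω N) : ℂ :=
  x N (l k) ω (ψ ((gX π).trg k)) (ψ ((gX π).src k))

variable (l : Pos p → Λ) (μ x) in
/-- The mixed moment of the entries carried by a set of edges of `T_X^π`. -/
def moment {N : ℕ} (ψ : Quotient π → Fin N) (S : Finset (Pos p)) : ℂ :=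
  ∫ ω, ∏ k ∈ S, edgeEntry x l ψ k ω ∂μ N

variable (l : Pos p → Λ) (π) in
/-- Edges with the same label and the same end points carry the same entry up to conjugation. -/
def entryKey (k : Pos p) : Λ × Sym2 (Quotient π) := (l k, bundle π k)

variable {l : Pos p → Λ} {N : ℕ}

theorem src_trg_of_bundle_eq {k k₀ : Pos p} (h : bundle π k = bundle π k₀) :
    ((gX π).src k = (gX π).src k₀ ∧ (gX π).trg k = (gX π).trg k₀) ∨
      ((gX π).src k = (gX π).trg k₀ ∧ (gX π).trg k = (gX π).src k₀) := by
  rwa [bundle, bundle, EdgeGraph.ends, EdgeGraph.ends, Sym2.eq_iff] at h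

open Classical in
theorem IsWignerFamily.edgeEntry_ae_eq (hx : IsWignerFamily μ x) (ψ : Quotient π → Fin N)
    {k k₀ : Pos p} (h : entryKey π l k = entryKey π l k₀) : edgeEntry x l ψ k =ᵐ[μ N] fun ω =>
      if (gX π).trg k = (gX π).trg k₀ then edgeEntry x l ψ k₀ ω
      else star (edgeEntry x l ψ k₀ ω) := by
  obtain ⟨h1, h2⟩ := Prod.ext_iff.1 h
  simp only [entryKey] at h1 h2
  filter_upwards [hx.hermitian N (l k₀)] with ω hω
  rcases src_trg_of_bundle_eq h2 with ⟨e1, e2⟩ | ⟨e1, e2⟩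
  · simp [edgeEntry, h1, e1, e2]
  -- The targets agree although the orientation is reversed exactly when the edge is a loop, and
  -- then no conjugate is taken.
  · by_cases h3 : (gX π).trg k = (gX π).trg k₀
    · simp only [edgeEntry, h1, e1, h3, if_true]
      rw [← e2, h3]
    · simp only [edgeEntry, h1, e1, h3, if_false]
      rw [e2, hω.apply]

theorem IsWignerFamily.aestronglyMeasurable_edgeEntry (hx : IsWignerFamily μ x)
    (ψ : Quotient π → Fin N) (k : Pos p) : AEStronglyMeasurable (edgeEntry x l ψ k) (μ N) :=
  (hx.memLp N (l k) _ _ 1).1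

theorem IsWignerFamily.integrable_prod_entry [∀ N, IsProbabilityMeasure (μ N)]
    (hx : IsWignerFamily μ x) {ι : Type*} (S : Finset ι) (l : ι → Λ) (u v : ι → Fin N) :
    Integrable (fun ω => ∏ k ∈ S, x N (l k) ω (u k) (v k)) (μ N) := by
  rcases S.eq_empty_or_nonempty with rfl | hS
  · simp
  · have h := MemLp.prod' (s := S) (p := fun _ => (S.card : ENNReal))
      (f := fun k ω => x N (l k) ω (u k) (v k)) (μ := μ N)
      fun k _ => hx.memLp N (l k) _ _ S.card
    rw [Finset.sum_const, nsmul_eq_mul, ENNReal.mul_inv_cancel (by simpa using hS.ne_empty)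
      (ENNReal.natCast_ne_top _), inv_one] at h
    exact memLp_one_iff_integrable.1 h

/-! ### Factorization -/

/-- Independence is assumed for the entries with `i ≤ j`, so the end points are sorted and the entry
is conjugated when its orientation is the other one. Injectivity of `ψ` keeps distinct keys at
distinct entries. -/
theorem IsWignerFamily.iIndepFun_edgeEntry [∀ N, IsProbabilityMeasure (μ N)]
    (hx : IsWignerFamily μ x) (ψ : Quotient π ↪ Fin N)
    {ι : Type*} (κ : ι → Pos p) (hκ : Function.Injective fun i => entryKey π l (κ i)) :
    iIndepFun (fun i => edgeEntry x l ψ (κ i)) (μ N) := by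
  set e : ι → Λ × {ij : Fin N × Fin N // ij.1 ≤ ij.2} := fun i =>
    (l (κ i), Sym2.sortEquiv (Sym2.map ψ (bundle π (κ i)))) with he
  have hei : Function.Injective e := by
    intro i j h
    obtain ⟨h1, h2⟩ := Prod.ext_iff.1 h
    exact hκ (Prod.ext h1 (Sym2.map.injective ψ.injective (Sym2.sortEquiv.injective h2)))
  have h1 := hx.indep N |>.precomp hei
  have h2 := h1.comp (fun i z => if ψ ((gX π).trg (κ i)) ≤ ψ ((gX π).src (κ i)) then z else star z)
    (fun i => by split_ifs <;> fun_prop)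
  refine (iIndepFun_congr fun i => ?_).1 h2
  filter_upwards [hx.hermitian N (l (κ i))] with ω hω
  have hb : Sym2.map ψ (bundle π (κ i)) =
      s(ψ ((gX π).src (κ i)), ψ ((gX π).trg (κ i))) := rfl
  simp only [Function.comp_def, he, hb, edgeEntry, Sym2.sortEquiv, Equiv.coe_fn_mk, Sym2.inf_mk,
    Sym2.sup_mk]
  split_ifs with hle
  · rw [inf_eq_right.2 hle, sup_eq_left.2 hle]
  · have hle' := (not_le.1 hle).le
    rw [inf_eq_left.2 hle', sup_eq_right.2 hle', hω.apply]

open Classical in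
-- Edges with a common key carry, up to conjugation, one and the same entry, and the entries of
-- distinct keys are independent. Each group of edges is thus a function of one representative.
theorem IsWignerFamily.moment_eq_prod [∀ N, IsProbabilityMeasure (μ N)]
    (hx : IsWignerFamily μ x) (ψ : Quotient π ↪ Fin N) (S : Finset (Pos p)) :
    moment μ x l ψ S =
      ∏ g ∈ S.image (entryKey π l), moment μ x l ψ (S.filter fun k => entryKey π l k = g) := by
  have hrep : ∀ g : S.image (entryKey π l), ∃ k ∈ S, entryKey π l k = g := fun g =>
    Finset.mem_image.1 g.2
  choose r hrS hr using hrep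
  have hind := hx.iIndepFun_edgeEntry ψ (l := l) r fun g g' h => Subtype.ext (by
    simpa only [hr] using h)
  set f : S.image (entryKey π l) → ℂ → ℂ := fun g z => ∏ k ∈ S.filter fun k => entryKey π l k = g,
    if (gX π).trg k = (gX π).trg (r g) then z else star z with hf
  have hfm : ∀ g, Continuous (f g) := fun g => by
    refine continuous_finsetProd _ fun k _ => ?_
    split_ifs <;> fun_prop
  have hfe : ∀ g : S.image (entryKey π l), (fun ω => ∏ k ∈ S.filter fun k => entryKey π l k = g,
      edgeEntry x l ψ k ω) =ᵐ[μ N] fun ω => f g (edgeEntry x l ψ (r g) ω) := fun g => by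
    have : ∀ᵐ ω ∂μ N, ∀ k ∈ S.filter fun k => entryKey π l k = g, edgeEntry x l ψ k ω =
        if (gX π).trg k = (gX π).trg (r g) then edgeEntry x l ψ (r g) ω
        else star (edgeEntry x l ψ (r g) ω) := by
      refine (Finset.eventually_all _).2 fun k hk => ?_
      exact hx.edgeEntry_ae_eq ψ ((Finset.mem_filter.1 hk).2.trans (hr g).symm)
    filter_upwards [this] with ω hω
    exact Finset.prod_congr rfl hω
  have h1 := hind.integral_fun_prod_comp (f := f)
    (fun g => (hx.aestronglyMeasurable_edgeEntry ψ _).aemeasurable)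
    (fun g => (hfm g).aestronglyMeasurable)
  calc moment μ x l ψ S = ∫ ω, ∏ g : S.image (entryKey π l), f g (edgeEntry x l ψ (r g) ω) ∂μ N := by
        refine integral_congr_ae ?_
        filter_upwards [ae_all_iff.2 hfe] with ω hω
        rw [← Finset.prod_congr rfl fun g _ => hω g]
        rw [Finset.prod_coe_sort (S.image (entryKey π l)) fun g =>
          ∏ k ∈ S.filter fun k => entryKey π l k = g, edgeEntry x l ψ k ω]
        exact (Finset.prod_fiberwise_of_maps_to (fun k hk => Finset.mem_image_of_mem _ hk) _).symm
    _ = ∏ g : S.image (entryKey π l), ∫ ω, f g (edgeEntry x l ψ (r g) ω) ∂μ N := h1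
    _ = ∏ g : S.image (entryKey π l), moment μ x l ψ (S.filter fun k => entryKey π l k = g) :=
        Finset.prod_congr rfl fun g _ => (integral_congr_ae (hfe g)).symm
    _ = _ := Finset.prod_coe_sort (S.image (entryKey π l)) fun g =>
        moment μ x l ψ (S.filter fun k => entryKey π l k = g)

/-- The mixed moments do not depend on the size of the matrices and on the places of the entries. -/
theorem WignerHypothesis.moment_eq [∀ N, IsProbabilityMeasure (μ N)]
    (hx : WignerHypothesis μ x) {N' : ℕ} (ψ : Quotient π ↪ Fin N) (ψ' : Quotient π ↪ Fin N')
    (S : Finset (Pos p)) : moment μ x l ψ S = moment μ x l ψ' S := by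
  classical
  rw [hx.moment_eq_prod, hx.moment_eq_prod]
  refine Finset.prod_congr rfl fun g hg => ?_
  obtain ⟨k₀, -, rfl⟩ := Finset.mem_image.1 hg
  set f : ℂ → ℂ := fun z => ∏ k ∈ S.filter fun k => entryKey π l k = entryKey π l k₀,
    if (gX π).trg k = (gX π).trg k₀ then z else star z with hf
  have hfm : Measurable f := Continuous.measurable <| continuous_finsetProd _ fun k _ => by
    split_ifs <;> fun_prop
  have key : ∀ {M : ℕ} (φ : Quotient π ↪ Fin M), moment μ x l φ
      (S.filter fun k => entryKey π l k = entryKey π l k₀) =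
      ∫ ω, f (edgeEntry x l φ k₀ ω) ∂μ M := fun {M} φ => by
    refine integral_congr_ae ?_
    have : ∀ᵐ ω ∂μ M, ∀ k ∈ S.filter fun k => entryKey π l k = entryKey π l k₀,
        edgeEntry x l φ k ω = if (gX π).trg k = (gX π).trg k₀ then edgeEntry x l φ k₀ ω
        else star (edgeEntry x l φ k₀ ω) := by
      refine (Finset.eventually_all _).2 fun k hk => ?_
      exact hx.edgeEntry_ae_eq φ (Finset.mem_filter.1 hk).2
    filter_upwards [this] with ω hω
    exact Finset.prod_congr rfl hω
  rw [key, key]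
  refine ((hx.identDistrib_entry (l k₀) ?_).comp hfm).integral_eq
  rw [ψ.injective.eq_iff, ψ'.injective.eq_iff]

theorem IsWignerFamily.moment_eq_zero [∀ N, IsProbabilityMeasure (μ N)] (hx : IsWignerFamily μ x)
    (ψ : Quotient π ↪ Fin N) {S : Finset (Pos p)} {k₀ : Pos p} (h₀ : k₀ ∈ S)
    (h : ∀ k ∈ S, entryKey π l k = entryKey π l k₀ → k = k₀) : moment μ x l ψ S = 0 := by
  classical
  rw [hx.moment_eq_prod]
  refine Finset.prod_eq_zero (Finset.mem_image_of_mem _ h₀) ?_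
  have : (S.filter fun k => entryKey π l k = entryKey π l k₀) = {k₀} := by
    ext k
    simp only [Finset.mem_filter, Finset.mem_singleton]
    exact ⟨fun hk => h k hk.1 hk.2, fun hk => by rw [hk]; exact ⟨h₀, rfl⟩⟩
  rw [this, moment]
  simp only [Finset.prod_singleton]
  exact hx.centered N _ _ _

theorem IsWignerFamily.moment_union [∀ N, IsProbabilityMeasure (μ N)] (hx : IsWignerFamily μ x)
    (ψ : Quotient π ↪ Fin N) {S T : Finset (Pos p)} [DecidableEq (Pos p)]
    (h : ∀ k ∈ S, ∀ k' ∈ T, bundle π k ≠ bundle π k') :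
    moment μ x l ψ (S ∪ T) = moment μ x l ψ S * moment μ x l ψ T := by
  classical
  have hne : ∀ k ∈ S, ∀ k' ∈ T, entryKey π l k ≠ entryKey π l k' := fun k hk k' hk' e =>
    h k hk k' hk' (congrArg Prod.snd e)
  rw [hx.moment_eq_prod ψ (S ∪ T), hx.moment_eq_prod ψ S, hx.moment_eq_prod ψ T,
    Finset.image_union, Finset.prod_union]
  · congr 1
    · refine Finset.prod_congr rfl fun g hg => ?_
      obtain ⟨k, hk, rfl⟩ := Finset.mem_image.1 hg
      congr 1
      ext k'
      simp only [Finset.mem_filter, Finset.mem_union]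
      exact ⟨fun ⟨h1, h2⟩ => ⟨h1.resolve_right fun h3 => hne k hk k' h3 h2.symm, h2⟩,
        fun ⟨h1, h2⟩ => ⟨Or.inl h1, h2⟩⟩
    · refine Finset.prod_congr rfl fun g hg => ?_
      obtain ⟨k, hk, rfl⟩ := Finset.mem_image.1 hg
      congr 1
      ext k'
      simp only [Finset.mem_filter, Finset.mem_union]
      exact ⟨fun ⟨h1, h2⟩ => ⟨h1.resolve_left fun h3 => hne k' h3 k hk h2, h2⟩,
        fun ⟨h1, h2⟩ => ⟨Or.inr h1, h2⟩⟩
  · rw [Finset.disjoint_left]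
    intro g hg hg'
    obtain ⟨k, hk, rfl⟩ := Finset.mem_image.1 hg
    obtain ⟨k', hk', e⟩ := Finset.mem_image.1 hg'
    exact hne k hk k' hk' e.symm

theorem WignerHypothesis.moment_pair (hx : WignerHypothesis μ x) (ψ : Quotient π ↪ Fin N)
    [DecidableEq (Pos p)] {k k' : Pos p} (hkk : k ≠ k') (hl : l k' = l k)
    (hne : (gX π).src k ≠ (gX π).trg k) (h1 : (gX π).src k' = (gX π).trg k)
    (h2 : (gX π).trg k' = (gX π).src k) : moment μ x l ψ {k, k'} = 1 := by
  have hv := hx.variance N (l k) (ψ ((gX π).trg k)) (ψ ((gX π).src k))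
    (fun e => hne (ψ.injective e).symm)
  rw [moment]
  calc _ = ∫ ω, ((‖x N (l k) ω (ψ ((gX π).trg k)) (ψ ((gX π).src k))‖ ^ 2 : ℝ) : ℂ) ∂μ N := by
        refine integral_congr_ae ?_
        filter_upwards [hx.hermitian N (l k)] with ω hω
        rw [Finset.prod_pair hkk, edgeEntry, edgeEntry, hl, h1, h2,
          ← hω.apply (ψ ((gX π).src k)) (ψ ((gX π).trg k)), RCLike.star_def, Complex.mul_conj]
        rw [Complex.normSq_eq_norm_sq]
    _ = 1 := by rw [integral_complex_ofReal, hv, Complex.ofReal_one]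

/-- When all the bundles of a set of edges consist of two opposite edges, the mixed moment is
determined by the labels. -/
theorem moment_eq_of_pairs {Ω' : ℕ → Type*} [∀ N, MeasurableSpace (Ω' N)]
    {ν : ∀ N, Measure (Ω' N)} {y : ∀ N, Λ → Ω' N → Matrix (Fin N) (Fin N) ℂ}
    [∀ N, IsProbabilityMeasure (μ N)] [∀ N, IsProbabilityMeasure (ν N)]
    (hx : WignerHypothesis μ x) (hy : WignerHypothesis ν y) (ψ : Quotient π ↪ Fin N)
    {S : Finset (Pos p)} (h : ∀ k ∈ S, (gX π).src k ≠ (gX π).trg k ∧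
      ∃ k' ∈ S, (gX π).src k' = (gX π).trg k ∧ (gX π).trg k' = (gX π).src k ∧
        ∀ k'' ∈ S, bundle π k'' = bundle π k → k'' = k ∨ k'' = k') :
    moment μ x l ψ S = moment ν y l ψ S := by
  classical
  rw [hx.moment_eq_prod, hy.moment_eq_prod]
  refine Finset.prod_congr rfl fun g hg => ?_
  obtain ⟨k, hk, rfl⟩ := Finset.mem_image.1 hg
  obtain ⟨hne, k', hk', h1, h2, h3⟩ := h k hk
  have hkk : k ≠ k' := by rintro rfl; exact hne h1
  by_cases hl : l k' = l k
  -- With equal labels the pair gives `E|x|² = 1`; with different labels, the other branch, `k` is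
  -- alone with its key and centering gives zero, for both families.
  · have hb : bundle π k' = bundle π k := by
      rw [bundle, bundle, EdgeGraph.ends, EdgeGraph.ends, h1, h2, Sym2.eq_swap]
    have hS : (S.filter fun k'' => entryKey π l k'' = entryKey π l k) = {k, k'} := by
      ext k''
      simp only [Finset.mem_filter, Finset.mem_insert, Finset.mem_singleton]
      refine ⟨fun hk'' => h3 k'' hk''.1 (congrArg Prod.snd hk''.2), ?_⟩
      rintro (rfl | rfl)
      · exact ⟨hk, rfl⟩
      · exact ⟨hk', Prod.ext hl hb⟩
    rw [hS, hx.moment_pair ψ hkk hl hne h1 h2, hy.moment_pair ψ hkk hl hne h1 h2]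
  · have hS : ∀ k'' ∈ S.filter fun k'' => entryKey π l k'' = entryKey π l k, k'' = k := by
      intro k'' hk''
      rw [Finset.mem_filter] at hk''
      rcases h3 k'' hk''.1 (congrArg Prod.snd hk''.2) with h | rfl
      · exact h
      · exact absurd (congrArg Prod.fst hk''.2) hl
    have hmem : k ∈ S.filter fun k'' => entryKey π l k'' = entryKey π l k :=
      Finset.mem_filter.2 ⟨hk, rfl⟩
    rw [hx.moment_eq_zero ψ hmem fun k'' hk'' _ => hS k'' hk'',
      hy.moment_eq_zero ψ hmem fun k'' hk'' _ => hS k'' hk'']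

end Moments

section Weights

variable {n : ℕ} {Λ : Type*} {Ω : ℕ → Type*} {p : Fin n → ℕ}
  {x : ∀ N, Λ → Ω N → Matrix (Fin N) (Fin N) ℂ} {π : Setoid (Vtx p)} {l : Pos p → Λ} {N : ℕ}

/-! ### The weights `ω_X⁽¹⁾` and `ω_X⁽²⁾` -/

/-- The positions in the words of a set of indices. -/
def posIn (p : Fin n → ℕ) (S : Finset (Fin n)) : Finset (Pos p) := S.sigma fun _ => Finset.univ

theorem mem_posIn {S : Finset (Fin n)} {k : Pos p} : k ∈ posIn p S ↔ k.1 ∈ S := by simp [posIn]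

theorem posIn_univ : posIn p Finset.univ = Finset.univ := by ext; simp [mem_posIn]

theorem prod_entryProd (ψ : Quotient π → Fin N) (S : Finset (Fin n)) (ω : Ω N) :
    ∏ j ∈ S, entryProd l x π ψ j ω = ∏ k ∈ posIn p S, edgeEntry x l ψ k ω := by
  rw [posIn, Finset.prod_sigma]
  rfl

variable [∀ N, MeasurableSpace (Ω N)] {μ : ∀ N, Measure (Ω N)}

theorem integral_entryProd (ψ : Quotient π → Fin N) (j : Fin n) :
    ∫ ω, entryProd l x π ψ j ω ∂μ N = moment μ x l ψ (posIn p {j}) := by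
  rw [moment]
  congr 1
  funext ω
  rw [← prod_entryProd, Finset.prod_singleton]

theorem omegaX₁_of_isEmpty (h : ¬ Nonempty (Quotient π ↪ Fin N)) : omegaX₁ l μ x N π = 0 :=
  dif_neg h

theorem omegaX₂_of_isEmpty (h : ¬ Nonempty (Quotient π ↪ Fin N)) : omegaX₂ l μ x N π = 0 :=
  dif_neg h

variable [∀ N, IsProbabilityMeasure (μ N)]

theorem WignerHypothesis.omegaX₁_eq (hx : WignerHypothesis μ x) (ψ : Quotient π ↪ Fin N) :
    omegaX₁ l μ x N π = moment μ x l ψ Finset.univ := by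
  rw [omegaX₁, dif_pos ⟨ψ⟩]
  simp only [prod_entryProd, posIn_univ]
  exact hx.moment_eq _ _ _

theorem WignerHypothesis.omegaX₂_eq (hx : WignerHypothesis μ x) (ψ : Quotient π ↪ Fin N) :
    omegaX₂ l μ x N π = ∑ S : Finset (Fin n), moment μ x l ψ (posIn p S) * (-1) ^ (n - S.card) *
      ∏ j ∈ Sᶜ, moment μ x l ψ (posIn p {j}) := by
  rw [omegaX₂, dif_pos ⟨ψ⟩]
  simp only [prod_entryProd, integral_entryProd]
  refine Finset.sum_congr rfl fun S _ => ?_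
  rw [Finset.prod_congr rfl fun j _ => hx.moment_eq _ ψ (posIn p {j})]
  congr 2
  exact hx.moment_eq _ ψ (posIn p S)

theorem exists_bound_of_eq {P : ℕ → Prop} {f : ℕ → ℂ} (h : ∀ N N', P N → P N' → f N = f N')
    (h0 : ∀ N, ¬ P N → f N = 0) : ∃ C : ℝ, ∀ N, ‖f N‖ ≤ C := by
  by_cases hP : ∃ N, P N
  · obtain ⟨M, hM⟩ := hP
    refine ⟨‖f M‖, fun N => ?_⟩
    by_cases hN : P N
    · rw [h N M hN hM]
    · rw [h0 N hN, norm_zero]; exact norm_nonneg _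
  · push Not at hP
    exact ⟨0, fun N => by rw [h0 N (hP N), norm_zero]⟩

theorem WignerHypothesis.exists_norm_omegaX₁_le (hx : WignerHypothesis μ x) (l : Pos p → Λ)
    (π : Setoid (Vtx p)) : ∃ C : ℝ, ∀ N, ‖omegaX₁ l μ x N π‖ ≤ C := by
  refine exists_bound_of_eq (P := fun N => Nonempty (Quotient π ↪ Fin N)) ?_
    fun N h => omegaX₁_of_isEmpty h
  rintro N N' ⟨ψ⟩ ⟨ψ'⟩
  rw [hx.omegaX₁_eq ψ, hx.omegaX₁_eq ψ', hx.moment_eq]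

theorem WignerHypothesis.exists_norm_omegaX₂_le (hx : WignerHypothesis μ x) (l : Pos p → Λ)
    (π : Setoid (Vtx p)) : ∃ C : ℝ, ∀ N, ‖omegaX₂ l μ x N π‖ ≤ C := by
  refine exists_bound_of_eq (P := fun N => Nonempty (Quotient π ↪ Fin N)) ?_
    fun N h => omegaX₂_of_isEmpty h
  rintro N N' ⟨ψ⟩ ⟨ψ'⟩
  rw [hx.omegaX₂_eq ψ, hx.omegaX₂_eq ψ']
  refine Finset.sum_congr rfl fun S _ => ?_
  rw [hx.moment_eq ψ ψ', Finset.prod_congr rfl fun j _ => hx.moment_eq ψ ψ' (posIn p {j})]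

theorem eq_of_mult_lt_two {k₀ : Pos p} (h : mult π (bundle π k₀) < 2) {k : Pos p}
    (hk : bundle π k = bundle π k₀) : k = k₀ := by
  classical
  have : (Finset.univ.filter fun k => bundle π k = bundle π k₀).card ≤ 1 :=
    Nat.lt_succ_iff.1 (by simpa [mult] using h)
  exact Finset.card_le_one.1 this _ (by simpa using hk) _ (by simp)

theorem WignerHypothesis.moment_eq_zero_of_mult (hx : WignerHypothesis μ x)
    (ψ : Quotient π ↪ Fin N) {k₀ : Pos p} (h : mult π (bundle π k₀) < 2) {S : Finset (Pos p)}
    (h₀ : k₀ ∈ S) : moment μ x l ψ S = 0 :=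
  hx.moment_eq_zero ψ h₀ fun _ _ e => eq_of_mult_lt_two h (congrArg Prod.snd e)

theorem WignerHypothesis.omegaX₁_eq_zero (hx : WignerHypothesis μ x)
    (h : ¬ ∀ k, 2 ≤ mult π (bundle π k)) : omegaX₁ l μ x N π = 0 := by
  push Not at h
  obtain ⟨k₀, h⟩ := h
  by_cases hN : Nonempty (Quotient π ↪ Fin N)
  · obtain ⟨ψ⟩ := hN
    rw [hx.omegaX₁_eq ψ, hx.moment_eq_zero_of_mult ψ h (Finset.mem_univ _)]
  · exact omegaX₁_of_isEmpty hN

theorem WignerHypothesis.omegaX₂_eq_zero (hx : WignerHypothesis μ x)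
    (h : ¬ ∀ k, 2 ≤ mult π (bundle π k)) : omegaX₂ l μ x N π = 0 := by
  push Not at h
  obtain ⟨k₀, h⟩ := h
  by_cases hN : Nonempty (Quotient π ↪ Fin N)
  · obtain ⟨ψ⟩ := hN
    rw [hx.omegaX₂_eq ψ]
    refine Finset.sum_eq_zero fun S _ => ?_
    by_cases hS : k₀.1 ∈ S
    · rw [hx.moment_eq_zero_of_mult ψ h (mem_posIn.2 hS), zero_mul, zero_mul]
    · rw [Finset.prod_eq_zero (Finset.mem_compl.2 hS), mul_zero]
      exact hx.moment_eq_zero_of_mult ψ h (mem_posIn.2 (Finset.mem_singleton_self _))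
  · exact omegaX₂_of_isEmpty hN

/-- A cycle `j` that shares no bundle is independent of the others, so in the alternating sum the
terms of `S` and of `insert j S` cancel. -/
theorem WignerHypothesis.omegaX₂_eq_zero_of_not_linked (hx : WignerHypothesis μ x)
    (h : ¬ Linked π) : omegaX₂ l μ x N π = 0 := by
  classical
  by_cases hN : Nonempty (Quotient π ↪ Fin N)
  swap
  · exact omegaX₂_of_isEmpty hN
  obtain ⟨ψ⟩ := hN
  rw [Linked] at h
  push Not at h
  obtain ⟨j, hj⟩ := h
  rw [hx.omegaX₂_eq ψ, ← Finset.powerset_univ, ← Finset.insert_erase (Finset.mem_univ j),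
    Finset.sum_powerset_insert (Finset.notMem_erase _ _), ← Finset.sum_add_distrib]
  refine Finset.sum_eq_zero fun S hS => ?_
  have hjS : j ∉ S := fun hh => Finset.notMem_erase _ _ (Finset.mem_powerset.1 hS hh)
  have h1 : posIn p (insert j S) = posIn p {j} ∪ posIn p S := by
    ext k; simp [mem_posIn]
  have h2 : moment μ x l ψ (posIn p (insert j S)) =
      moment μ x l ψ (posIn p {j}) * moment μ x l ψ (posIn p S) := by
    rw [h1]
    refine hx.moment_union ψ fun k hk k' hk' => hj k k' ?_ ?_
    · simpa using mem_posIn.1 hk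
    · rintro rfl; exact hjS (mem_posIn.1 hk')
  have h3 : Sᶜ = insert j (insert j S)ᶜ := by
    ext i
    simp only [Finset.mem_compl, Finset.mem_insert, not_or]
    by_cases hi : i = j
    · simp [hi, hjS]
    · simp [hi]
  have h4 : n - S.card = n - (insert j S).card + 1 := by
    have := Finset.card_le_univ (insert j S)
    rw [Finset.card_insert_of_notMem hjS, Fintype.card_fin] at *
    omega
  rw [h2, h3, Finset.prod_insert (by simp), h4, pow_succ]
  ring

/-- Either some multiplicity is below two and both weights vanish, or every bundle is a pair of
opposite edges, whose moment does not depend on the law. -/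
theorem WignerHypothesis.omegaX₁_universal {Ω' : ℕ → Type*} [∀ N, MeasurableSpace (Ω' N)]
    {ν : ∀ N, Measure (Ω' N)} {y : ∀ N, Λ → Ω' N → Matrix (Fin N) (Fin N) ℂ}
    [∀ N, IsProbabilityMeasure (ν N)] (hx : WignerHypothesis μ x) (hy : WignerHypothesis ν y)
    (h : ∀ i, IsDoubleTree π i) : omegaX₁ l μ x N π = omegaX₁ l ν y N π := by
  classical
  by_cases hm : ∀ k, 2 ≤ mult π (bundle π k)
  swap
  · rw [hx.omegaX₁_eq_zero hm, hy.omegaX₁_eq_zero hm]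
  by_cases hN : Nonempty (Quotient π ↪ Fin N)
  swap
  · rw [omegaX₁_of_isEmpty hN, omegaX₁_of_isEmpty hN]
  obtain ⟨ψ⟩ := hN
  rw [hx.omegaX₁_eq ψ, hy.omegaX₁_eq ψ]
  refine moment_eq_of_pairs hx hy ψ fun k _ => ?_
  have hq := (h (edgeComp π k)).2
  refine ⟨src_ne_trg_of_tree hq, ?_⟩
  -- The cycle of `k` crosses the bridge as often backwards as forwards, which provides an edge
  -- opposite to `k`; multiplicity two leaves room for no third edge.
  have h1 := card_forward_eq_card_backward hq k.1
  have h2 : 0 < (Finset.univ.filter fun m : Fin (p k.1) => bundle π ⟨k.1, m⟩ = bundle π k ∧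
      (gX π).src ⟨k.1, m⟩ = (gX π).src k).card := Finset.card_pos.2 ⟨k.2, by simp⟩
  rw [h1] at h2
  obtain ⟨m, hm'⟩ := Finset.card_pos.1 h2
  rw [Finset.mem_filter] at hm'
  obtain ⟨-, hb, hs⟩ := hm'
  have ht : (gX π).trg ⟨k.1, m⟩ = (gX π).src k := by
    rcases src_trg_of_bundle_eq hb with h | h
    · exact absurd (h.1.symm.trans hs) (src_ne_trg_of_tree hq)
    · exact h.2
  refine ⟨⟨k.1, m⟩, Finset.mem_univ _, hs, ht, fun k'' _ hk'' => ?_⟩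
  by_contra hcon
  push Not at hcon
  have hne : k ≠ ⟨k.1, m⟩ := fun e => src_ne_trg_of_tree hq (by rw [← hs, ← e])
  have h3 := mult_eq_two_of_q₁ hm (h (edgeComp π k)).1 rfl
  have h4 : ({k, ⟨k.1, m⟩, k''} : Finset (Pos p)) ⊆
      Finset.univ.filter fun k' => bundle π k' = bundle π k := by
    intro k' hk'
    simp only [Finset.mem_insert, Finset.mem_singleton] at hk'
    rw [Finset.mem_filter]
    rcases hk' with rfl | rfl | rfl
    exacts [⟨Finset.mem_univ _, rfl⟩, ⟨Finset.mem_univ _, hb⟩, ⟨Finset.mem_univ _, hk''⟩]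
  have h5 := Finset.card_le_card h4
  rw [Finset.card_eq_three.2 ⟨k, ⟨k.1, m⟩, k'', hne, hcon.1.symm, hcon.2.symm, rfl⟩] at h5
  rw [mult] at h3
  have h6 : (Finset.univ.filter fun k' => bundle π k' = bundle π k).card = 2 := by
    convert h3
  omega

end Weights

/-! ### Exact expansion over partitions, and the limit -/

section Expansion

variable {n : ℕ} {Λ J : Type*} {Ω : ℕ → Type*} {p : Fin n → ℕ}
  {x : ∀ N, Λ → Ω N → Matrix (Fin N) (Fin N) ℂ} {A : ∀ N, J → Matrix (Fin N) (Fin N) ℂ}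
  {l : Pos p → Λ} {a : Pos p → J} {N : ℕ}

/-! ### Expansion of the traces -/

theorem trace_prod_ofFn_mul {m : ℕ} (hm : 0 < m) (X B : Fin m → Matrix (Fin N) (Fin N) ℂ) :
    (List.ofFn fun k => X k * B k).prod.trace = ∑ i : Fin m ⊕ Fin m → Fin N,
      (∏ k, B k (i (Sum.inr k)) (i (Sum.inl (finRotate m k)))) *
        ∏ k, X k (i (Sum.inl k)) (i (Sum.inr k)) := by
  rw [trace_prod_ofFn hm, ← (Equiv.sumArrowEquivProdArrow (Fin m) (Fin m) (Fin N)).symm.sum_comp,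
    Fintype.sum_prod_type]
  refine Finset.sum_congr rfl fun y _ => ?_
  simp only [Matrix.mul_apply]
  rw [Finset.prod_univ_sum, Fintype.piFinset_univ]
  refine Finset.sum_congr rfl fun z _ => ?_
  rw [Finset.prod_mul_distrib, mul_comm]
  rfl

theorem trace_word {j : Fin n} (hj : 0 < p j) (ω : Ω N) :
    (word p l a x A N j ω).trace = ((Real.sqrt N : ℝ) : ℂ)⁻¹ ^ p j *
      ∑ i : Fin (p j) ⊕ Fin (p j) → Fin N,
        (∏ k, A N (a ⟨j, k⟩) (i (Sum.inr k)) (i (Sum.inl (finRotate (p j) k)))) *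
          ∏ k, x N (l ⟨j, k⟩) ω (i (Sum.inl k)) (i (Sum.inr k)) := by
  rw [word, trace_prod_ofFn_mul hj, Finset.mul_sum]
  refine Finset.sum_congr rfl fun i _ => ?_
  simp only [normalized, Matrix.smul_apply, smul_eq_mul, Finset.prod_mul_distrib,
    Finset.prod_const, Finset.card_univ, Fintype.card_fin]
  ring

/-- The index maps of a family of words. -/
def indexEquiv (p : Fin n → ℕ) (α : Type*) :
    (∀ j, Fin (p j) ⊕ Fin (p j) → α) ≃ (Vtx p → α) where
  toFun i := Sum.elim (fun k => i k.1 (Sum.inl k.2)) fun k => i k.1 (Sum.inr k.2)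
  invFun i j := Sum.elim (fun k => i (Sum.inl ⟨j, k⟩)) fun k => i (Sum.inr ⟨j, k⟩)
  left_inv i := by funext j k; rcases k with k | k <;> rfl
  right_inv i := by funext k; rcases k with k | k <;> rfl

variable (x l) in
/-- The product of the entries of the Wigner matrices along a cycle. -/
def indexProd (i : Vtx p → Fin N) (j : Fin n) (ω : Ω N) : ℂ :=
  ∏ k : Fin (p j), x N (l ⟨j, k⟩) ω (i (Sum.inl ⟨j, k⟩)) (i (Sum.inr ⟨j, k⟩))

variable (A a) in
/-- The product of the entries of the deterministic matrices. -/
def indexDet (i : Vtx p → Fin N) : ℂ :=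
  ∏ k : Pos p, A N (a k) (i (Sum.inr k)) (i (Sum.inl (next p k)))

/-- Sums over index maps are decomposed according to the kernels of the maps. -/
theorem sum_index_eq_sum_kernel {V : Type*} [Fintype V] [Fintype (Setoid V)] [DecidableEq V]
    [∀ π : Setoid V, Fintype (Quotient π ↪ Fin N)] (f : (V → Fin N) → ℂ) :
    ∑ i, f i = ∑ π : Setoid V, ∑ ψ : Quotient π ↪ Fin N, f fun v => ψ (Quotient.mk π v) := by
  classical
  rw [← Finset.sum_fiberwise_of_maps_to (s := Finset.univ) (t := Finset.univ) (g := Setoid.ker)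
    (by simp)]
  refine Finset.sum_congr rfl fun π _ => ?_
  symm
  refine Finset.sum_bij (fun ψ _ v => ψ (Quotient.mk π v)) ?_ ?_ ?_ fun _ _ => rfl
  · intro ψ _
    rw [Finset.mem_filter]
    refine ⟨Finset.mem_univ _, Setoid.ext fun u v => ?_⟩
    rw [Setoid.ker_def, ψ.injective.eq_iff, Quotient.eq]
  · intro ψ _ ψ' _ h
    ext q
    obtain ⟨v, rfl⟩ := Quotient.exists_rep q
    exact congrArg Fin.val (congrFun h v)
  · intro i hi
    obtain rfl := (Finset.mem_filter.1 hi).2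
    refine ⟨⟨Quotient.lift i fun _ _ h => h, fun q q' => ?_⟩, Finset.mem_univ _, rfl⟩
    obtain ⟨v, rfl⟩ := Quotient.exists_rep q
    obtain ⟨v', rfl⟩ := Quotient.exists_rep q'
    exact fun h => Quotient.sound h

variable [∀ N, MeasurableSpace (Ω N)] {μ : ∀ N, Measure (Ω N)} [∀ N, IsProbabilityMeasure (μ N)]

theorem IsWignerFamily.integrable_prod_indexProd (hx : IsWignerFamily μ x) (i : Vtx p → Fin N)
    (S : Finset (Fin n)) : Integrable (fun ω => ∏ j ∈ S, indexProd x l i j ω) (μ N) := by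
  have h := hx.integrable_prod_entry (S.sigma fun j => (Finset.univ : Finset (Fin (p j)))) l
    (fun k => i (Sum.inl k)) (fun k => i (Sum.inr k))
  simp only [Finset.prod_sigma] at h
  exact h

theorem prod_sub_eq {c : Fin n → ℂ} (f : Fin n → ℂ) : ∏ j, (f j - c j) =
    ∑ S : Finset (Fin n), (∏ j ∈ S, f j) * (-1) ^ (n - S.card) * ∏ j ∈ Sᶜ, c j := by
  simp only [sub_eq_add_neg]
  rw [Finset.prod_add, Finset.powerset_univ]
  refine Finset.sum_congr rfl fun S _ => ?_
  rw [← Finset.compl_eq_univ_sdiff, Finset.prod_neg, Finset.card_compl, Fintype.card_fin, mul_assoc]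

theorem IsWignerFamily.integrable_prod_sub (hx : IsWignerFamily μ x) (i : Vtx p → Fin N)
    (c : Fin n → ℂ) : Integrable (fun ω => ∏ j, (indexProd x l i j ω - c j)) (μ N) := by
  simp only [prod_sub_eq]
  refine integrable_finsetSum _ fun S _ => ?_
  exact ((hx.integrable_prod_indexProd i S).mul_const _).mul_const _

theorem IsWignerFamily.integral_prod_sub (hx : IsWignerFamily μ x) (i : Vtx p → Fin N)
    (c : Fin n → ℂ) : ∫ ω, ∏ j, (indexProd x l i j ω - c j) ∂μ N =
      ∑ S : Finset (Fin n), (∫ ω, ∏ j ∈ S, indexProd x l i j ω ∂μ N) * (-1) ^ (n - S.card) *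
        ∏ j ∈ Sᶜ, c j := by
  simp only [prod_sub_eq]
  rw [integral_finsetSum _ fun S _ =>
    ((hx.integrable_prod_indexProd i S).mul_const _).mul_const _]
  refine Finset.sum_congr rfl fun S _ => ?_
  rw [integral_mul_const, integral_mul_const]

/-- Expansion of the moments of the traces (`θ = 0`) and of their central moments (`θ = 1`). -/
theorem IsWignerFamily.integral_prod_trace (hx : IsWignerFamily μ x) (hp : ∀ j, 0 < p j)
    (θ : ℂ) : ∫ ω, ∏ j, ((word p l a x A N j ω).trace
        - θ * ∫ ω', (word p l a x A N j ω').trace ∂μ N) ∂μ N =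
      ((Real.sqrt N : ℝ) : ℂ)⁻¹ ^ Fintype.card (Pos p) * ∑ i : Vtx p → Fin N, indexDet A a i *
        ∫ ω, ∏ j, (indexProd x l i j ω - θ * ∫ ω', indexProd x l i j ω' ∂μ N) ∂μ N := by
  set s := ((Real.sqrt N : ℝ) : ℂ)⁻¹
  set α : ∀ j, (Fin (p j) ⊕ Fin (p j) → Fin N) → ℂ := fun j i =>
    ∏ k, A N (a ⟨j, k⟩) (i (Sum.inr k)) (i (Sum.inl (finRotate (p j) k))) with hα
  set Y : ∀ j, (Fin (p j) ⊕ Fin (p j) → Fin N) → Ω N → ℂ := fun j i ω =>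
    ∏ k, x N (l ⟨j, k⟩) ω (i (Sum.inl k)) (i (Sum.inr k)) with hY
  have hint : ∀ j i, Integrable (Y j i) (μ N) := fun j i =>
    hx.integrable_prod_entry Finset.univ (fun k => l ⟨j, k⟩) _ _
  have htr : ∀ j ω, (word p l a x A N j ω).trace = s ^ p j * ∑ i, α j i * Y j i ω :=
    fun j ω => trace_word (hp j) ω
  have hE : ∀ j, ∫ ω, (word p l a x A N j ω).trace ∂μ N =
      s ^ p j * ∑ i, α j i * ∫ ω, Y j i ω ∂μ N := fun j => by
    simp only [htr]
    rw [integral_const_mul, integral_finsetSum _ fun i _ => (hint j i).const_mul _]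
    simp only [integral_const_mul]
  have hsub : ∀ j ω, (word p l a x A N j ω).trace - θ * ∫ ω', (word p l a x A N j ω').trace ∂μ N =
      s ^ p j * ∑ i, α j i * (Y j i ω - θ * ∫ ω', Y j i ω' ∂μ N) := fun j ω => by
    rw [htr, hE]
    simp only [mul_sub, Finset.sum_sub_distrib, Finset.mul_sum]
    congr 1
    exact Finset.sum_congr rfl fun i _ => by ring
  have hcard : Fintype.card (Pos p) = ∑ j, p j := by simp
  have hexp : ∀ ω, ∏ j, ((word p l a x A N j ω).trace
      - θ * ∫ ω', (word p l a x A N j ω').trace ∂μ N) = s ^ Fintype.card (Pos p) *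
      ∑ i : Vtx p → Fin N, indexDet A a i *
        ∏ j, (indexProd x l i j ω - θ * ∫ ω', indexProd x l i j ω' ∂μ N) := fun ω => by
    simp only [hsub]
    rw [Finset.prod_mul_distrib, Finset.prod_pow_eq_pow_sum, hcard, Finset.prod_univ_sum,
      Fintype.piFinset_univ, ← (indexEquiv p (Fin N)).sum_comp]
    congr 1
    refine Finset.sum_congr rfl fun i _ => ?_
    rw [Finset.prod_mul_distrib, indexDet, Fintype.prod_sigma]
    rfl
  simp only [hexp]
  rw [integral_const_mul, integral_finsetSum _ fun i _ => (hx.integrable_prod_sub i _).const_mul _]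
  simp only [integral_const_mul]

variable (a A) in
theorem injTraceA_eq (π : Setoid (Vtx p)) [F : Fintype (Quotient π ↪ Fin N)] :
    injTraceA a A N π =
      ∑ ψ : Quotient π ↪ Fin N, indexDet A a fun v => ψ (Quotient.mk π v) := by
  rw [injTraceA]
  exact Finset.sum_congr (Finset.ext fun ψ => by simp only [Finset.mem_univ]) fun ψ _ => rfl

theorem WignerHypothesis.integral_prod_indexProd (hx : WignerHypothesis μ x) {π : Setoid (Vtx p)}
    (ψ : Quotient π ↪ Fin N) :
    ∫ ω, ∏ j, (indexProd x l (fun v => ψ (Quotient.mk π v)) j ω - 0 *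
      ∫ ω', indexProd x l (fun v => ψ (Quotient.mk π v)) j ω' ∂μ N) ∂μ N = omegaX₁ l μ x N π := by
  simp only [zero_mul, sub_zero]
  rw [hx.omegaX₁_eq ψ, moment, ← posIn_univ]
  simp only [← prod_entryProd]
  rfl

theorem WignerHypothesis.integral_prod_indexProd_sub (hx : WignerHypothesis μ x)
    {π : Setoid (Vtx p)} (ψ : Quotient π ↪ Fin N) :
    ∫ ω, ∏ j, (indexProd x l (fun v => ψ (Quotient.mk π v)) j ω - 1 *
      ∫ ω', indexProd x l (fun v => ψ (Quotient.mk π v)) j ω' ∂μ N) ∂μ N = omegaX₂ l μ x N π := by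
  rw [hx.integral_prod_sub, hx.omegaX₂_eq ψ]
  simp only [moment, ← prod_entryProd, one_mul, Finset.prod_singleton]
  rfl

theorem WignerHypothesis.tau₁_eq (hx : WignerHypothesis μ x) (hp : ∀ j, 0 < p j)
    [Fintype (Setoid (Vtx p))] : tau₁ p l a μ x A N =
      ∑ π : Setoid (Vtx p), ((Real.sqrt N : ℝ) : ℂ)⁻¹ ^ (Fintype.card (Pos p) + 2 * n) *
        (omegaX₁ l μ x N π * injTraceA a A N π) := by
  classical
  have h := hx.integral_prod_trace (a := a) (A := A) (N := N) (l := l) hp 0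
  simp only [zero_mul, sub_zero] at h
  -- The `n` normalizations `1 / N` account for the `2 * n` in the exponent; the identity also holds
  -- at `N = 0`, where both sides are zero.
  have hN : (1 / (N : ℂ)) = ((Real.sqrt N : ℝ) : ℂ)⁻¹ ^ 2 := by
    rw [inv_pow, ← Complex.ofReal_pow, Real.sq_sqrt (Nat.cast_nonneg _), one_div,
      Complex.ofReal_natCast]
  rw [tau₁]
  simp only [Finset.prod_mul_distrib, Finset.prod_const, Finset.card_univ, Fintype.card_fin]
  rw [integral_const_mul, h, hN, ← pow_mul, ← mul_assoc, ← pow_add, add_comm (2 * n),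
    ← Finset.mul_sum, sum_index_eq_sum_kernel]
  congr 1
  refine Finset.sum_congr rfl fun π _ => ?_
  rw [injTraceA_eq, Finset.mul_sum]
  refine Finset.sum_congr rfl fun ψ _ => ?_
  rw [← hx.integral_prod_indexProd ψ, mul_comm]
  simp only [zero_mul, sub_zero]

theorem WignerHypothesis.tau₂_eq (hx : WignerHypothesis μ x) (hp : ∀ j, 0 < p j)
    [Fintype (Setoid (Vtx p))] : tau₂ p l a μ x A N =
      ∑ π : Setoid (Vtx p), ((Real.sqrt N : ℝ) : ℂ)⁻¹ ^ Fintype.card (Pos p) *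
        (omegaX₂ l μ x N π * injTraceA a A N π) := by
  classical
  have h := hx.integral_prod_trace (a := a) (A := A) (N := N) (l := l) hp 1
  simp only [one_mul] at h
  rw [tau₂, h, ← Finset.mul_sum, sum_index_eq_sum_kernel]
  congr 1
  refine Finset.sum_congr rfl fun π _ => ?_
  rw [injTraceA_eq, Finset.mul_sum]
  refine Finset.sum_congr rfl fun ψ _ => ?_
  rw [← hx.integral_prod_indexProd_sub ψ, mul_comm]
  simp only [one_mul]

/-! ### Convergence -/

/-- Exponents are integers in units of `N ^ (1/2)`, so a strict inequality gains at least one factor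
`N ^ (-1/2)`. -/
theorem tendsto_of_exponent_lt {w T : ℕ → ℂ} {C C' : ℝ} {E m : ℕ} (hw : ∀ N, ‖w N‖ ≤ C)
    (hT : ∀ N : ℕ, 0 < N → ‖T N‖ ≤ C' * (N : ℝ) ^ E) (hE : 2 * E < m) :
    Tendsto (fun N : ℕ => ((Real.sqrt N : ℝ) : ℂ)⁻¹ ^ m * (w N * T N)) atTop (𝓝 0) := by
  have hlim : Tendsto (fun N : ℕ => C * C' * (Real.sqrt N)⁻¹) atTop (𝓝 0) := by
    rw [← mul_zero (C * C')]
    exact (tendsto_inv_atTop_zero.comp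
      (Real.tendsto_sqrt_atTop.comp tendsto_natCast_atTop_atTop)).const_mul _
  refine squeeze_zero_norm' ?_ hlim
  filter_upwards [eventually_gt_atTop 0] with N hN
  have hN1 : (1 : ℝ) ≤ N := by exact_mod_cast hN
  set r := Real.sqrt N with hr
  have hr1 : 1 ≤ r := Real.one_le_sqrt.2 hN1
  have hr2 : (N : ℝ) = r ^ 2 := (Real.sq_sqrt (Nat.cast_nonneg _)).symm
  have hC : 0 ≤ C := (norm_nonneg _).trans (hw N)
  have h1 := hT N hN
  have hC' : 0 ≤ C' := by
    have := (norm_nonneg _).trans h1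
    exact nonneg_of_mul_nonneg_left this (by positivity)
  rw [norm_mul, norm_mul, norm_pow, norm_inv, Complex.norm_real, Real.norm_of_nonneg (by positivity)]
  calc (r⁻¹) ^ m * (‖w N‖ * ‖T N‖) ≤ (r⁻¹) ^ (2 * E + 1) * (C * (C' * (N : ℝ) ^ E)) := by
        gcongr ?_ * (?_ * ?_)
        · exact pow_le_pow_of_le_one (by positivity) (inv_le_one_of_one_le₀ hr1) hE
        · exact hw N
    _ = C * C' * r⁻¹ := by
        rw [hr2, ← pow_mul, pow_succ]
        have : r⁻¹ ^ (2 * E) * r ^ (2 * E) = 1 := by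
          rw [← mul_pow, inv_mul_cancel₀ (by positivity), one_pow]
        calc _ = (r⁻¹ ^ (2 * E) * r ^ (2 * E)) * (C * C' * r⁻¹) := by ring
          _ = _ := by rw [this, one_mul]

theorem rpow_neg_half_eq (N m : ℕ) :
    (((N : ℝ) ^ (-(m : ℝ) / 2) : ℝ) : ℂ) = ((Real.sqrt N : ℝ) : ℂ)⁻¹ ^ m := by
  have : (N : ℝ) ^ (-(m : ℝ) / 2) = (Real.sqrt N)⁻¹ ^ m := by
    rw [Real.sqrt_eq_rpow, ← Real.rpow_neg (Nat.cast_nonneg _), ← Real.rpow_natCast,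
      ← Real.rpow_mul (Nat.cast_nonneg _)]
    congr 1
    ring
  rw [this]
  push_cast
  rfl

/-- The argument common to both orders. On `S` the two terms agree exactly for each `N`, since `𝔣 =
m` identifies the normalizations or the weight vanishes; off `S` each term tends to zero. -/
theorem tendsto_sum_sub_sum_partitions {S : Set (Setoid (Vtx p))} [Fintype (Setoid (Vtx p))]
    (hA : ∀ b, ∃ C : ℝ, ∀ N, opNorm (A N b) ≤ C) {m : ℕ} {w : ℕ → Setoid (Vtx p) → ℂ}
    (hw : ∀ π, ∃ C : ℝ, ∀ N, ‖w N π‖ ≤ C)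
    (hS : ∀ π ∈ S, (∀ N, w N π = 0) ∨ ((cycA p).quot π).numLeaves = m)
    (hS' : ∀ π ∉ S, (∀ N, w N π = 0) ∨ 2 * traceExponent π < m) :
    Tendsto (fun N : ℕ => ∑ π : Setoid (Vtx p), ((Real.sqrt N : ℝ) : ℂ)⁻¹ ^ m *
      (w N π * injTraceA a A N π) - ∑ π ∈ partitions S, w N π * omegaA a A N π)
      atTop (𝓝 0) := by
  classical
  have e : ∀ N, ∑ π ∈ partitions S, w N π * omegaA a A N π =
      ∑ π : Setoid (Vtx p), if π ∈ S then w N π * omegaA a A N π else 0 := fun N => by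
    rw [← Finset.sum_filter]
    refine Finset.sum_congr ?_ fun _ _ => rfl
    ext π
    simp [partitions]
  simp only [e, ← Finset.sum_sub_distrib]
  rw [show 𝓝 (0 : ℂ) = 𝓝 (∑ _π : Setoid (Vtx p), 0) by rw [Finset.sum_const_zero]]
  refine tendsto_finsetSum _ fun π _ => ?_
  by_cases hπ : π ∈ S
  · refine tendsto_const_nhds.congr fun N => ?_
    rw [if_pos hπ]
    rcases hS π hπ with h | h
    · simp [h]
    · rw [omegaA, h, rpow_neg_half_eq]
      ring
  · simp only [if_neg hπ, sub_zero]
    rcases hS' π hπ with h | h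
    · simp [h]
    · obtain ⟨C, hC⟩ := hw π
      obtain ⟨C', hC'⟩ := exists_norm_injTraceA_le a A hA π
      exact tendsto_of_exponent_lt hC hC' h

theorem WignerHypothesis.tendsto_tau₁ (hx : WignerHypothesis μ x)
    (hA : ∀ b, ∃ C : ℝ, ∀ N, opNorm (A N b) ≤ C) (hp : ∀ j, 0 < p j) :
    Tendsto (fun N => tau₁ p l a μ x A N
      - ∑ π ∈ partitions (DT p n), omegaX₁ l μ x N π * omegaA a A N π) atTop (𝓝 0) := by
  have := Fintype.ofFinite (Setoid (Vtx p))
  simp only [hx.tau₁_eq hp]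
  refine tendsto_sum_sub_sum_partitions hA (w := fun N π => omegaX₁ l μ x N π)
    (hx.exists_norm_omegaX₁_le l) (fun π hπ => Or.inr (numLeaves_of_mem_DT hπ)) fun π hπ => ?_
  by_cases hm : ∀ k, 2 ≤ mult π (bundle π k)
  · exact Or.inr (two_mul_traceExponent_lt hm hπ)
  · exact Or.inl fun N => hx.omegaX₁_eq_zero hm

theorem WignerHypothesis.tendsto_tau₂ (hx : WignerHypothesis μ x)
    (hA : ∀ b, ∃ C : ℝ, ∀ N, opNorm (A N b) ≤ C) (hp : ∀ j, 0 < p j) :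
    Tendsto (fun N => tau₂ p l a μ x A N
      - ∑ π ∈ partitions (DUFT p), omegaX₂ l μ x N π * omegaA a A N π) atTop (𝓝 0) := by
  have := Fintype.ofFinite (Setoid (Vtx p))
  simp only [hx.tau₂_eq hp]
  refine tendsto_sum_sub_sum_partitions hA (w := fun N π => omegaX₂ l μ x N π)
    (hx.exists_norm_omegaX₂_le l) (fun π hπ => ?_) fun π hπ => ?_ <;>
    by_cases hm : ∀ k, 2 ≤ mult π (bundle π k)
  · exact Or.inr (numLeaves_of_mem_DUFT hm hπ)
  · exact Or.inl fun N => hx.omegaX₂_eq_zero hm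
  · by_cases hl : Linked π
    · exact Or.inr (two_mul_traceExponent_lt_of_linked hm hl hπ)
    · exact Or.inl fun N => hx.omegaX₂_eq_zero_of_not_linked hl
  · exact Or.inl fun N => hx.omegaX₂_eq_zero hm

end Expansion

end WignerTraffic

theorem mainTheorem5 {n : ℕ} {Λ J : Type*} {Ω : ℕ → Type*} [∀ N, MeasurableSpace (Ω N)]
    (μ : ∀ N, Measure (Ω N)) [∀ N, IsProbabilityMeasure (μ N)]
    (x : ∀ N, Λ → Ω N → Matrix (Fin N) (Fin N) ℂ) (hx : WignerTraffic.WignerHypothesis μ x)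
    (A : ∀ N, J → Matrix (Fin N) (Fin N) ℂ)
    (hA : ∀ b, ∃ C : ℝ, ∀ N, WignerTraffic.opNorm (A N b) ≤ C)
    (p : Fin n → ℕ) (hp : ∀ j, 0 < p j)
    (l : WignerTraffic.Pos p → Λ) (a : WignerTraffic.Pos p → J) :
    Tendsto (fun N => WignerTraffic.tau₁ p l a μ x A N
      - ∑ π ∈ WignerTraffic.partitions (WignerTraffic.DT p n),
          WignerTraffic.omegaX₁ l μ x N π * WignerTraffic.omegaA a A N π) atTop (𝓝 0) ∧
    Tendsto (fun N => WignerTraffic.tau₂ p l a μ x A N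
      - ∑ π ∈ WignerTraffic.partitions (WignerTraffic.DUFT p),
          WignerTraffic.omegaX₂ l μ x N π * WignerTraffic.omegaA a A N π) atTop (𝓝 0) ∧
    -- universality of the first order: any other family of Wigner matrices, such as the Gaussian
    -- one, has the same asymptotics
    (∀ (Ω' : ℕ → Type*) [∀ N, MeasurableSpace (Ω' N)] (ν : ∀ N, Measure (Ω' N))
      [∀ N, IsProbabilityMeasure (ν N)] (y : ∀ N, Λ → Ω' N → Matrix (Fin N) (Fin N) ℂ),
      WignerTraffic.WignerHypothesis ν y →
      Tendsto (fun N => WignerTraffic.tau₁ p l a μ x A N - WignerTraffic.tau₁ p l a ν y A N)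
        atTop (𝓝 0)) := by
  refine ⟨hx.tendsto_tau₁ hA hp, hx.tendsto_tau₂ hA hp, fun Ω' _ ν _ y hy => ?_⟩
  have h := (hx.tendsto_tau₁ (l := l) (a := a) hA hp).sub (hy.tendsto_tau₁ (l := l) (a := a) hA hp)
  rw [sub_zero] at h
  refine h.congr fun N => ?_
  -- The weights of the two families agree on `DT`, so the main sums are equal and cancel in the
  -- difference of the two expansions.
  rw [Finset.sum_congr rfl fun π hπ => by
    rw [hx.omegaX₁_universal hy ((Set.Finite.mem_toFinset _).1 hπ).2]]
  exact sub_sub_sub_cancel_right _ _ _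

end
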